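/- Let $S$ be a compact Polish space with Borel $\sigma$-algebra $\mathcal B(S)$, and let $\mathcal P(S)$ be the space of Borel probability measures on $S$ with the topology of weak convergence. Let $q:S\to\mathbb R$ be continuous with $K_1\le q(x)\le K_2$ for all $x\in S$, for some constants $0<K_1\le K_2<\infty$, and let $\alpha(x,dy)$ be a probability transition kernel on $S$, with $k$-step kernels $\alpha^{(k)}$. Assume: 1. (Feller) $x\mapsto\alpha(x,\cdot)$ is continuous from $S$ to $\mathcal P(S)$. 2. (Transitivity) There are positive integers $l_0,n_0$ such that for all $x,\zeta\in S$, $$\sum_{i\ge l_0}2^{-i}\alpha^{(i)}(x,dy)\ll\sum_{j\ge n_0}2^{-j}\alpha^{(j)}(\zeta,dy).$$ 3. $\tilde\pi$ is an invariant distribution of $\alpha$, and there are an integer $N\ge 0$ and a real $c>0$ with $\alpha^{(N)}(x,\cdot)\le c\,\tilde\pi(\cdot)$ for all $x\in S$. 4. The probability measure $\pi(A)=\int_A q^{-1}\,d\tilde\pi\big/\int_S q^{-1}\,d\tilde\pi$ has support $S$. 5. (Detailed balance) $q(x)\,\alpha(x,dy)\,\pi(dx)=q(y)\,\alpha(y,dx)\,\pi(dy)$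 as measures on $S\times S$. Let $(X_n)_{n\ge0}$ be a Markov chain in $S$ with transition kernel $\alpha$ and arbitrary initial distribution, and let $\tau_1,\tau_2,\dots$ be independent exponential random variables with mean $1$, independent of $(X_n)$. Put $s_i=\tau_i/q(X_{i-1})$, and let $X(t)=X_n$ for $\sum_{i=1}^n s_i\le t<\sum_{i=1}^{n+1}s_i$ be the resulting Markov jump process, with empirical measures $$\eta_T=\frac1T\int_0^T\delta_{X(t)}\,dt,\qquad T>0.$$ For $\eta\in H=\{\eta\in\mathcal P(S):\eta\ll\pi\}$ with $\theta=d\eta/d\pi$, put $$I(\eta)=\int_S q\,d\eta-\int_S\int_S\theta^{1/2}(x)\,\theta^{1/2}(y)\,q(x)\,\alpha(x,dy)\,\pi(dx),$$ and for every $\eta\in\mathcal P(S)$ let $$\bar I(\eta)=\liminf_{\nu\to\eta,\ \nu\in H}I(\nu)$$ be the lower semicontinuous regularization of $I$ (here $\nu=\eta$ is allowed if $\eta\in H$). Then $\bar I$ is lower semicontinuous on $\mathcal P(S)$, $\bar I=I$ on $H$, $0\le\bar I\le\sup_S q$ on $\mathcal P(S)$, and the family $(\eta_T)_{T>0}$ satisfies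 the large deviation bounds with rate function $\bar I$: for every open $O\subset\mathcal P(S)$, $$\liminf_{T\to\infty}\frac1T\log P(\eta_T\in O)\ge-\inf_{\eta\in O}\bar I(\eta),$$ and for every closed $C\subset\mathcal P(S)$, $$\limsup_{T\to\infty}\frac1T\log P(\eta_T\in C)\le-\inf_{\eta\in C}\bar I(\eta).$$ (Conventions: $\log 0=-\infty$, $\inf\emptyset=+\infty$.) -/

import Mathlib

open MeasureTheory ProbabilityTheory Filter Topology
open scoped ENNReal NNReal

namespace JumpLDP

noncomputable section

variable {S Ω : Type*}

section Conditions

variable [MeasurableSpace S] [MeasurableSpace Ω]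

/-- The probability measure proportional to `(1 / q) dπ'`. -/
def stationaryLaw (q : S → ℝ) (π' : Measure S) : Measure S :=
  (∫⁻ x, ENNReal.ofReal (1 / q x) ∂π')⁻¹ • π'.withDensity (fun x => ENNReal.ofReal (1 / q x))

/-- The Feller property: `x ↦ α(x, ·)` is continuous for the topology of weak convergence. -/
def IsFeller [TopologicalSpace S] [OpensMeasurableSpace S]
    (α : Kernel S S) [IsMarkovKernel α] : Prop :=
  Continuous (Y := ProbabilityMeasure S) (fun x => ⟨α x, inferInstance⟩)

/-- The measure `∑_{i ≥ l} 2^{-i} α^{(i)}(x, ·)`; here `α ^ i` is the `i`-step kernel. -/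
def tailSum (α : Kernel S S) (l : ℕ) (x : S) : Measure S :=
  Measure.sum (fun i : ℕ => (2⁻¹ : ℝ≥0∞) ^ (l + i) • (α ^ (l + i)) x)

/-- The transitivity condition. -/
def IsTransitive (α : Kernel S S) : Prop :=
  ∃ l₀ n₀ : ℕ, 0 < l₀ ∧ 0 < n₀ ∧ ∀ x ζ : S, tailSum α l₀ x ≪ tailSum α n₀ ζ

/-- The measure `q(x) α(x, dy) μ(dx)` on `S × S`. -/
def flux (q : S → ℝ) (α : Kernel S S) (μ : Measure S) : Measure (S × S) :=
  (μ ⊗ₘ α).withDensity (fun z => ENNReal.ofReal (q z.1))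

/-- Detailed balance: `q(x) α(x, dy) μ(dx) = q(y) α(y, dx) μ(dy)` as measures on `S × S`. -/
def DetailedBalance (q : S → ℝ) (α : Kernel S S) (μ : Measure S) : Prop :=
  (flux q α μ).map Prod.swap = flux q α μ

/-- The data of the construction of the jump process. `X` is a Markov chain with transition
kernel `α` (and arbitrary initial law); `τ 0, τ 1, …` are independent, exponential with mean one,
and independent of the chain. -/
structure IsJumpData (P : Measure Ω) (α : Kernel S S) (X : ℕ → Ω → S) (τ : ℕ → Ω → ℝ) :
    Prop where
  measurable_chain : ∀ n, Measurable (X n)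
  measurable_time : ∀ n, Measurable (τ n)
  markov : ∀ (n : ℕ) (Γ : Set S), MeasurableSet Γ →
    P[(X (n + 1) ⁻¹' Γ).indicator (fun _ => (1 : ℝ)) |
        ⨆ j ∈ Finset.range (n + 1), MeasurableSpace.comap (X j) inferInstance]
      =ᵐ[P] fun ω => (α (X n ω)).real Γ
  law_time : ∀ n, P.map (τ n) = expMeasure 1
  indep_times : iIndepFun τ P
  indep_chain : IndepFun (fun ω n => X n ω) (fun ω n => τ n ω) P

end Conditions

/-- The time `∑_{i < n} τ_i / q(X_i)` of the `n`-th jump. -/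
def jumpTime (q : S → ℝ) (X : ℕ → Ω → S) (τ : ℕ → Ω → ℝ) (n : ℕ) (ω : Ω) : ℝ :=
  ∑ i ∈ Finset.range n, τ i ω / q (X i ω)

/-- The number of jumps up to time `t`: the first `n` with `t < jumpTime (n + 1)`. -/
def jumpCount (q : S → ℝ) (X : ℕ → Ω → S) (τ : ℕ → Ω → ℝ) (t : ℝ) (ω : Ω) : ℕ :=
  sInf {n : ℕ | t < jumpTime q X τ (n + 1) ω}

/-- The Markov jump process: it equals `X n` on `[jumpTime n, jumpTime (n + 1))`. -/
def jumpProcess (q : S → ℝ) (X : ℕ → Ω → S) (τ : ℕ → Ω → ℝ) (t : ℝ) (ω : Ω) : S :=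
  X (jumpCount q X τ t ω) ω

theorem jumpProcess_eq (q : S → ℝ) (X : ℕ → Ω → S) (τ : ℕ → Ω → ℝ) (ω : Ω)
    (h0 : ∀ i, 0 ≤ τ i ω / q (X i ω)) (n : ℕ) (t : ℝ)
    (h1 : jumpTime q X τ n ω ≤ t) (h2 : t < jumpTime q X τ (n + 1) ω) :
    jumpProcess q X τ t ω = X n ω := by
  have hmono : Monotone (fun n => jumpTime q X τ n ω) := by
    refine monotone_nat_of_le_succ fun k => ?_
    simp only [jumpTime, Finset.sum_range_succ]
    linarith [h0 k]
  have : jumpCount q X τ t ω = n := by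
    refine le_antisymm (Nat.sInf_le h2) ?_
    refine le_csInf ⟨n, h2⟩ fun m hm => ?_
    by_contra hlt
    have : jumpTime q X τ (m + 1) ω ≤ jumpTime q X τ n ω := hmono (by omega)
    exact absurd hm (by simp only [Set.mem_ofPred_eq, not_lt]; linarith)
  rw [jumpProcess, this]

variable [MeasurableSpace S]

theorem measurable_jumpProcess_path (q : S → ℝ) (X : ℕ → Ω → S) (τ : ℕ → Ω → ℝ) (ω : Ω) :
    Measurable (fun t => jumpProcess q X τ t ω) := by
  have hN : Measurable (fun t => jumpCount q X τ t ω) := by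
    classical
    refine measurable_to_countable' fun n => ?_
    have hs : ∀ m, MeasurableSet {t : ℝ | t < jumpTime q X τ (m + 1) ω} :=
      fun m => measurableSet_Iio
    have key : (fun t => jumpCount q X τ t ω) ⁻¹' {n} =
        ({t | t < jumpTime q X τ (n + 1) ω} ∩
            ⋂ (m : ℕ) (_ : m < n), {t | t < jumpTime q X τ (m + 1) ω}ᶜ) ∪
          ({t | n = 0} ∩ ⋂ m : ℕ, {t | t < jumpTime q X τ (m + 1) ω}ᶜ) := by
      ext t
      simp only [Set.mem_preimage, Set.mem_singleton_iff, Set.mem_union, Set.mem_inter_iff,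
        Set.mem_iInter, Set.mem_compl_iff, Set.mem_ofPred_eq, jumpCount]
      constructor
      · intro h
        by_cases hne : {n : ℕ | t < jumpTime q X τ (n + 1) ω}.Nonempty
        · left
          subst h
          exact ⟨Nat.sInf_mem hne, fun m hm => Nat.notMem_of_lt_sInf hm⟩
        · right
          rw [Set.not_nonempty_iff_eq_empty] at hne
          rw [hne, Nat.sInf_empty] at h
          exact ⟨h.symm, fun m hm => by
            have : m ∈ {n : ℕ | t < jumpTime q X τ (n + 1) ω} := hm
            rw [hne] at this
            exact this⟩
      · rintro (⟨h1, h2⟩ | ⟨h1, h2⟩)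
        · refine le_antisymm (Nat.sInf_le h1) ?_
          refine le_csInf ⟨n, h1⟩ fun m hm => ?_
          by_contra hlt
          exact h2 m (by omega) hm
        · have : {n : ℕ | t < jumpTime q X τ (n + 1) ω} = ∅ :=
            Set.eq_empty_of_forall_notMem h2
          rw [this, Nat.sInf_empty, h1]
    rw [key]
    refine MeasurableSet.union (MeasurableSet.inter (hs n) ?_) (MeasurableSet.inter (.const _) ?_)
    · exact MeasurableSet.iInter fun m => MeasurableSet.iInter fun _ => (hs m).compl
    · exact MeasurableSet.iInter fun m => (hs m).compl
  exact (measurable_of_countable (fun n => X n ω)).comp hN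

/-- The measure `(1 / T) ∫_0^T δ_{X(t)} dt`. -/
def occupation (q : S → ℝ) (X : ℕ → Ω → S) (τ : ℕ → Ω → ℝ) (T : ℝ) (ω : Ω) : Measure S :=
  ENNReal.ofReal (1 / T) •
    (volume.restrict (Set.Ico 0 T)).map (fun t => jumpProcess q X τ t ω)

theorem isProbabilityMeasure_occupation (q : S → ℝ) (X : ℕ → Ω → S) (τ : ℕ → Ω → ℝ) (T : ℝ)
    (hT : 0 < T) (ω : Ω) : IsProbabilityMeasure (occupation q X τ T ω) := by
  refine ⟨?_⟩
  rw [occupation, Measure.smul_apply,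
    Measure.map_apply (measurable_jumpProcess_path q X τ ω) MeasurableSet.univ, Set.preimage_univ,
    Measure.restrict_apply_univ, Real.volume_Ico, sub_zero, smul_eq_mul,
    ← ENNReal.ofReal_mul (by positivity), one_div_mul_cancel hT.ne', ENNReal.ofReal_one]

open Classical in
/-- The empirical measure `η_T`, as a point of the space of probability measures. Only `T > 0`
is meaningful; for `T ≤ 0` the value is the Dirac mass at the initial state. -/
def empiricalMeasure (q : S → ℝ) (X : ℕ → Ω → S) (τ : ℕ → Ω → ℝ) (T : ℝ) (ω : Ω) :
    ProbabilityMeasure S :=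
  if hT : 0 < T then ⟨occupation q X τ T ω, isProbabilityMeasure_occupation q X τ T hT ω⟩
  else ⟨Measure.dirac (X 0 ω), inferInstance⟩

/-- For `η ≪ μ` with density `θ = dη/dμ`, the quantity
`∫ q dη - ∫∫ θ(x)^{1/2} θ(y)^{1/2} q(x) α(x, dy) μ(dx)`. -/
def rateOnAC (q : S → ℝ) (α : Kernel S S) (μ : Measure S) (η : ProbabilityMeasure S) : EReal :=
  ((∫⁻ x, ENNReal.ofReal (q x) ∂(η : Measure S) : ℝ≥0∞) : EReal) -
    ((∫⁻ x, ∫⁻ y, ((η : Measure S).rnDeriv μ x) ^ (1 / 2 : ℝ) *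
        ((η : Measure S).rnDeriv μ y) ^ (1 / 2 : ℝ) * ENNReal.ofReal (q x) ∂(α x) ∂μ : ℝ≥0∞) :
      EReal)

/-- The probability measures that are absolutely continuous with respect to `μ`. -/
def acMeasures (μ : Measure S) : Set (ProbabilityMeasure S) :=
  {η | (η : Measure S) ≪ μ}

/-- The rate function: the lower semicontinuous regularization, for weak convergence, of
`rateOnAC` from `acMeasures μ` to all probability measures,
`I(η) = liminf_{ν → η, ν ≪ μ} rateOnAC ν` (where `ν = η` is allowed if `η ≪ μ`). -/
def rate [TopologicalSpace S] [OpensMeasurableSpace S]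
    (q : S → ℝ) (α : Kernel S S) (μ : Measure S) (η : ProbabilityMeasure S) : EReal :=
  liminf (rateOnAC q α μ) (𝓝[acMeasures μ] η)

end

end JumpLDP

open JumpLDP

set_option linter.unusedSectionVars false

namespace JumpLDP

/-! ### The Dirichlet form and the jump gain -/

section Form

variable {S : Type*} [MeasurableSpace S]

/-! For a positive continuous `u` write `W_u = q - q (αu) / u` (`tiltPotential`). The analytic core
is a variational formula, valid for every probability measure `η`, singular ones included: `rateReal
η = sup_u ∫ W_u dη`.

One inequality (`ReversibleJump.integral_tiltPotential_le`) is AM-GM: `θ(x) u(y)/u(x) + θ(y)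
u(x)/u(y) ≥ 2 √(θ(x) θ(y))`, integrated against the flux, which detailed balance makes symmetric.
For the converse (`ReversibleJump.exists_rateReal_le`) the formal optimizer is `u = √θ`. It is
truncated, a large weight is added on the null set carrying the singular part of `η` (a set where
the chain cannot be after exactly `N` steps), and the result is approximated by a continuous
function. As a supremum of weakly continuous functionals, `rateReal` is lower semicontinuous.
Averaging the singular part over small balls approaches `η` by absolutely continuous measures whose
form is no smaller, so `rateReal` is the regularization (`ReversibleJump.rate_eq`).

The only probabilistic input is the identity `E[u(X(T)) exp(T ∫ W_u dη_T)] = E[u(X(0))]`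
(`IsJumpData.lintegral_exp_empiricalMeasure`). For the upper bound, a near-optimal `u` is chosen at
each point of the closed set; Chebyshev's inequality controls a neighbourhood of that point, and
compactness of the space of probability measures leaves finitely many neighbourhoods
(`ReversibleJump.exists_setLIntegral_le`).

The lower bound uses the same identity at a measure `ν` proportional to `f² dμ`. By the equality
case of AM-GM and transitivity, `ν` is the only measure with `rateReal η = ∫ W_f dη`
(`ReversibleJump.eq_squareLaw_of_rateReal_le`). The weighted upper bound then makes the contribution
from outside a neighbourhood of `ν` exponentially small, so the neighbourhood carries at least a
fixed amount of the weighted mass. Its weight there is at most about `exp(T ∫ W_f dν)`, which bounds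
its probability from below (`ReversibleJump.exists_le_measure`). Such `ν` approximate every
absolutely continuous measure together with its rate (`ReversibleJump.exists_squareLaw_mem`). -/

/-- The quantity `q(x) (∫ u(y) α(x, dy)) / u(x)`. -/
noncomputable def gain (q : S → ℝ) (α : Kernel S S) (u : S → ℝ≥0∞) (x : S) : ℝ≥0∞ :=
  ENNReal.ofReal (q x) * (∫⁻ y, u y ∂(α x)) / u x

/-- The bilinear form `∫∫ θ(x)^{1/2} θ(y)^{1/2} q(x) α(x, dy) μ(dx)`. -/
noncomputable def form (q : S → ℝ) (α : Kernel S S) (μ : Measure S) (θ : S → ℝ≥0∞) : ℝ≥0∞ :=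
  ∫⁻ x, ∫⁻ y, θ x ^ (1 / 2 : ℝ) * θ y ^ (1 / 2 : ℝ) * ENNReal.ofReal (q x) ∂(α x) ∂μ

variable {q : S → ℝ} {α : Kernel S S} {μ : Measure S}

theorem measurable_gain [IsMarkovKernel α] (hq : Measurable q) {u : S → ℝ≥0∞}
    (hu : Measurable u) : Measurable (gain q α u) := by
  unfold gain
  have := hu.lintegral_kernel (κ := α)
  fun_prop

theorem lintegral_flux [SFinite μ] [IsMarkovKernel α] (hq : Measurable q)
    {g : S × S → ℝ≥0∞} (hg : Measurable g) :
    ∫⁻ z, g z ∂(flux q α μ) = ∫⁻ x, ∫⁻ y, g (x, y) * ENNReal.ofReal (q x) ∂(α x) ∂μ := by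
  have hq' : Measurable (fun z : S × S => ENNReal.ofReal (q z.1)) := by fun_prop
  rw [flux, lintegral_withDensity_eq_lintegral_mul _ hq' hg, Measure.lintegral_compProd (by fun_prop)]
  simp [mul_comm]

theorem DetailedBalance.lintegral_swap (h : DetailedBalance q α μ) {g : S × S → ℝ≥0∞}
    (hg : Measurable g) :
    ∫⁻ z, g z.swap ∂(flux q α μ) = ∫⁻ z, g z ∂(flux q α μ) := by
  conv_rhs => rw [← h]
  rw [lintegral_map hg measurable_swap]

theorem form_eq_lintegral_flux [SFinite μ] [IsMarkovKernel α] (hq : Measurable q)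
    {θ : S → ℝ≥0∞} (hθ : Measurable θ) :
    form q α μ θ = ∫⁻ z, θ z.1 ^ (1 / 2 : ℝ) * θ z.2 ^ (1 / 2 : ℝ) ∂(flux q α μ) := by
  rw [lintegral_flux hq (by fun_prop)]
  rfl

theorem lintegral_mul_gain [SFinite μ] [IsMarkovKernel α] (hq : Measurable q)
    {θ u : S → ℝ≥0∞} (hθ : Measurable θ) (hu : Measurable u) :
    ∫⁻ x, θ x * gain q α u x ∂μ = ∫⁻ z, θ z.1 * (u z.2 / u z.1) ∂(flux q α μ) := by
  rw [lintegral_flux hq (by fun_prop)]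
  refine lintegral_congr fun x => ?_
  have : ∀ y, θ x * (u y / u x) * ENNReal.ofReal (q x)
      = (θ x * ENNReal.ofReal (q x) * (u x)⁻¹) * u y := fun y => by
    rw [ENNReal.div_eq_inv_mul]; ring
  simp only [this]
  rw [lintegral_const_mul _ hu, gain, ENNReal.div_eq_inv_mul]
  ring

/-- AM-GM for `a r` and `b / r`, whose product is `a b`. It is applied with `r = u(y) / u(x)`. -/
theorem _root_.ENNReal.two_mul_sqrt_mul_sqrt_le (a b : ℝ≥0∞) {r : ℝ≥0∞} (h0 : r ≠ 0)
    (ht : r ≠ ∞) :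
    2 * (a ^ (1 / 2 : ℝ) * b ^ (1 / 2 : ℝ)) ≤ a * r + b * r⁻¹ := by
  rcases eq_or_ne a ∞ with rfl | ha
  · simp [ENNReal.top_mul h0]
  rcases eq_or_ne b ∞ with rfl | hb
  · simp [ENNReal.top_mul (ENNReal.inv_ne_zero.2 ht)]
  lift a to ℝ≥0 using ha
  lift b to ℝ≥0 using hb
  lift r to ℝ≥0 using ht
  have hr : r ≠ 0 := by exact_mod_cast h0
  rw [← ENNReal.coe_inv hr, ← ENNReal.coe_rpow_of_nonneg _ (by norm_num),
    ← ENNReal.coe_rpow_of_nonneg _ (by norm_num), ← NNReal.sqrt_eq_rpow, ← NNReal.sqrt_eq_rpow]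
  norm_cast
  have h1 : NNReal.sqrt a * NNReal.sqrt b = NNReal.sqrt (a * r) * NNReal.sqrt (b * r⁻¹) := by
    rw [← NNReal.sqrt_mul, ← NNReal.sqrt_mul]; congr 1; field_simp
  rw [h1]
  have h2 := NNReal.sq_sqrt (a * r)
  have h3 := NNReal.sq_sqrt (b * r⁻¹)
  calc _ ≤ NNReal.sqrt (a * r) ^ 2 + NNReal.sqrt (b * r⁻¹) ^ 2 := by
        rw [← mul_assoc]; exact two_mul_le_add_sq _ _
    _ = _ := by rw [h2, h3]

theorem _root_.ENNReal.eq_of_two_mul_sqrt_mul_sqrt_eq {a b r : ℝ≥0∞} (ha : a ≠ ∞) (hb : b ≠ ∞)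
    (h0 : r ≠ 0) (ht : r ≠ ∞)
    (h : 2 * (a ^ (1 / 2 : ℝ) * b ^ (1 / 2 : ℝ)) = a * r + b * r⁻¹) : a * r = b * r⁻¹ := by
  lift a to ℝ≥0 using ha
  lift b to ℝ≥0 using hb
  lift r to ℝ≥0 using ht
  have hr : r ≠ 0 := by exact_mod_cast h0
  rw [← ENNReal.coe_inv hr, ← ENNReal.coe_rpow_of_nonneg _ (by norm_num),
    ← ENNReal.coe_rpow_of_nonneg _ (by norm_num), ← NNReal.sqrt_eq_rpow,
    ← NNReal.sqrt_eq_rpow] at h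
  rw [← ENNReal.coe_inv hr]
  norm_cast at h ⊢
  have h1 : NNReal.sqrt a * NNReal.sqrt b = NNReal.sqrt (a * r) * NNReal.sqrt (b * r⁻¹) := by
    rw [← NNReal.sqrt_mul, ← NNReal.sqrt_mul]; congr 1; field_simp
  rw [h1] at h
  have h2 := NNReal.sq_sqrt (a * r)
  have h3 := NNReal.sq_sqrt (b * r⁻¹)
  conv_rhs at h => rw [← h2, ← h3]
  have h4 : (NNReal.sqrt (a * r) : ℝ) = NNReal.sqrt (b * r⁻¹) := by
    have : (2 * (NNReal.sqrt (a * r) * NNReal.sqrt (b * r⁻¹)) : ℝ)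
      = NNReal.sqrt (a * r) ^ 2 + NNReal.sqrt (b * r⁻¹) ^ 2 := by exact_mod_cast h
    nlinarith [sq_nonneg ((NNReal.sqrt (a * r) : ℝ) - NNReal.sqrt (b * r⁻¹))]
  rw [← h2, ← h3, NNReal.coe_injective h4]

/-- The symmetrized integrand majorizing the Dirichlet form. -/
theorem two_mul_lintegral_mul_gain [SFinite μ] [IsMarkovKernel α] (hq : Measurable q)
    (hrev : DetailedBalance q α μ) {θ u : S → ℝ≥0∞} (hθ : Measurable θ) (hu : Measurable u) :
    2 * ∫⁻ x, θ x * gain q α u x ∂μ =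
      ∫⁻ z, (θ z.1 * (u z.2 / u z.1) + θ z.2 * (u z.1 / u z.2)) ∂(flux q α μ) := by
  rw [lintegral_add_left (by fun_prop), lintegral_mul_gain hq hθ hu, two_mul]
  congr 1
  exact (hrev.lintegral_swap (g := fun z => θ z.1 * (u z.2 / u z.1)) (by fun_prop)).symm

/-- Detailed balance averages the right-hand integrand with its swap, and AM-GM then applies
pointwise under the flux. -/
theorem form_le_lintegral_mul_gain [SFinite μ] [IsMarkovKernel α] (hq : Measurable q)
    (hrev : DetailedBalance q α μ) {θ u : S → ℝ≥0∞} (hθ : Measurable θ) (hu : Measurable u)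
    (hu0 : ∀ x, u x ≠ 0) (hut : ∀ x, u x ≠ ∞) :
    form q α μ θ ≤ ∫⁻ x, θ x * gain q α u x ∂μ := by
  have h : 2 * form q α μ θ ≤ 2 * ∫⁻ x, θ x * gain q α u x ∂μ := by
    rw [two_mul_lintegral_mul_gain hq hrev hθ hu, form_eq_lintegral_flux hq hθ,
      ← lintegral_const_mul _ (by fun_prop)]
    refine lintegral_mono fun z => ?_
    have := ENNReal.two_mul_sqrt_mul_sqrt_le (θ z.1) (θ z.2) (r := u z.2 / u z.1)
      (ENNReal.div_ne_zero.2 ⟨hu0 _, hut _⟩) (ENNReal.div_ne_top (hut _) (hu0 _))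
    rwa [ENNReal.inv_div (Or.inl (hut _)) (Or.inl (hu0 _))] at this
  exact (ENNReal.mul_le_mul_iff_right (by norm_num) (by norm_num)).1 h

theorem form_rnDeriv_le_lintegral_gain [IsFiniteMeasure μ] [IsMarkovKernel α] (hq : Measurable q)
    (hrev : DetailedBalance q α μ) {u : S → ℝ≥0∞} (hu : Measurable u)
    (hu0 : ∀ x, u x ≠ 0) (hut : ∀ x, u x ≠ ∞) (η : Measure S) [IsFiniteMeasure η] :
    form q α μ (η.rnDeriv μ) ≤ ∫⁻ x, gain q α u x ∂η := by
  refine (form_le_lintegral_mul_gain hq hrev (Measure.measurable_rnDeriv η μ) hu hu0 hut).trans ?_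
  have := lintegral_withDensity_eq_lintegral_mul μ (Measure.measurable_rnDeriv η μ)
    (measurable_gain (α := α) hq hu)
  simp only [Pi.mul_apply] at this
  rw [← this]
  exact lintegral_mono' (Measure.withDensity_rnDeriv_le η μ) le_rfl

/-- The equality case in `form_rnDeriv_le_lintegral_gain`. -/
theorem ac_and_ae_eq_of_lintegral_gain_le [IsFiniteMeasure μ] [IsMarkovKernel α]
    (hq : Measurable q) (hrev : DetailedBalance q α μ) {u : S → ℝ≥0∞} (hu : Measurable u)
    (hu0 : ∀ x, u x ≠ 0) (hut : ∀ x, u x ≠ ∞) (η : Measure S) [IsFiniteMeasure η]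
    (hpos : ∀ x, gain q α u x ≠ 0) (hfin : ∫⁻ x, gain q α u x ∂η ≠ ∞)
    (h : ∫⁻ x, gain q α u x ∂η ≤ form q α μ (η.rnDeriv μ)) :
    η ≪ μ ∧ ∀ᵐ z ∂(flux q α μ), η.rnDeriv μ z.1 ≠ ∞ → η.rnDeriv μ z.2 ≠ ∞ →
      η.rnDeriv μ z.1 / u z.1 ^ 2 = η.rnDeriv μ z.2 / u z.2 ^ 2 := by
  have hg := measurable_gain (α := α) hq hu
  have hθ := Measure.measurable_rnDeriv η μ
  have hdec : ∫⁻ x, gain q α u x ∂η =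
      ∫⁻ x, gain q α u x ∂(η.singularPart μ) + ∫⁻ x, η.rnDeriv μ x * gain q α u x ∂μ := by
    have := lintegral_withDensity_eq_lintegral_mul μ hθ hg
    simp only [Pi.mul_apply] at this
    rw [← this, ← lintegral_add_measure, ← Measure.haveLebesgueDecomposition_add]
  have hle := form_le_lintegral_mul_gain hq hrev hθ hu hu0 hut
  rw [hdec] at h hfin
  have hfin2 : ∫⁻ x, η.rnDeriv μ x * gain q α u x ∂μ ≠ ∞ :=
    (ENNReal.add_ne_top.1 hfin).2
  -- The absolutely continuous part alone already dominates the form, so nothing is left for the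
  -- singular part.
  have hs : ∫⁻ x, gain q α u x ∂(η.singularPart μ) = 0 := by
    have h' := h.trans hle
    by_contra hne
    exact absurd h' (not_le.2 (by
      conv_lhs => rw [← zero_add (∫⁻ x, η.rnDeriv μ x * gain q α u x ∂μ)]
      exact (ENNReal.add_lt_add_iff_right hfin2).2 (pos_iff_ne_zero.2 hne)))
  have hform : form q α μ (η.rnDeriv μ) = ∫⁻ x, η.rnDeriv μ x * gain q α u x ∂μ :=
    le_antisymm hle (by rwa [hs, zero_add] at h)
  refine ⟨?_, ?_⟩
  · rw [lintegral_eq_zero_iff hg] at hs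
    have : η.singularPart μ = 0 := by
      rw [← ae_eq_bot, ← eventually_false_iff_eq_bot]
      filter_upwards [hs] with x hx
      exact hpos x hx
    exact Measure.singularPart_eq_zero η μ |>.1 this
  -- The two sides of AM-GM have the same finite integral, hence agree almost everywhere; equality
  -- there means `θ / u²` takes the same value at both ends of the jump.
  · have h2 : ∫⁻ z, (η.rnDeriv μ z.1 * (u z.2 / u z.1) + η.rnDeriv μ z.2 * (u z.1 / u z.2))
        ∂(flux q α μ) ≤ ∫⁻ z, 2 * (η.rnDeriv μ z.1 ^ (1 / 2 : ℝ) *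
          η.rnDeriv μ z.2 ^ (1 / 2 : ℝ)) ∂(flux q α μ) := by
      rw [← two_mul_lintegral_mul_gain hq hrev hθ hu, ← hform, form_eq_lintegral_flux hq hθ,
        ← lintegral_const_mul _ (by fun_prop)]
    have hAM : ∀ z : S × S, 2 * (η.rnDeriv μ z.1 ^ (1 / 2 : ℝ) * η.rnDeriv μ z.2 ^ (1 / 2 : ℝ)) ≤
        η.rnDeriv μ z.1 * (u z.2 / u z.1) + η.rnDeriv μ z.2 * (u z.1 / u z.2) := fun z => by
      have := ENNReal.two_mul_sqrt_mul_sqrt_le (η.rnDeriv μ z.1) (η.rnDeriv μ z.2)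
        (r := u z.2 / u z.1)
        (ENNReal.div_ne_zero.2 ⟨hu0 _, hut _⟩) (ENNReal.div_ne_top (hut _) (hu0 _))
      rwa [ENNReal.inv_div (Or.inl (hut _)) (Or.inl (hu0 _))] at this
    have hfin3 : ∫⁻ z, 2 * (η.rnDeriv μ z.1 ^ (1 / 2 : ℝ) *
          η.rnDeriv μ z.2 ^ (1 / 2 : ℝ)) ∂(flux q α μ) ≠ ∞ := by
      rw [lintegral_const_mul _ (by fun_prop), ← form_eq_lintegral_flux hq hθ, hform]
      exact ENNReal.mul_ne_top (by norm_num) hfin2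
    filter_upwards [ae_eq_of_ae_le_of_lintegral_le (Eventually.of_forall hAM) hfin3
      (by fun_prop) h2] with z hz h1 h2
    have h3 := ENNReal.eq_of_two_mul_sqrt_mul_sqrt_eq h1 h2 (r := u z.2 / u z.1)
      (ENNReal.div_ne_zero.2 ⟨hu0 _, hut _⟩) (ENNReal.div_ne_top (hut _) (hu0 _))
      (by rwa [ENNReal.inv_div (Or.inl (hut _)) (Or.inl (hu0 _))])
    rw [ENNReal.inv_div (Or.inl (hut _)) (Or.inl (hu0 _))] at h3
    have key : ∀ a b s t : ℝ≥0∞, s ≠ 0 → s ≠ ∞ → t ≠ 0 → t ≠ ∞ → a * (t / s) = b * (s / t) →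
        a / s ^ 2 = b / t ^ 2 := by
      intro a b s t hs0 hst ht0 htt he
      rw [ENNReal.div_eq_inv_mul, ENNReal.div_eq_inv_mul] at he
      have e1 : a / s ^ 2 = (a * (s⁻¹ * t)) * (s⁻¹ * t⁻¹) := by
        rw [ENNReal.div_eq_inv_mul, ENNReal.inv_pow]
        calc (s⁻¹) ^ 2 * a = (s⁻¹) ^ 2 * a * (t * t⁻¹) := by
              rw [ENNReal.mul_inv_cancel ht0 htt, mul_one]
          _ = _ := by ring
      have e2 : b / t ^ 2 = (b * (t⁻¹ * s)) * (s⁻¹ * t⁻¹) := by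
        rw [ENNReal.div_eq_inv_mul, ENNReal.inv_pow]
        calc (t⁻¹) ^ 2 * b = (t⁻¹) ^ 2 * b * (s * s⁻¹) := by
              rw [ENNReal.mul_inv_cancel hs0 hst, mul_one]
          _ = _ := by ring
      rw [e1, e2, he]
    exact key _ _ _ _ (hu0 _) (hut _) (hu0 _) (hut _) h3

end Form

/-! ### Near-optimal measurable test functions -/

section NearOptimal

variable {S : Type*} [MeasurableSpace S] {q : S → ℝ} {α : Kernel S S} {μ : Measure S}

/-- The sets `√θ > k` decrease to `θ = ∞`, which is null for an integrable density. -/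
theorem exists_setLIntegral_sqrt_gt_lt {θ : S → ℝ≥0∞} (hθ : Measurable θ)
    (hfin : ∫⁻ x, θ x ∂μ ≠ ∞) {ε : ℝ≥0∞} (hε : ε ≠ 0) :
    ∃ k : ℕ, 1 ≤ k ∧ ∫⁻ x in {x | (k : ℝ≥0∞) < θ x ^ (1 / 2 : ℝ)}, θ x ∂μ < ε := by
  set s : ℕ → Set S := fun k => {x | (k : ℝ≥0∞) < θ x ^ (1 / 2 : ℝ)} with hs_def
  have hs : ∀ k, MeasurableSet (s k) := fun k => measurableSet_lt measurable_const (by fun_prop)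
  have hlim : Tendsto (fun k => μ.withDensity θ (s k)) atTop (𝓝 (μ.withDensity θ (⋂ k, s k))) := by
    refine tendsto_measure_iInter_atTop (fun k => (hs k).nullMeasurableSet) ?_ ⟨0, ?_⟩
    · intro i j hij x hx
      exact lt_of_le_of_lt (Nat.cast_le.2 hij) (show (j : ℝ≥0∞) < θ x ^ (1 / 2 : ℝ) from hx)
    · rw [withDensity_apply _ (hs 0)]
      exact ((setLIntegral_le_lintegral _ _).trans_lt hfin.lt_top).ne
  have hzero : μ.withDensity θ (⋂ k, s k) = 0 := by
    refine withDensity_absolutelyContinuous μ θ ?_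
    refine measure_mono_null ?_ (measure_eq_top_of_lintegral_ne_top hθ.aemeasurable hfin)
    intro x hx
    by_contra hne
    have : θ x ^ (1 / 2 : ℝ) ≠ ∞ := ENNReal.rpow_ne_top_of_nonneg (by norm_num) hne
    obtain ⟨n, hn⟩ := ENNReal.exists_nat_gt this
    exact absurd (Set.mem_iInter.1 hx n) (not_lt.2 hn.le)
  rw [hzero] at hlim
  obtain ⟨k, hk, hk1⟩ := ((hlim.eventually (gt_mem_nhds (pos_iff_ne_zero.2 hε))).and
    (eventually_ge_atTop 1)).exists
  exact ⟨k, hk1, by rwa [withDensity_apply _ (hs k)] at hk⟩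

/-- The function `θ^{1/2}` truncated to `[δ, k]`. -/
noncomputable def truncSqrt (θ : S → ℝ≥0∞) (δ k : ℝ≥0∞) (x : S) : ℝ≥0∞ :=
  max δ (min (θ x ^ (1 / 2 : ℝ)) k)

/-- Without truncation the ratio gives exactly `√θ(x) √θ(y)`. The lower cutoff adds `δ √θ(x)`; where
the upper cutoff acts at `x`, the ratio is at most one, which costs `θ(x)`. -/
theorem mul_truncSqrt_div_le {T : Type*} {θ : T → ℝ≥0∞} {δ k : ℝ≥0∞} (hδ : δ ≠ 0)
    (hδk : δ ≤ k) (hk : k ≠ ∞) (x y : T) :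
    θ x * (truncSqrt θ δ k y / truncSqrt θ δ k x) ≤
      θ x ^ (1 / 2 : ℝ) * θ y ^ (1 / 2 : ℝ) + δ * θ x ^ (1 / 2 : ℝ) +
        {x | k < θ x ^ (1 / 2 : ℝ)}.indicator θ x := by
  have hx0 : truncSqrt θ δ k x ≠ 0 := (lt_of_lt_of_le (pos_iff_ne_zero.2 hδ) (le_max_left _ _)).ne'
  have hyk : truncSqrt θ δ k y ≤ k := max_le hδk (min_le_right _ _)
  have hxt : truncSqrt θ δ k x ≠ ∞ :=
    ((max_le hδk (min_le_right _ _) : truncSqrt θ δ k x ≤ k).trans_lt hk.lt_top).ne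
  by_cases hx : k < θ x ^ (1 / 2 : ℝ)
  · rw [Set.indicator_of_mem (by exact hx)]
    have : truncSqrt θ δ k x = k := by
      rw [truncSqrt, min_eq_right hx.le, max_eq_right hδk]
    rw [this] at hx0 ⊢
    calc _ ≤ θ x * 1 := by gcongr; exact ENNReal.div_le_of_le_mul (by simpa using hyk)
      _ ≤ _ := by rw [mul_one]; exact le_add_self
  · rw [Set.indicator_of_notMem (by exact hx), add_zero]
    push Not at hx
    have h1 : θ x ^ (1 / 2 : ℝ) ≤ truncSqrt θ δ k x := by
      rw [truncSqrt, min_eq_left hx]; exact le_max_right _ _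
    have h2 : truncSqrt θ δ k y ≤ θ y ^ (1 / 2 : ℝ) + δ :=
      max_le le_add_self ((min_le_left _ _).trans le_self_add)
    have h3 : θ x = θ x ^ (1 / 2 : ℝ) * θ x ^ (1 / 2 : ℝ) := by
      rw [← ENNReal.rpow_add_of_nonneg _ _ (by norm_num) (by norm_num)]; norm_num
    calc θ x * (truncSqrt θ δ k y / truncSqrt θ δ k x)
        = θ x ^ (1 / 2 : ℝ) * truncSqrt θ δ k y *
            (θ x ^ (1 / 2 : ℝ) / truncSqrt θ δ k x) := by
          conv_lhs => rw [h3]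
          rw [ENNReal.div_eq_inv_mul, ENNReal.div_eq_inv_mul]; ring
      _ ≤ θ x ^ (1 / 2 : ℝ) * (θ y ^ (1 / 2 : ℝ) + δ) * 1 := by
          gcongr
          exact ENNReal.div_le_of_le_mul (by simpa using h1)
      _ = _ := by ring

theorem lintegral_mul_gain_truncSqrt_le [IsFiniteMeasure μ] [IsMarkovKernel α]
    (hq : Measurable q) {K : ℝ≥0∞} (hqK : ∀ x, ENNReal.ofReal (q x) ≤ K)
    {θ : S → ℝ≥0∞} (hθ : Measurable θ) {δ k : ℝ≥0∞} (hδ : δ ≠ 0) (hδk : δ ≤ k) (hk : k ≠ ∞) :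
    ∫⁻ x, θ x * gain q α (truncSqrt θ δ k) x ∂μ ≤ form q α μ θ +
      δ * (K * (μ Set.univ + ∫⁻ x, θ x ∂μ)) +
        (∫⁻ x in {x | k < θ x ^ (1 / 2 : ℝ)}, θ x ∂μ) * K := by
  have hu : Measurable (truncSqrt θ δ k) := by unfold truncSqrt; fun_prop
  have hs : MeasurableSet {x | k < θ x ^ (1 / 2 : ℝ)} :=
    measurableSet_lt measurable_const (by fun_prop)
  have hind : Measurable ({x | k < θ x ^ (1 / 2 : ℝ)}.indicator θ) := hθ.indicator hs
  have hfst : ∀ g : S → ℝ≥0∞, Measurable g →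
      ∫⁻ z, g z.1 ∂(flux q α μ) ≤ (∫⁻ x, g x ∂μ) * K := by
    intro g hg
    rw [lintegral_flux (g := fun z => g z.1) hq (by fun_prop), ← lintegral_mul_const _ hg]
    refine lintegral_mono fun x => ?_
    simp only [lintegral_const, measure_univ, mul_one]
    gcongr
    exact hqK x
  rw [lintegral_mul_gain hq hθ hu, form_eq_lintegral_flux hq hθ]
  calc _ ≤ ∫⁻ z, (θ z.1 ^ (1 / 2 : ℝ) * θ z.2 ^ (1 / 2 : ℝ) + δ * θ z.1 ^ (1 / 2 : ℝ) +
        {x | k < θ x ^ (1 / 2 : ℝ)}.indicator θ z.1) ∂(flux q α μ) :=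
        lintegral_mono fun z => mul_truncSqrt_div_le hδ hδk hk z.1 z.2
    _ = ∫⁻ z, θ z.1 ^ (1 / 2 : ℝ) * θ z.2 ^ (1 / 2 : ℝ) ∂(flux q α μ) +
        δ * ∫⁻ z, θ z.1 ^ (1 / 2 : ℝ) ∂(flux q α μ) +
        ∫⁻ z, {x | k < θ x ^ (1 / 2 : ℝ)}.indicator θ z.1 ∂(flux q α μ) := by
        rw [lintegral_add_right _ (by fun_prop), lintegral_add_right _ (by fun_prop),
          lintegral_const_mul _ (by fun_prop)]
    _ ≤ _ := by
        gcongr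
        · refine (hfst (fun x => θ x ^ (1 / 2 : ℝ)) (by fun_prop)).trans ?_
          rw [mul_comm]
          gcongr
          calc ∫⁻ x, θ x ^ (1 / 2 : ℝ) ∂μ ≤ ∫⁻ x, (1 + θ x) ∂μ := by
                refine lintegral_mono fun x => ?_
                rcases le_total (θ x) 1 with h | h
                · exact (ENNReal.rpow_le_one h (by norm_num)).trans le_self_add
                · refine le_trans ?_ le_add_self
                  conv_rhs => rw [← ENNReal.rpow_one (θ x)]
                  exact ENNReal.rpow_le_rpow_of_exponent_le h (by norm_num)
            _ = _ := by rw [lintegral_add_left measurable_const]; simp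
        · refine (hfst _ hind).trans_eq ?_
          rw [lintegral_indicator hs]

/-- A weight that is large on `A` and decreases quickly along the chain, for a set `A` that the
chain cannot be in after `N` steps. -/
noncomputable def exitWeight (α : Kernel S S) (A : Set S) (N : ℕ) (M : ℝ≥0∞) (x : S) : ℝ≥0∞ :=
  ∑ j ∈ Finset.range N, M ^ (j + 1) * (α ^ j) x A

theorem measurable_exitWeight {A : Set S} (hA : MeasurableSet A) (N : ℕ) (M : ℝ≥0∞) :
    Measurable (exitWeight α A N M) := by
  unfold exitWeight
  refine Finset.measurable_sum _ fun j _ => ?_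
  exact ((α ^ j).measurable_coe hA).const_mul _

theorem isMarkovKernel_pow [IsMarkovKernel α] (j : ℕ) : IsMarkovKernel (α ^ j) := by
  induction j with
  | zero => rw [pow_zero]; exact inferInstanceAs (IsMarkovKernel Kernel.id)
  | succ j ih =>
    rw [pow_succ]
    exact inferInstanceAs (IsMarkovKernel ((α ^ j) ∘ₖ α))

theorem exitWeight_le [IsMarkovKernel α] (A : Set S) (N : ℕ) (M : ℝ≥0∞) (x : S) :
    exitWeight α A N M x ≤ ∑ j ∈ Finset.range N, M ^ (j + 1) := by
  refine Finset.sum_le_sum fun j _ => ?_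
  have := isMarkovKernel_pow (α := α) j
  exact (mul_le_mul_right prob_le_one _).trans_eq (mul_one _)

theorem lintegral_exitWeight {A : Set S} (hA : MeasurableSet A) (N : ℕ) (M : ℝ≥0∞) (x : S) :
    ∫⁻ y, exitWeight α A N M y ∂(α x) =
      ∑ j ∈ Finset.range N, M ^ (j + 1) * (α ^ (j + 1)) x A := by
  unfold exitWeight
  rw [lintegral_finsetSum _ fun j _ => ((α ^ j).measurable_coe hA).const_mul _]
  refine Finset.sum_congr rfl fun j _ => ?_
  rw [lintegral_const_mul _ ((α ^ j).measurable_coe hA)]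
  have := Kernel.pow_add_apply_eq_lintegral α 1 j x hA
  rw [pow_one, add_comm 1 j] at this
  rw [this]

/-- One step of the chain shifts the sum by one index. The new top term is a multiple of `α^N(x, A)
= 0`, and the lost term `j = 0` is nonnegative, so the weight drops on average by a factor `M`. -/
theorem mul_lintegral_exitWeight_le {A : Set S} (hA : MeasurableSet A) {N : ℕ} (M : ℝ≥0∞) {x : S}
    (hN : (α ^ N) x A = 0) :
    M * ∫⁻ y, exitWeight α A N M y ∂(α x) ≤ exitWeight α A N M x := by
  have h1 : M * ∫⁻ y, exitWeight α A N M y ∂(α x) =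
      ∑ j ∈ Finset.range N, M ^ (j + 1 + 1) * (α ^ (j + 1)) x A := by
    rw [lintegral_exitWeight hA, Finset.mul_sum]
    exact Finset.sum_congr rfl fun j _ => by ring
  have h2 := Finset.sum_range_succ (fun j => M ^ (j + 1) * (α ^ j) x A) N
  rw [Finset.sum_range_succ', hN, mul_zero, add_zero] at h2
  rw [h1, exitWeight, ← h2]
  exact le_self_add

theorem le_exitWeight {A : Set S} {N : ℕ} (M : ℝ≥0∞) {x : S} (hx : x ∈ A)
    (hN : (α ^ N) x A = 0) : M ≤ exitWeight α A N M x := by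
  have h0 : (α ^ 0) x A = 1 := by
    rw [pow_zero]
    change Kernel.id x A = 1
    rw [Kernel.id_apply]
    exact Measure.dirac_apply_of_mem hx
  have hpos : 0 < N := by
    rcases Nat.eq_zero_or_pos N with rfl | h
    · rw [h0] at hN; exact absurd hN one_ne_zero
    · exact h
  calc M = M ^ (0 + 1) * (α ^ 0) x A := by rw [h0]; simp
    _ ≤ _ := Finset.single_le_sum (f := fun j => M ^ (j + 1) * (α ^ j) x A)
        (fun _ _ => zero_le) (Finset.mem_range.2 hpos)

/-- The test function is the truncated `√θ` plus an exit weight on the null set carrying the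
singular part. The weight makes the gain small on that set and is invisible `μ`-almost everywhere.
-/
theorem exists_measurable_lintegral_gain_le [IsFiniteMeasure μ] [IsMarkovKernel α]
    (hq : Measurable q) {K : ℝ≥0∞} (hK : K ≠ ∞) (hqK : ∀ x, ENNReal.ofReal (q x) ≤ K)
    (hnull : ∀ A, MeasurableSet A → μ A = 0 → ∀ k, ∀ᵐ x ∂μ, (α ^ k) x A = 0)
    {N : ℕ} (hN : ∀ A, MeasurableSet A → μ A = 0 → ∀ x, (α ^ N) x A = 0)
    (η : Measure S) [IsFiniteMeasure η] {ε : ℝ≥0∞} (hε : ε ≠ 0) :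
    ∃ (m M : ℝ≥0∞) (u : S → ℝ≥0∞), m ≠ 0 ∧ M ≠ ∞ ∧ Measurable u ∧ (∀ x, m ≤ u x ∧ u x ≤ M) ∧
      ∫⁻ x, gain q α u x ∂η ≤ form q α μ (η.rnDeriv μ) + ε := by
  set θ := η.rnDeriv μ with hθ_def
  have hθ : Measurable θ := Measure.measurable_rnDeriv η μ
  have hθfin : ∫⁻ x, θ x ∂μ ≠ ∞ := (Measure.lintegral_rnDeriv_lt_top η μ).ne
  have hε3 : ε / 3 ≠ 0 := ENNReal.div_ne_zero.2 ⟨hε, by norm_num⟩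
  obtain ⟨κ, hκ0, hκ⟩ := ENNReal.exists_nnreal_pos_mul_lt hK hε3
  obtain ⟨k, hk1, hk⟩ := exists_setLIntegral_sqrt_gt_lt (μ := μ) hθ hθfin
    (ε := κ) (by exact_mod_cast hκ0.ne')
  obtain ⟨δ', hδ0', hδ'⟩ := ENNReal.exists_nnreal_pos_mul_lt
    (a := K * (μ Set.univ + ∫⁻ x, θ x ∂μ))
    (ENNReal.mul_ne_top hK (ENNReal.add_ne_top.2 ⟨measure_ne_top _ _, hθfin⟩)) hε3
  set δ : ℝ≥0 := min δ' 1 with hδ_def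
  have hδ0 : (δ : ℝ≥0∞) ≠ 0 := by
    have : 0 < δ := lt_min hδ0' one_pos
    exact_mod_cast this.ne'
  have hδk : (δ : ℝ≥0∞) ≤ (k : ℝ≥0∞) := by
    have h1 : (δ : ℝ≥0∞) ≤ 1 := by exact_mod_cast min_le_right _ _
    exact h1.trans (by exact_mod_cast hk1)
  have hkt : (k : ℝ≥0∞) ≠ ∞ := ENNReal.natCast_ne_top k
  -- On the singular part the gain will be at most `r K (k + 1)`; this fixes `r`, and then the base
  -- `M = r⁻¹` of the exit weight.
  obtain ⟨r, hr0, hr⟩ := ENNReal.exists_nnreal_pos_mul_lt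
    (a := K * (k + 1) * η Set.univ)
    (ENNReal.mul_ne_top (ENNReal.mul_ne_top hK (by finiteness)) (measure_ne_top _ _)) hε3
  have hrpos : (r : ℝ≥0∞) ≠ 0 := by exact_mod_cast hr0.ne'
  set M : ℝ≥0∞ := (r : ℝ≥0∞)⁻¹ with hM_def
  have hMt : M ≠ ∞ := ENNReal.inv_ne_top.2 hrpos
  have hM0 : M ≠ 0 := ENNReal.inv_ne_zero.2 ENNReal.coe_ne_top
  have hMinv : M⁻¹ = r := inv_inv _
  obtain ⟨B, hB, hB1, hB2⟩ := Measure.mutuallySingular_singularPart η μ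
  -- `B` is null for the singular part, `Bᶜ` is null for `μ`
  have hA : MeasurableSet Bᶜ := hB.compl
  set u0 := truncSqrt θ δ k with hu0_def
  have hu0 : Measurable u0 := by rw [hu0_def]; unfold truncSqrt; fun_prop
  have hu0k : ∀ x, u0 x ≤ k := fun x => max_le hδk (min_le_right _ _)
  set w := exitWeight α Bᶜ N M with hw_def
  have hw : Measurable w := measurable_exitWeight hA N M
  have hu : Measurable (fun x => u0 x + w x) := hu0.add hw
  refine ⟨δ, k + ∑ j ∈ Finset.range N, M ^ (j + 1), fun x => u0 x + w x, hδ0, ?_, hu,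
    fun x => ⟨(le_max_left _ _).trans le_self_add,
      add_le_add (hu0k x) (exitWeight_le _ _ _ _)⟩, ?_⟩
  · exact ENNReal.add_ne_top.2 ⟨hkt, ENNReal.sum_ne_top.2 fun j _ => ENNReal.pow_ne_top hMt⟩
  have hg := measurable_gain (α := α) hq hu
  have hdec : ∫⁻ x, gain q α (fun x => u0 x + w x) x ∂η =
      ∫⁻ x, gain q α (fun x => u0 x + w x) x ∂(η.singularPart μ) +
        ∫⁻ x, θ x * gain q α (fun x => u0 x + w x) x ∂μ := by
    have := lintegral_withDensity_eq_lintegral_mul μ hθ hg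
    simp only [Pi.mul_apply] at this
    rw [← this, ← lintegral_add_measure, ← Measure.haveLebesgueDecomposition_add]
  have hsing : ∫⁻ x, gain q α (fun x => u0 x + w x) x ∂(η.singularPart μ) ≤ ε / 3 := by
    have hpt : ∀ x ∈ Bᶜ, gain q α (fun x => u0 x + w x) x ≤ r * (K * (k + 1)) := by
      intro x hx
      have hNx := hN _ hA hB2 x
      have hMx : M ≤ w x := le_exitWeight M hx hNx
      have hwt : w x ≠ ∞ := ((exitWeight_le _ _ _ _).trans_lt
        (ENNReal.sum_lt_top.2 fun j _ => (ENNReal.pow_ne_top hMt).lt_top)).ne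
      have hw0 : w x ≠ 0 := (lt_of_lt_of_le (pos_iff_ne_zero.2 hM0) hMx).ne'
      have h1 : ∫⁻ y, (u0 y + w y) ∂(α x) ≤ k + r * w x := by
        rw [lintegral_add_left hu0]
        gcongr
        · calc _ ≤ ∫⁻ _, (k : ℝ≥0∞) ∂(α x) := lintegral_mono hu0k
            _ = k := by simp
        · have := mul_lintegral_exitWeight_le (α := α) hA M hNx
          rw [← hMinv]
          calc _ = M⁻¹ * (M * ∫⁻ y, w y ∂(α x)) := by
                rw [← mul_assoc, ENNReal.inv_mul_cancel hM0 hMt, one_mul]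
            _ ≤ _ := by gcongr
      -- Since `w x ≥ M = r⁻¹`, the bounded part of the test function is also absorbed by a factor
      -- `r`.
      have h2 : (k : ℝ≥0∞) ≤ r * (k * w x) := by
        calc (k : ℝ≥0∞) = r * (k * M) := by
              rw [← hMinv, mul_comm (k : ℝ≥0∞), ← mul_assoc, ENNReal.inv_mul_cancel hM0 hMt,
                one_mul]
          _ ≤ _ := by gcongr
      unfold gain
      refine ENNReal.div_le_of_le_mul ?_
      calc ENNReal.ofReal (q x) * ∫⁻ y, (u0 y + w y) ∂(α x)
          ≤ K * (r * (k * w x) + r * w x) := by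
            gcongr
            · exact hqK x
            · exact h1.trans (add_le_add_left h2 _)
        _ = r * (K * (k + 1)) * w x := by ring
        _ ≤ _ := by gcongr; exact le_add_self
    have hae : ∀ᵐ x ∂(η.singularPart μ), x ∈ Bᶜ := compl_mem_ae_iff.2 hB1
    calc _ ≤ ∫⁻ _, r * (K * (k + 1)) ∂(η.singularPart μ) := by
          refine lintegral_mono_ae ?_
          filter_upwards [hae] with x hx using hpt x hx
      _ = r * (K * (k + 1)) * (η.singularPart μ) Set.univ := by simp
      _ ≤ r * (K * (k + 1)) * η Set.univ := by
          gcongr; exact Measure.singularPart_le η μ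
      _ = r * (K * (k + 1) * η Set.univ) := by ring
      _ ≤ ε / 3 := hr.le
  -- From `μ`-almost every point the null set is never charged, so both `w` and its one-step average
  -- vanish there.
  have hac : ∫⁻ x, θ x * gain q α (fun x => u0 x + w x) x ∂μ =
      ∫⁻ x, θ x * gain q α u0 x ∂μ := by
    refine lintegral_congr_ae ?_
    filter_upwards [ae_all_iff.2 (hnull _ hA hB2)] with x hx
    have h1 : w x = 0 := Finset.sum_eq_zero fun j _ => by rw [hx j, mul_zero]
    have h2 : ∫⁻ y, w y ∂(α x) = 0 := by
      rw [hw_def, lintegral_exitWeight hA]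
      exact Finset.sum_eq_zero fun j _ => by rw [hx (j + 1), mul_zero]
    simp only [gain]
    rw [lintegral_add_left hu0, h1, h2, add_zero, add_zero]
  rw [hdec, hac]
  have hmain := lintegral_mul_gain_truncSqrt_le (μ := μ) (α := α) hq hqK hθ hδ0 hδk hkt
  calc _ ≤ ε / 3 + (form q α μ θ + ε / 3 + ε / 3) := by
        refine add_le_add hsing (hmain.trans ?_)
        gcongr
        · refine le_trans ?_ hδ'.le
          gcongr
          exact min_le_left _ _
        · exact (mul_le_mul_left hk.le K).trans hκ.le
    _ = form q α μ θ + (ε / 3 + ε / 3 + ε / 3) := by ring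
    _ = _ := by rw [ENNReal.add_thirds]

end NearOptimal

/-! ### The variational formula for the rate -/

section Variational

/-- The gain is Lipschitz in the test function between the bounds `m` and `M`: the numerator
contributes the kernel average of the error `d`, the reciprocal contributes `d x`. -/
theorem gain_le_gain_add {S : Type*} [MeasurableSpace S] {q : S → ℝ} {α : Kernel S S}
    [IsMarkovKernel α] {u v d : S → ℝ≥0∞} (hu : Measurable u) {m M K : ℝ≥0∞}
    (hm : m ≠ 0) (hM : M ≠ ∞) (hqK : ∀ x, ENNReal.ofReal (q x) ≤ K)
    (humM : ∀ x, m ≤ u x ∧ u x ≤ M) (hvmM : ∀ x, m ≤ v x ∧ v x ≤ M)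
    (huv : ∀ x, u x ≤ v x + d x) (hvu : ∀ x, v x ≤ u x + d x) (x : S) :
    gain q α v x ≤ gain q α u x + K * (m⁻¹ * ∫⁻ y, d y ∂(α x) + M * (m⁻¹ * m⁻¹) * d x) := by
  have hu0 : u x ≠ 0 := (lt_of_lt_of_le (pos_iff_ne_zero.2 hm) (humM x).1).ne'
  have hut : u x ≠ ∞ := ((humM x).2.trans_lt hM.lt_top).ne
  have hv0 : v x ≠ 0 := (lt_of_lt_of_le (pos_iff_ne_zero.2 hm) (hvmM x).1).ne'
  have hvt : v x ≠ ∞ := ((hvmM x).2.trans_lt hM.lt_top).ne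
  have h1 : ∫⁻ y, v y ∂(α x) ≤ ∫⁻ y, u y ∂(α x) + ∫⁻ y, d y ∂(α x) := by
    rw [← lintegral_add_left hu]
    exact lintegral_mono hvu
  have h2 : (v x)⁻¹ ≤ (u x)⁻¹ + d x * (m⁻¹ * m⁻¹) := by
    calc (v x)⁻¹ = (v x)⁻¹ * (u x)⁻¹ * u x := by
          rw [mul_assoc, ENNReal.inv_mul_cancel hu0 hut, mul_one]
      _ ≤ (v x)⁻¹ * (u x)⁻¹ * (v x + d x) := by gcongr; exact huv x
      _ = (u x)⁻¹ * ((v x)⁻¹ * v x) + d x * ((v x)⁻¹ * (u x)⁻¹) := by ring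
      _ ≤ (u x)⁻¹ + d x * (m⁻¹ * m⁻¹) := by
          rw [ENNReal.inv_mul_cancel hv0 hvt, mul_one]
          gcongr
          · exact (hvmM x).1
          · exact (humM x).1
  have h3 : ∫⁻ y, u y ∂(α x) ≤ M := by
    calc _ ≤ ∫⁻ _, M ∂(α x) := lintegral_mono fun y => (humM y).2
      _ = M := by simp
  have h4 : (v x)⁻¹ ≤ m⁻¹ := ENNReal.inv_le_inv.2 (hvmM x).1
  have hQ := hqK x
  unfold gain
  rw [ENNReal.div_eq_inv_mul, ENNReal.div_eq_inv_mul]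
  set U := ∫⁻ y, u y ∂(α x)
  set D := ∫⁻ y, d y ∂(α x)
  set Q := ENNReal.ofReal (q x)
  calc (v x)⁻¹ * (Q * ∫⁻ y, v y ∂(α x)) ≤ (v x)⁻¹ * (Q * (U + D)) := by gcongr
    _ = (v x)⁻¹ * (Q * U) + Q * ((v x)⁻¹ * D) := by ring
    _ ≤ ((u x)⁻¹ + d x * (m⁻¹ * m⁻¹)) * (Q * U) + Q * (m⁻¹ * D) := by gcongr
    _ = (u x)⁻¹ * (Q * U) + (Q * (m⁻¹ * D) + Q * (U * (m⁻¹ * m⁻¹) * d x)) := by ring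
    _ ≤ (u x)⁻¹ * (Q * U) + (K * (m⁻¹ * D) + K * (M * (m⁻¹ * m⁻¹) * d x)) := by gcongr
    _ = _ := by ring

theorem exists_le_of_continuous {S : Type*} [TopologicalSpace S] [CompactSpace S] {f : S → ℝ} (hf : Continuous f) :
    ∃ K : ℝ, 0 < K ∧ ∀ x, |f x| ≤ K := by
  obtain ⟨K, hK⟩ := isCompact_univ.exists_bound_of_continuousOn hf.continuousOn
  exact ⟨max K 1, by positivity, fun x => (hK x trivial).trans (le_max_left _ _)⟩

theorem exists_pos_le_of_continuous {S : Type*} [TopologicalSpace S] [CompactSpace S] {f : S → ℝ} (hf : Continuous f)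
    (hpos : ∀ x, 0 < f x) : ∃ m : ℝ, 0 < m ∧ ∀ x, m ≤ f x := by
  rcases isEmpty_or_nonempty S with h | h
  · exact ⟨1, one_pos, fun x => h.elim x⟩
  · obtain ⟨x₀, -, hx₀⟩ := isCompact_univ.exists_isMinOn Set.univ_nonempty hf.continuousOn
    exact ⟨f x₀, hpos x₀, fun x => hx₀ (Set.mem_univ x)⟩

variable {S : Type*} [TopologicalSpace S] [MeasurableSpace S] [BorelSpace S]
  {q : S → ℝ} {α : Kernel S S} {μ : Measure S}

/-- The standing assumptions on a reversible jump kernel. -/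
structure ReversibleJump (q : S → ℝ) (α : Kernel S S) [IsMarkovKernel α] (μ : Measure S) :
    Prop where
  continuous_rate : Continuous q
  rate_pos : ∀ x, 0 < q x
  feller : IsFeller α
  trans : IsTransitive α
  null_ae : ∀ A, MeasurableSet A → μ A = 0 → ∀ k, ∀ᵐ x ∂μ, (α ^ k) x A = 0
  null : ∃ N : ℕ, ∀ A, MeasurableSet A → μ A = 0 → ∀ x, (α ^ N) x A = 0
  support_eq : μ.support = Set.univ
  balance : DetailedBalance q α μ

/-- The function `q(x) (∫ u(y) α(x, dy)) / u(x)`, for real-valued `u`. -/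
noncomputable def realGain (q : S → ℝ) (α : Kernel S S) (u : S → ℝ) (x : S) : ℝ :=
  q x * (∫ y, u y ∂(α x)) / u x

/-- The potential `- L u / u` of a positive function `u`, where `L` is the generator. -/
noncomputable def tiltPotential (q : S → ℝ) (α : Kernel S S) (u : S → ℝ) (x : S) : ℝ :=
  q x - realGain q α u x

/-- `∫ q dη` minus the Dirichlet form of the density of the absolutely continuous part of `η`. -/
noncomputable def rateReal (q : S → ℝ) (α : Kernel S S) (μ : Measure S)
    (η : ProbabilityMeasure S) : ℝ :=
  ∫ x, q x ∂(η : Measure S) - (form q α μ ((η : Measure S).rnDeriv μ)).toReal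

theorem integrable_of_continuous [CompactSpace S] {f : S → ℝ} (hf : Continuous f)
    (η : Measure S) [IsFiniteMeasure η] : Integrable f η := by
  obtain ⟨K, -, hK⟩ := exists_le_of_continuous hf
  exact Integrable.of_bound hf.measurable.aestronglyMeasurable K
    (Eventually.of_forall hK)

theorem IsFeller.continuous_integral [CompactSpace S] [IsMarkovKernel α] (h : IsFeller α)
    {u : S → ℝ} (hu : Continuous u) : Continuous (fun x => ∫ y, u y ∂(α x)) :=
  ProbabilityMeasure.continuous_iff_forall_continuousMap_continuous_integral.1 h ⟨u, hu⟩

theorem continuous_realGain [CompactSpace S] [IsMarkovKernel α] (h : IsFeller α)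
    (hq : Continuous q) {u : S → ℝ} (hu : Continuous u) (hpos : ∀ x, 0 < u x) :
    Continuous (realGain q α u) :=
  (hq.mul (h.continuous_integral hu)).div hu fun x => (hpos x).ne'

theorem continuous_tiltPotential [CompactSpace S] [IsMarkovKernel α] (h : IsFeller α)
    (hq : Continuous q) {u : S → ℝ} (hu : Continuous u) (hpos : ∀ x, 0 < u x) :
    Continuous (tiltPotential q α u) :=
  hq.sub (continuous_realGain h hq hu hpos)

theorem integral_kernel_pos [CompactSpace S] [IsMarkovKernel α] {u : S → ℝ} (hu : Continuous u)
    (hpos : ∀ x, 0 < u x) (x : S) : 0 < ∫ y, u y ∂(α x) := by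
  obtain ⟨m, hm, hmu⟩ := exists_pos_le_of_continuous hu hpos
  calc 0 < ∫ _, m ∂(α x) := by simpa using hm
    _ ≤ _ := integral_mono (integrable_const _) (integrable_of_continuous hu _) hmu

theorem realGain_pos [CompactSpace S] [IsMarkovKernel α] (hq : ∀ x, 0 < q x) {u : S → ℝ}
    (hu : Continuous u) (hpos : ∀ x, 0 < u x) (x : S) : 0 < realGain q α u x :=
  div_pos (mul_pos (hq x) (integral_kernel_pos hu hpos x)) (hpos x)

theorem gain_ofReal [CompactSpace S] [IsMarkovKernel α] (hq : ∀ x, 0 < q x) {u : S → ℝ}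
    (hu : Continuous u) (hpos : ∀ x, 0 < u x) (x : S) :
    gain q α (fun x => ENNReal.ofReal (u x)) x = ENNReal.ofReal (realGain q α u x) := by
  rw [gain, realGain, ENNReal.ofReal_div_of_pos (hpos x), ENNReal.ofReal_mul (hq x).le,
    ofReal_integral_eq_lintegral_ofReal (integrable_of_continuous hu _)
      (Eventually.of_forall fun y => (hpos y).le)]

theorem ofReal_integral_realGain [CompactSpace S] [IsMarkovKernel α] (h : IsFeller α)
    (hqc : Continuous q) (hq : ∀ x, 0 < q x) {u : S → ℝ} (hu : Continuous u) (hpos : ∀ x, 0 < u x)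
    (η : Measure S) [IsFiniteMeasure η] :
    ENNReal.ofReal (∫ x, realGain q α u x ∂η) =
      ∫⁻ x, gain q α (fun x => ENNReal.ofReal (u x)) x ∂η := by
  rw [ofReal_integral_eq_lintegral_ofReal
    (integrable_of_continuous (continuous_realGain h hqc hu hpos) _)
    (Eventually.of_forall fun y => (realGain_pos hq hu hpos y).le)]
  exact lintegral_congr fun x => (gain_ofReal hq hu hpos x).symm

variable [IsMarkovKernel α]

theorem ReversibleJump.form_le [CompactSpace S] [IsFiniteMeasure μ] (H : ReversibleJump q α μ)
    {u : S → ℝ} (hu : Continuous u) (hpos : ∀ x, 0 < u x) (η : Measure S) [IsFiniteMeasure η] :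
    form q α μ (η.rnDeriv μ) ≤ ENNReal.ofReal (∫ x, realGain q α u x ∂η) := by
  rw [ofReal_integral_realGain H.feller H.continuous_rate H.rate_pos hu hpos]
  exact form_rnDeriv_le_lintegral_gain H.continuous_rate.measurable H.balance
    (by fun_prop) (fun x => by simpa using hpos x) (fun x => ENNReal.ofReal_ne_top) η

theorem ReversibleJump.form_ne_top [CompactSpace S] [IsFiniteMeasure μ]
    (H : ReversibleJump q α μ) (η : Measure S) [IsFiniteMeasure η] :
    form q α μ (η.rnDeriv μ) ≠ ∞ :=
  ((H.form_le (u := fun _ => 1) continuous_const (fun _ => one_pos) η).trans_lt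
    ENNReal.ofReal_lt_top).ne

/-- Both terms are finite, so the `EReal` subtraction is the real one; absolute continuity plays no
role here. -/
theorem ReversibleJump.rateOnAC_eq [CompactSpace S] [IsFiniteMeasure μ]
    (H : ReversibleJump q α μ) (η : ProbabilityMeasure S) :
    rateOnAC q α μ η = (rateReal q α μ η : EReal) := by
  have hf := H.form_ne_top (η : Measure S)
  have h1 : ∫⁻ x, ENNReal.ofReal (q x) ∂(η : Measure S) =
      ENNReal.ofReal (∫ x, q x ∂(η : Measure S)) :=
    (ofReal_integral_eq_lintegral_ofReal (integrable_of_continuous H.continuous_rate _)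
      (Eventually.of_forall fun y => (H.rate_pos y).le)).symm
  have h2 : 0 ≤ ∫ x, q x ∂(η : Measure S) := integral_nonneg fun y => (H.rate_pos y).le
  have h3 : ((form q α μ ((η : Measure S).rnDeriv μ)).toReal : EReal) =
      (form q α μ ((η : Measure S).rnDeriv μ) : EReal) := by
    conv_rhs => rw [← ENNReal.ofReal_toReal hf, EReal.coe_ennreal_ofReal,
      max_eq_left ENNReal.toReal_nonneg]
  rw [rateReal, EReal.coe_sub, rateOnAC, h1, EReal.coe_ennreal_ofReal, max_eq_left h2, h3]
  rfl

/-- The easy half of the variational formula, from AM-GM. -/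
theorem ReversibleJump.integral_tiltPotential_le [CompactSpace S] [IsFiniteMeasure μ]
    (H : ReversibleJump q α μ) {u : S → ℝ} (hu : Continuous u) (hpos : ∀ x, 0 < u x)
    (η : ProbabilityMeasure S) :
    ∫ x, tiltPotential q α u x ∂(η : Measure S) ≤ rateReal q α μ η := by
  have h1 := H.form_le hu hpos (η : Measure S)
  have h0 : 0 ≤ ∫ x, realGain q α u x ∂(η : Measure S) :=
    integral_nonneg fun y => (realGain_pos H.rate_pos hu hpos y).le
  have h2 := ENNReal.toReal_mono ENNReal.ofReal_ne_top h1
  rw [ENNReal.toReal_ofReal h0] at h2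
  unfold tiltPotential rateReal
  rw [integral_sub (integrable_of_continuous H.continuous_rate _)
    (integrable_of_continuous (continuous_realGain H.feller H.continuous_rate hu hpos) _)]
  linarith

/-- Continuous functions are dense in `L¹`, and the change of gain is controlled by an `L¹`
distance. -/
theorem exists_continuous_lintegral_gain_le [PolishSpace S]
    (hq : Measurable q) {K : ℝ≥0∞} (hK : K ≠ ∞) (hqK : ∀ x, ENNReal.ofReal (q x) ≤ K)
    {u : S → ℝ≥0∞} (hu : Measurable u) {m M : ℝ≥0∞} (hm : m ≠ 0) (hM : M ≠ ∞)
    (humM : ∀ x, m ≤ u x ∧ u x ≤ M) (η : Measure S) [IsProbabilityMeasure η]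
    {ε : ℝ≥0∞} (hε : ε ≠ 0) :
    ∃ v : S → ℝ, Continuous v ∧ (∀ x, 0 < v x) ∧
      ∫⁻ x, gain q α (fun x => ENNReal.ofReal (v x)) x ∂η ≤ ∫⁻ x, gain q α u x ∂η + ε := by
  have hne : Nonempty S := nonempty_of_isProbabilityMeasure η
  have hmM : m ≤ M := (humM hne.some).1.trans (humM hne.some).2
  have hmt : m ≠ ∞ := (hmM.trans_lt hM.lt_top).ne
  have hm0' : 0 < m.toReal := ENNReal.toReal_pos hm hmt
  have hmM' : m.toReal ≤ M.toReal := ENNReal.toReal_mono hM hmM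
  have hut : ∀ x, u x ≠ ∞ := fun x => ((humM x).2.trans_lt hM.lt_top).ne
  set f : S → ℝ := fun x => (u x).toReal with hf_def
  have hfm : ∀ x, m.toReal ≤ f x ∧ f x ≤ M.toReal := fun x =>
    ⟨ENNReal.toReal_mono (hut x) (humM x).1, ENNReal.toReal_mono hM (humM x).2⟩
  have hfmeas : Measurable f := hu.ennreal_toReal
  -- The error appears both at the current state and, averaged, at the next one; this measure
  -- controls the two at once.
  set σ : Measure S := η + η.bind α with hσ_def
  have hbind : IsProbabilityMeasure (η.bind α) := inferInstance
  have hfint : Integrable f σ := by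
    refine Integrable.of_bound hfmeas.aestronglyMeasurable M.toReal (Eventually.of_forall fun x => ?_)
    rw [Real.norm_of_nonneg (hm0'.le.trans (hfm x).1)]
    exact (hfm x).2
  set C : ℝ≥0∞ := K * (m⁻¹ + M * (m⁻¹ * m⁻¹)) with hC_def
  have hCt : C ≠ ∞ := by
    have := ENNReal.inv_ne_top.2 hm
    rw [hC_def]; finiteness
  obtain ⟨δ, hδ0, hδ⟩ := ENNReal.exists_nnreal_pos_mul_lt hCt hε
  obtain ⟨g, hg, -⟩ := hfint.exists_boundedContinuous_lintegral_sub_le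
    (ε := (δ : ℝ≥0∞)) (by exact_mod_cast hδ0.ne')
  -- Clamping to the range of `u` keeps `v` positive and does not increase the distance to `u`.
  set v : S → ℝ := fun x => max m.toReal (min (g x) M.toReal) with hv_def
  have hvm : ∀ x, m.toReal ≤ v x ∧ v x ≤ M.toReal := fun x =>
    ⟨le_max_left _ _, max_le hmM' (min_le_right _ _)⟩
  have hvc : Continuous v := by rw [hv_def]; fun_prop
  refine ⟨v, hvc, fun x => hm0'.trans_le (hvm x).1, ?_⟩
  set d : S → ℝ≥0∞ := fun x => ENNReal.ofReal |f x - v x| with hd_def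
  have hd : Measurable d := by
    have := hvc.measurable
    rw [hd_def]; fun_prop
  have hdg : ∀ x, d x ≤ ‖f x - g x‖ₑ := by
    intro x
    rw [← ofReal_norm]
    refine ENNReal.ofReal_le_ofReal ?_
    rw [Real.norm_eq_abs]
    have h1 := hfm x
    have h2 : f x = max m.toReal (min (f x) M.toReal) := by
      rw [min_eq_left h1.2, max_eq_right h1.1]
    conv_lhs => rw [h2]
    rw [hv_def]
    calc |max m.toReal (min (f x) M.toReal) - max m.toReal (min (g x) M.toReal)|
        ≤ |min (f x) M.toReal - min (g x) M.toReal| := by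
          rw [max_comm m.toReal, max_comm m.toReal]; exact abs_max_sub_max_le_abs _ _ _
      _ ≤ _ := by
          have := abs_min_sub_min_le_max (f x) M.toReal (g x) M.toReal
          simpa using this
  have huf : ∀ x, u x = ENNReal.ofReal (f x) := fun x => (ENNReal.ofReal_toReal (hut x)).symm
  have hpt := gain_le_gain_add (q := q) (α := α) (v := fun x => ENNReal.ofReal (v x)) (d := d) hu
    hm hM hqK humM (fun x => ⟨(ENNReal.le_ofReal_iff_toReal_le hmt (hm0'.le.trans (hvm x).1)).2
      (hvm x).1, ENNReal.ofReal_le_of_le_toReal (hvm x).2⟩)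
    (fun x => by
      rw [huf x, hd_def, ← ENNReal.ofReal_add (hm0'.le.trans (hvm x).1) (abs_nonneg _)]
      refine ENNReal.ofReal_le_ofReal ?_
      linarith [le_abs_self (f x - v x)])
    (fun x => by
      rw [huf x, hd_def, ← ENNReal.ofReal_add (hm0'.le.trans (hfm x).1) (abs_nonneg _)]
      refine ENNReal.ofReal_le_ofReal ?_
      linarith [neg_abs_le (f x - v x)])
  have hdk : Measurable (fun x => ∫⁻ y, d y ∂(α x)) := hd.lintegral_kernel
  calc _ ≤ ∫⁻ x, (gain q α u x +
          K * (m⁻¹ * ∫⁻ y, d y ∂(α x) + M * (m⁻¹ * m⁻¹) * d x)) ∂η := lintegral_mono hpt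
    _ = ∫⁻ x, gain q α u x ∂η +
          K * (m⁻¹ * ∫⁻ x, ∫⁻ y, d y ∂(α x) ∂η + M * (m⁻¹ * m⁻¹) * ∫⁻ x, d x ∂η) := by
        rw [lintegral_add_left (measurable_gain hq hu), lintegral_const_mul _ (by fun_prop),
          lintegral_add_left (by fun_prop), lintegral_const_mul _ hdk, lintegral_const_mul _ hd]
    _ ≤ _ := by
        gcongr
        have h1 : ∫⁻ x, d x ∂η ≤ δ := by
          refine le_trans (lintegral_mono' ?_ hdg) hg
          rw [hσ_def]; exact Measure.le_add_right le_rfl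
        have h2 : ∫⁻ x, ∫⁻ y, d y ∂(α x) ∂η ≤ δ := by
          rw [← Measure.lintegral_bind α.measurable.aemeasurable hd.aemeasurable]
          refine le_trans (lintegral_mono' ?_ hdg) hg
          rw [hσ_def]; exact Measure.le_add_left le_rfl
        calc _ ≤ K * (m⁻¹ * δ + M * (m⁻¹ * m⁻¹) * δ) := by gcongr
          _ = δ * C := by rw [hC_def]; ring
          _ ≤ ε := hδ.le

/-- The hard half of the variational formula: half of `ε` pays for the measurable near-optimizer,
half for making it continuous. -/
theorem ReversibleJump.exists_rateReal_le [CompactSpace S] [PolishSpace S] [IsFiniteMeasure μ]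
    (H : ReversibleJump q α μ) (η : ProbabilityMeasure S) {ε : ℝ} (hε : 0 < ε) :
    ∃ u : S → ℝ, Continuous u ∧ (∀ x, 0 < u x) ∧
      rateReal q α μ η ≤ ∫ x, tiltPotential q α u x ∂(η : Measure S) + ε := by
  obtain ⟨K, hK0, hK⟩ := exists_le_of_continuous H.continuous_rate
  have hqK : ∀ x, ENNReal.ofReal (q x) ≤ ENNReal.ofReal K := fun x =>
    ENNReal.ofReal_le_ofReal ((le_abs_self _).trans (hK x))
  obtain ⟨N, hN⟩ := H.null
  have hε2 : ENNReal.ofReal (ε / 2) ≠ 0 := by simpa using hε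
  obtain ⟨m, M, u, hm, hM, hu, humM, h1⟩ := exists_measurable_lintegral_gain_le (μ := μ)
    H.continuous_rate.measurable ENNReal.ofReal_ne_top hqK H.null_ae hN (η : Measure S) hε2
  obtain ⟨v, hv, hv0, h2⟩ := exists_continuous_lintegral_gain_le (α := α)
    H.continuous_rate.measurable ENNReal.ofReal_ne_top hqK hu hm hM humM (η : Measure S) hε2
  refine ⟨v, hv, hv0, ?_⟩
  have h3 := h2.trans (add_le_add_left h1 _)
  rw [← ofReal_integral_realGain H.feller H.continuous_rate H.rate_pos hv hv0, add_assoc,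
    ← ENNReal.ofReal_add (by positivity) (by positivity), add_halves,
    ← ENNReal.ofReal_toReal (H.form_ne_top (η : Measure S)),
    ← ENNReal.ofReal_add ENNReal.toReal_nonneg hε.le,
    ENNReal.ofReal_le_ofReal_iff (add_nonneg ENNReal.toReal_nonneg hε.le)] at h3
  unfold tiltPotential rateReal
  rw [integral_sub (integrable_of_continuous H.continuous_rate _)
    (integrable_of_continuous (continuous_realGain H.feller H.continuous_rate hv hv0) _)]
  linarith

end Variational


/-! ### Smoothing a measure by local averages -/

section Smoothing

variable {S : Type*} [PseudoMetricSpace S] [SecondCountableTopology S] [MeasurableSpace S]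
  [BorelSpace S] {μ : Measure S}

/-- The density of the normalized restriction of `μ` to the ball of radius `r` at `x`. -/
noncomputable def ballDensity (μ : Measure S) (r : ℝ) (x y : S) : ℝ≥0∞ :=
  (μ (Metric.ball x r))⁻¹ * {z : S × S | dist z.2 z.1 < r}.indicator 1 (x, y)

theorem measurableSet_dist_lt (r : ℝ) : MeasurableSet {z : S × S | dist z.2 z.1 < r} :=
  measurableSet_lt (measurable_snd.dist measurable_fst) measurable_const

theorem measurable_ballDensity [IsFiniteMeasure μ] (r : ℝ) :
    Measurable (Function.uncurry (ballDensity μ r)) := by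
  have h1 : Measurable (fun x : S => μ (Metric.ball x r)) :=
    measurable_measure_prodMk_left (ν := μ) (measurableSet_dist_lt r)
  have h2 : Measurable ({z : S × S | dist z.2 z.1 < r}.indicator (1 : S × S → ℝ≥0∞)) :=
    measurable_one.indicator (measurableSet_dist_lt r)
  exact (h1.comp measurable_fst).inv.mul h2

theorem lintegral_ballDensity_mul {r : ℝ} {x : S} (h0 : μ (Metric.ball x r) ≠ 0) (h : S → ℝ≥0∞) :
    ∫⁻ y, ballDensity μ r x y * h y ∂μ =
      (μ (Metric.ball x r))⁻¹ * ∫⁻ y in Metric.ball x r, h y ∂μ := by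
  rw [← lintegral_indicator Metric.isOpen_ball.measurableSet, ← lintegral_const_mul' _ _
    (ENNReal.inv_ne_top.2 h0)]
  refine lintegral_congr fun y => ?_
  by_cases hy : y ∈ Metric.ball x r
  · have : (x, y) ∈ {z : S × S | dist z.2 z.1 < r} := hy
    rw [ballDensity, Set.indicator_of_mem this, Set.indicator_of_mem hy, Pi.one_apply, mul_one]
  · have : (x, y) ∉ {z : S × S | dist z.2 z.1 < r} := hy
    rw [ballDensity, Set.indicator_of_notMem this, Set.indicator_of_notMem hy, mul_zero,
      zero_mul]

theorem ball_ne_zero (hsupp : μ.support = Set.univ) {r : ℝ} (hr : 0 < r) (x : S) :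
    μ (Metric.ball x r) ≠ 0 :=
  ((Measure.mem_support_iff_forall x).1 (hsupp ▸ Set.mem_univ x) _
    (Metric.ball_mem_nhds x hr)).ne'

theorem lintegral_ballDensity [IsFiniteMeasure μ] (hsupp : μ.support = Set.univ) {r : ℝ}
    (hr : 0 < r) (x : S) : ∫⁻ y, ballDensity μ r x y ∂μ = 1 := by
  have h0 := ball_ne_zero hsupp hr x
  have := lintegral_ballDensity_mul h0 1
  simp only [Pi.one_apply, mul_one, lintegral_one, Measure.restrict_apply_univ] at this
  rw [this, ENNReal.inv_mul_cancel h0 (measure_ne_top _ _)]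

/-- Averages over shrinking balls converge at a point of continuity; full support makes every ball
chargeable. -/
theorem tendsto_lintegral_ballDensity_mul [IsFiniteMeasure μ] (hsupp : μ.support = Set.univ)
    {h : S → ℝ≥0} (hh : Continuous h) (x : S) :
    Tendsto (fun n : ℕ => ∫⁻ y, ballDensity μ (1 / (n + 1)) x y * h y ∂μ) atTop
      (𝓝 (h x)) := by
  rw [ENNReal.tendsto_nhds ENNReal.coe_ne_top]
  intro ε hε
  rcases eq_or_ne ε ∞ with rfl | hεt
  · simp
  lift ε to ℝ≥0 using hεt
  have hε' : 0 < ε := by exact_mod_cast hε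
  obtain ⟨δ, hδ, hball⟩ := Metric.continuousAt_iff.1 (hh.continuousAt (x := x)) (ε : ℝ)
    (by exact_mod_cast hε')
  have hr := tendsto_one_div_add_atTop_nhds_zero_nat (𝕜 := ℝ)
  filter_upwards [hr.eventually (gt_mem_nhds hδ)] with n hn
  have hpos : (0 : ℝ) < 1 / (n + 1) := by positivity
  have h1 := lintegral_ballDensity (μ := μ) hsupp hpos x
  have hmeas : Measurable (ballDensity μ (1 / (n + 1 : ℝ)) x) :=
    (measurable_ballDensity (μ := μ) _).of_uncurry_left
  have hzero : ∀ y, ¬ dist y x < 1 / (n + 1) → ballDensity μ (1 / (n + 1)) x y = 0 := fun y hy => by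
    have : (x, y) ∉ {z : S × S | dist z.2 z.1 < 1 / (n + 1 : ℝ)} := hy
    rw [ballDensity, Set.indicator_of_notMem this, mul_zero]
  have hclose : ∀ y, dist y x < 1 / (n + 1) → (h x : ℝ≥0∞) ≤ h y + ε ∧
      (h y : ℝ≥0∞) ≤ h x + ε := fun y hy => by
    have := hball (hy.trans hn)
    rw [NNReal.dist_eq, abs_lt] at this
    constructor
    · rw [← ENNReal.coe_add, ENNReal.coe_le_coe, ← NNReal.coe_le_coe]; push_cast; linarith
    · rw [← ENNReal.coe_add, ENNReal.coe_le_coe, ← NNReal.coe_le_coe]; push_cast; linarith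
  constructor
  · rw [tsub_le_iff_right]
    calc (h x : ℝ≥0∞) = ∫⁻ y, ballDensity μ (1 / (n + 1)) x y * h x ∂μ := by
          rw [lintegral_mul_const _ hmeas, h1, one_mul]
      _ ≤ ∫⁻ y, (ballDensity μ (1 / (n + 1)) x y * h y + ballDensity μ (1 / (n + 1)) x y * ε)
            ∂μ := by
          refine lintegral_mono fun y => ?_
          by_cases hy : dist y x < 1 / (n + 1)
          · rw [← mul_add]
            gcongr
            exact (hclose y hy).1
          · rw [hzero y hy, zero_mul]; exact zero_le
      _ = _ := by
          rw [lintegral_add_right _ (hmeas.mul_const _), lintegral_mul_const _ hmeas, h1, one_mul]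
  · calc _ ≤ ∫⁻ y, ballDensity μ (1 / (n + 1)) x y * (h x + ε) ∂μ := by
          refine lintegral_mono fun y => ?_
          by_cases hy : dist y x < 1 / (n + 1)
          · gcongr
            exact (hclose y hy).2
          · rw [hzero y hy, zero_mul]; exact zero_le
      _ = _ := by rw [lintegral_mul_const _ hmeas, h1, one_mul]

/-- Every probability measure is a weak limit of measures that are absolutely continuous with
respect to a measure of full support and whose densities dominate the one of the given measure. -/
theorem exists_seq_ac_tendsto [IsFiniteMeasure μ] (hsupp : μ.support = Set.univ)
    (η : ProbabilityMeasure S) :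
    ∃ ν : ℕ → ProbabilityMeasure S, Tendsto ν atTop (𝓝 η) ∧
      ∀ n, ν n ∈ acMeasures μ ∧ (η : Measure S).rnDeriv μ ≤ᵐ[μ] (ν n : Measure S).rnDeriv μ := by
  set θ := (η : Measure S).rnDeriv μ with hθ_def
  set σ := (η : Measure S).singularPart μ with hσ_def
  have hθ : Measurable θ := Measure.measurable_rnDeriv _ _
  -- Only the singular part is smoothed. The density `θ` is kept, which is why the new density `θ +
  -- g n` dominates it.
  set g : ℕ → S → ℝ≥0∞ := fun n y => ∫⁻ x, ballDensity μ (1 / (n + 1)) x y ∂σ with hg_def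
  have hbm : ∀ n : ℕ, Measurable (Function.uncurry (ballDensity μ (1 / (n + 1 : ℝ)))) :=
    fun n => measurable_ballDensity _
  have hg : ∀ n, Measurable (g n) := fun n => (hbm n).lintegral_prod_left'
  have hint : ∀ n, ∀ h : S → ℝ≥0∞, Measurable h →
      ∫⁻ y, h y ∂(μ.withDensity fun y => θ y + g n y) =
        ∫⁻ y, θ y * h y ∂μ + ∫⁻ x, ∫⁻ y, ballDensity μ (1 / (n + 1)) x y * h y ∂μ ∂σ := by
    intro n h hh
    have := lintegral_withDensity_eq_lintegral_mul μ (hθ.add (hg n)) hh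
    simp only [Pi.add_def] at this
    rw [this, lintegral_lintegral_swap]
    · rw [← lintegral_add_left (f := fun y => θ y * h y) (hθ.mul hh)]
      refine lintegral_congr fun y => ?_
      simp only [Pi.mul_apply, add_mul, hg_def]
      rw [lintegral_mul_const _ (hbm n).of_uncurry_right]
    · exact ((hbm n).mul (hh.comp measurable_snd)).aemeasurable
  have hdec : ∀ h : S → ℝ≥0∞, Measurable h →
      ∫⁻ y, θ y * h y ∂μ + ∫⁻ x, h x ∂σ = ∫⁻ x, h x ∂(η : Measure S) := by
    intro h hh
    have := lintegral_withDensity_eq_lintegral_mul μ hθ hh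
    simp only [Pi.mul_apply] at this
    rw [← this, add_comm, ← lintegral_add_measure, ← Measure.haveLebesgueDecomposition_add]
  have hprob : ∀ n, IsProbabilityMeasure (μ.withDensity fun y => θ y + g n y) := by
    intro n
    refine ⟨?_⟩
    have h1 := hint n 1 measurable_one
    have h2 := hdec 1 measurable_one
    simp only [Pi.one_apply, mul_one, lintegral_one] at h1 h2
    rw [h1]
    simp only [lintegral_ballDensity (μ := μ) hsupp (show (0 : ℝ) < 1 / (n + 1) by positivity)]
    rw [lintegral_one, h2, measure_univ]
  let ν : ℕ → ProbabilityMeasure S := fun n => ⟨_, hprob n⟩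
  refine ⟨ν, ?_, fun n => ⟨withDensity_absolutelyContinuous _ _, ?_⟩⟩
  · rw [ProbabilityMeasure.tendsto_iff_forall_lintegral_tendsto]
    intro h
    have hhm : Measurable (fun y => (h y : ℝ≥0∞)) := h.continuous.measurable.coe_nnreal_ennreal
    change Tendsto (fun n => ∫⁻ y, h y ∂(μ.withDensity fun y => θ y + g n y)) _ _
    simp only [fun n => hint n _ hhm]
    rw [← hdec _ hhm]
    refine tendsto_const_nhds.add ?_
    refine tendsto_lintegral_of_dominated_convergence (fun _ => (nndist h 0 : ℝ≥0∞)) ?_ ?_ ?_ ?_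
    · intro n
      exact ((hbm n).mul (hhm.comp measurable_snd)).lintegral_prod_right'
    · intro n
      refine Eventually.of_forall fun x => ?_
      calc _ ≤ ∫⁻ y, ballDensity μ (1 / (n + 1)) x y * (nndist h 0 : ℝ≥0∞) ∂μ := by
            refine lintegral_mono fun y => mul_le_mul_right ?_ _
            exact ENNReal.coe_le_coe.2 (BoundedContinuousFunction.NNReal.upper_bound h y)
        _ = _ := by
            rw [lintegral_mul_const _ (hbm n).of_uncurry_left,
              lintegral_ballDensity hsupp (by positivity), one_mul]
    · simp only [lintegral_const]
      exact ENNReal.mul_ne_top ENNReal.coe_ne_top (measure_ne_top _ _)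
    · exact Eventually.of_forall fun x => tendsto_lintegral_ballDensity_mul hsupp h.continuous x
  · filter_upwards [Measure.rnDeriv_withDensity μ (hθ.add (hg n))] with y hy
    change _ ≤ (μ.withDensity (θ + g n)).rnDeriv μ y
    rw [hy]
    exact le_self_add

end Smoothing

/-! ### Identification of the rate function and its basic properties -/

section Rate

variable {S : Type*} [TopologicalSpace S] [CompactSpace S] [PolishSpace S] [MeasurableSpace S]
  [BorelSpace S] {q : S → ℝ} {α : Kernel S S} [IsMarkovKernel α] {μ : Measure S}
  [IsFiniteMeasure μ]

theorem continuous_integral_of_continuous {f : S → ℝ} (hf : Continuous f) :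
    Continuous (fun η : ProbabilityMeasure S => ∫ x, f x ∂(η : Measure S)) :=
  ProbabilityMeasure.continuous_integral_continuousMap (⟨f, hf⟩ : C(S, ℝ))

/-- The form also evaluates the density after a jump, so the exceptional null set must be null for
`α(x, ·)` from almost every `x`. -/
theorem ReversibleJump.form_mono (H : ReversibleJump q α μ) {θ θ' : S → ℝ≥0∞}
    (hθ : Measurable θ) (hθ' : Measurable θ') (h : θ ≤ᵐ[μ] θ') :
    form q α μ θ ≤ form q α μ θ' := by
  have hA : MeasurableSet {x | ¬ θ x ≤ θ' x} := (measurableSet_le hθ hθ').compl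
  have h1 := H.null_ae _ hA h 1
  rw [pow_one] at h1
  refine lintegral_mono_ae ?_
  filter_upwards [h, h1] with x hx hx1
  refine lintegral_mono_ae ?_
  have hx2 : ∀ᵐ y ∂(α x), θ y ≤ θ' y := hx1
  filter_upwards [hx2] with y hy
  gcongr

/-- By the variational formula this is a supremum of weakly continuous functionals. -/
theorem ReversibleJump.lowerSemicontinuous_rateReal (H : ReversibleJump q α μ) :
    LowerSemicontinuous (rateReal q α μ) := by
  intro (η : ProbabilityMeasure S) a ha
  obtain ⟨u, hu, hu0, h1⟩ := H.exists_rateReal_le η (ε := (rateReal q α μ η - a) / 2)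
    (by linarith)
  have h2 : ∀ᶠ ν : ProbabilityMeasure S in 𝓝 η,
      a < ∫ x, tiltPotential q α u x ∂(ν : Measure S) :=
    ((continuous_integral_of_continuous
      (continuous_tiltPotential H.feller H.continuous_rate hu hu0)).tendsto η).eventually
      (lt_mem_nhds (by linarith))
  filter_upwards [h2] with ν hν
  exact hν.trans_le (H.integral_tiltPotential_le hu hu0 ν)

/-- Smoothing the singular part only increases the form, while `∫ q` converges, which gives the
upper bound. The lower bound is semicontinuity of `rateReal`. -/
theorem ReversibleJump.rate_eq (H : ReversibleJump q α μ) (η : ProbabilityMeasure S) :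
    rate q α μ η = (rateReal q α μ η : EReal) := by
  refine le_antisymm ?_ ?_
  · let := TopologicalSpace.upgradeIsCompletelyMetrizable S
    obtain ⟨ν, hν, hν'⟩ := exists_seq_ac_tendsto H.support_eq η
    have h1 : Tendsto ν atTop (𝓝[acMeasures μ] η) :=
      tendsto_nhdsWithin_iff.2 ⟨hν, Eventually.of_forall fun n => (hν' n).1⟩
    have h2 : rate q α μ η ≤ liminf (fun n => rateOnAC q α μ (ν n)) atTop :=
      liminf_le_liminf_of_le h1
    have h3 : Tendsto (fun n => ((∫ x, q x ∂(ν n : Measure S) -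
        (form q α μ ((η : Measure S).rnDeriv μ)).toReal : ℝ) : EReal)) atTop
        (𝓝 (rateReal q α μ η : EReal)) := by
      refine continuous_coe_real_ereal.continuousAt.tendsto.comp ?_
      exact (((continuous_integral_of_continuous H.continuous_rate).tendsto η).comp hν).sub_const _
    rw [← h3.liminf_eq]
    refine h2.trans (liminf_le_liminf (Eventually.of_forall fun n => ?_))
    rw [H.rateOnAC_eq, EReal.coe_le_coe_iff, rateReal]
    have := ENNReal.toReal_mono (H.form_ne_top (ν n : Measure S))
      (H.form_mono (Measure.measurable_rnDeriv _ _) (Measure.measurable_rnDeriv _ _) (hν' n).2)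
    linarith
  · refine le_of_forall_lt fun c hc => ?_
    obtain ⟨a, hca, ha⟩ := EReal.lt_iff_exists_real_btwn.1 hc
    rw [EReal.coe_lt_coe_iff] at ha
    refine hca.trans_le ?_
    rw [rate]
    refine le_liminf_of_le (h := ?_)
    filter_upwards [nhdsWithin_le_nhds (H.lowerSemicontinuous_rateReal η a ha)] with ν hν
    rw [H.rateOnAC_eq, EReal.coe_le_coe_iff]
    exact hν.le

theorem ReversibleJump.lowerSemicontinuous_rate (H : ReversibleJump q α μ) :
    LowerSemicontinuous (rate q α μ) := by
  intro (η : ProbabilityMeasure S) c hc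
  rw [H.rate_eq] at hc
  obtain ⟨a, hca, ha⟩ := EReal.lt_iff_exists_real_btwn.1 hc
  rw [EReal.coe_lt_coe_iff] at ha
  filter_upwards [H.lowerSemicontinuous_rateReal η a ha] with ν hν
  rw [H.rate_eq]
  exact hca.trans (EReal.coe_lt_coe_iff.2 hν)

theorem ReversibleJump.rateReal_nonneg (H : ReversibleJump q α μ) (η : ProbabilityMeasure S) :
    0 ≤ rateReal q α μ η := by
  have := H.integral_tiltPotential_le (u := fun _ => 1) continuous_const (fun _ => one_pos) η
  simpa [tiltPotential, realGain] using this

theorem ReversibleJump.rateReal_le (H : ReversibleJump q α μ) (η : ProbabilityMeasure S) :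
    rateReal q α μ η ≤ ⨆ x, q x := by
  obtain ⟨K, -, hK⟩ := exists_le_of_continuous H.continuous_rate
  have hbdd : BddAbove (Set.range q) := ⟨K, by
    rintro _ ⟨x, rfl⟩; exact (le_abs_self _).trans (hK x)⟩
  have h1 : ∫ x, q x ∂(η : Measure S) ≤ ∫ _, (⨆ x, q x) ∂(η : Measure S) :=
    integral_mono (integrable_of_continuous H.continuous_rate _) (integrable_const _)
      fun x => le_ciSup hbdd x
  rw [integral_const, probReal_univ, one_smul] at h1
  have := ENNReal.toReal_nonneg (a := form q α μ ((η : Measure S).rnDeriv μ))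
  rw [rateReal]
  linarith

end Rate

/-! ### Measures with squared continuous density -/

section SquareLaw

variable {S : Type*} [TopologicalSpace S] [CompactSpace S] [PolishSpace S] [MeasurableSpace S]
  [BorelSpace S] {q : S → ℝ} {α : Kernel S S} [IsMarkovKernel α] {μ : Measure S}
  [IsProbabilityMeasure μ]

/-- The probability measure proportional to `f² dμ`. -/
noncomputable def squareLaw (μ : Measure S) (f : S → ℝ) : Measure S :=
  (∫⁻ x, ENNReal.ofReal (f x) ^ 2 ∂μ)⁻¹ • μ.withDensity fun x => ENNReal.ofReal (f x) ^ 2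

theorem lintegral_sq_ne {f : S → ℝ} (hf : Continuous f) (hpos : ∀ x, 0 < f x) :
    ∫⁻ x, ENNReal.ofReal (f x) ^ 2 ∂μ ≠ 0 ∧ ∫⁻ x, ENNReal.ofReal (f x) ^ 2 ∂μ ≠ ∞ := by
  have hm := hf.measurable
  constructor
  · rw [Ne, lintegral_eq_zero_iff (by fun_prop)]
    intro h
    obtain ⟨x, hx⟩ := h.exists
    simp only [Pi.zero_apply, pow_eq_zero_iff two_ne_zero, ENNReal.ofReal_eq_zero] at hx
    exact absurd hx (not_le.2 (hpos x))
  · obtain ⟨K, -, hK⟩ := exists_le_of_continuous hf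
    refine ((lintegral_mono fun x => ?_ : _ ≤ ∫⁻ _, ENNReal.ofReal K ^ 2 ∂μ).trans_lt ?_).ne
    · gcongr
      exact (le_abs_self _).trans (hK x)
    · simp

theorem isProbabilityMeasure_squareLaw {f : S → ℝ} (hf : Continuous f) (hpos : ∀ x, 0 < f x) :
    IsProbabilityMeasure (squareLaw μ f) := by
  obtain ⟨h0, ht⟩ := lintegral_sq_ne (μ := μ) hf hpos
  refine ⟨?_⟩
  rw [squareLaw, Measure.smul_apply, withDensity_apply _ MeasurableSet.univ, setLIntegral_univ,
    smul_eq_mul, ENNReal.inv_mul_cancel h0 ht]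

theorem integral_squareLaw {f : S → ℝ} (hf : Continuous f) (hpos : ∀ x, 0 < f x) (h : S → ℝ) :
    ∫ x, h x ∂(squareLaw μ f) = (∫ x, f x * f x ∂μ)⁻¹ * ∫ x, h x * f x * f x ∂μ := by
  have hm := hf.measurable
  have hZ : (∫⁻ x, ENNReal.ofReal (f x) ^ 2 ∂μ).toReal = ∫ x, f x * f x ∂μ := by
    rw [integral_eq_lintegral_of_nonneg_ae
      (Eventually.of_forall fun x => mul_self_nonneg _) (hf.mul hf).aestronglyMeasurable]
    congr 1
    refine lintegral_congr fun x => ?_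
    rw [ENNReal.ofReal_mul (hpos x).le, pow_two]
  rw [squareLaw, integral_smul_measure, integral_withDensity_eq_integral_toReal_smul
    (by fun_prop) (Eventually.of_forall fun x => by finiteness), ENNReal.toReal_inv, hZ,
    smul_eq_mul]
  congr 1
  refine integral_congr_ae (Eventually.of_forall fun x => ?_)
  simp only [smul_eq_mul, ENNReal.toReal_pow, ENNReal.toReal_ofReal (hpos x).le]
  ring

/-- A function that is almost surely preserved by the chain is almost surely constant. -/
theorem ReversibleJump.ae_const_of_ae_eq (H : ReversibleJump q α μ) {r : S → ℝ≥0∞}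
    (hr : Measurable r) (h : ∀ᵐ x ∂μ, ∀ᵐ y ∂(α x), r y = r x) : ∃ c, ∀ᵐ x ∂μ, r x = c := by
  -- A measurable null set containing all bad starting points; from almost every state the chain
  -- avoids it at every step, so `r` is preserved by all powers.
  set D : Set S := toMeasurable μ {x | ¬ ∀ᵐ y ∂(α x), r y = r x} with hD
  have hD0 : μ D = 0 := by rw [hD, measure_toMeasurable]; exact h
  have hDm : MeasurableSet D := measurableSet_toMeasurable _ _
  have hsub : ∀ x, x ∉ D → ∀ᵐ y ∂(α x), r y = r x := fun x hx => by
    by_contra hne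
    exact hx (subset_toMeasurable _ _ hne)
  have hk : ∀ᵐ x ∂μ, ∀ k, ∀ᵐ y ∂((α ^ k) x), r y = r x := by
    filter_upwards [ae_all_iff.2 (H.null_ae D hDm hD0)] with x hx k
    have hmeas : MeasurableSet {y | r y = r x} := measurableSet_eq_fun hr measurable_const
    induction k with
    | zero =>
      rw [pow_zero]
      change ∀ᵐ y ∂(Kernel.id x), r y = r x
      rw [Kernel.id_apply, ae_dirac_iff hmeas]
    | succ k ih =>
      rw [pow_succ']
      change ∀ᵐ y ∂((α ∘ₖ (α ^ k)) x), r y = r x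
      refine Kernel.ae_comp_of_ae_ae hmeas ?_
      have hx' : ∀ᵐ y ∂((α ^ k) x), y ∉ D := measure_eq_zero_iff_ae_notMem.1 (hx k)
      filter_upwards [ih, hx'] with y hy1 hy2
      filter_upwards [hsub y hy2] with z hz
      rw [hz, hy1]
  obtain ⟨x₀, hx₀⟩ := hk.exists
  refine ⟨r x₀, ?_⟩
  obtain ⟨l₀, n₀, -, -, hac⟩ := H.trans
  have hmeas : MeasurableSet {y | ¬ r y = r x₀} :=
    (measurableSet_eq_fun hr measurable_const).compl
  filter_upwards [hk] with ζ hζ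
  -- Transitivity carries this nullity to the tail sum from `ζ`. Its term of index 0 is the
  -- `l₀`-step law from `ζ`, under which `r` also equals `r ζ`; hence the two values coincide.
  have h1 : tailSum α n₀ x₀ {y | ¬ r y = r x₀} = 0 := by
    rw [tailSum, Measure.sum_apply _ hmeas, ENNReal.tsum_eq_zero]
    intro i
    rw [Measure.smul_apply, show ((α ^ (n₀ + i)) x₀) {y | ¬ r y = r x₀} = 0 from hx₀ _, smul_zero]
  have h2 := hac ζ x₀ h1
  rw [tailSum, Measure.sum_apply _ hmeas, ENNReal.tsum_eq_zero] at h2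
  have h3 := h2 0
  rw [Measure.smul_apply, add_zero, smul_eq_mul, mul_eq_zero] at h3
  have h4 : ∀ᵐ y ∂((α ^ l₀) ζ), r y = r x₀ := h3.resolve_left (by simp)
  have := isMarkovKernel_pow (α := α) l₀
  obtain ⟨y, hy1, hy2⟩ := (h4.and (hζ l₀)).exists
  rw [← hy2, hy1]

/-- The hypothesis forces equality in AM-GM. Hence `η` has no singular part and `θ / f²` is
preserved by jumps, so it is constant, and normalization fixes the constant. -/
theorem ReversibleJump.eq_squareLaw_of_rateReal_le (H : ReversibleJump q α μ) {f : S → ℝ}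
    (hf : Continuous f) (hpos : ∀ x, 0 < f x) (η : ProbabilityMeasure S)
    (h : rateReal q α μ η ≤ ∫ x, tiltPotential q α f x ∂(η : Measure S)) :
    (η : Measure S) = squareLaw μ f := by
  have hfm := hf.measurable
  have hqm := H.continuous_rate.measurable
  set θ := (η : Measure S).rnDeriv μ with hθ_def
  have hθ : Measurable θ := Measure.measurable_rnDeriv _ _
  set u : S → ℝ≥0∞ := fun x => ENNReal.ofReal (f x) with hu_def
  have hu : Measurable u := by rw [hu_def]; fun_prop
  have hu0 : ∀ x, u x ≠ 0 := fun x => by simpa [hu_def] using hpos x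
  have hut : ∀ x, u x ≠ ∞ := fun x => ENNReal.ofReal_ne_top
  have hlin := ofReal_integral_realGain H.feller H.continuous_rate H.rate_pos hf hpos (η : Measure S)
  have hle : ∫⁻ x, gain q α u x ∂(η : Measure S) ≤ form q α μ θ := by
    rw [← hlin]
    unfold tiltPotential rateReal at h
    rw [integral_sub (integrable_of_continuous H.continuous_rate _)
      (integrable_of_continuous (continuous_realGain H.feller H.continuous_rate hf hpos) _)] at h
    exact ENNReal.ofReal_le_of_le_toReal (by linarith)
  obtain ⟨hac, hae⟩ := ac_and_ae_eq_of_lintegral_gain_le (μ := μ) hqm H.balance hu hu0 hut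
    (η : Measure S) (fun x => by
      rw [gain_ofReal H.rate_pos hf hpos]
      simpa using realGain_pos H.rate_pos hf hpos x) (by rw [← hlin]; exact ENNReal.ofReal_ne_top)
    hle
  -- Positivity of `q` lets statements valid flux-almost everywhere pass to the law of one step of
  -- the chain.
  have hflux : μ ⊗ₘ α ≪ flux q α μ :=
    withDensity_absolutelyContinuous' (by fun_prop)
      (Eventually.of_forall fun z => by simpa using H.rate_pos z.1)
  have hfin : ∀ᵐ x ∂μ, θ x ≠ ∞ := (Measure.rnDeriv_lt_top _ μ).mono fun x hx => hx.ne
  have hfin2 : ∀ᵐ x ∂μ, ∀ᵐ y ∂(α x), θ y ≠ ∞ := by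
    have := H.null_ae {x | ¬ θ x ≠ ∞} (by
      simpa using measurableSet_eq_fun hθ measurable_const) hfin 1
    rw [pow_one] at this
    exact this
  have hinv : ∀ᵐ x ∂μ, ∀ᵐ y ∂(α x), θ y / u y ^ 2 = θ x / u x ^ 2 := by
    filter_upwards [Measure.ae_ae_of_ae_compProd (hflux.ae_le hae), hfin, hfin2] with x hx h1 h2
    filter_upwards [hx, h2] with y hy h3
    exact (hy h1 h3).symm
  obtain ⟨c, hc⟩ := H.ae_const_of_ae_eq (r := fun x => θ x / u x ^ 2) (by fun_prop) hinv
  have hθc : θ =ᵐ[μ] fun x => c * u x ^ 2 := by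
    filter_upwards [hc] with x hx
    rw [← hx, ENNReal.div_mul_cancel (pow_ne_zero _ (hu0 x)) (ENNReal.pow_ne_top (hut x))]
  have hηθ : (η : Measure S) = c • μ.withDensity fun x => u x ^ 2 := by
    rw [← Measure.withDensity_rnDeriv_eq _ _ hac, withDensity_congr_ae hθc,
      ← withDensity_smul c (by fun_prop)]
    rfl
  obtain ⟨h0, ht⟩ := lintegral_sq_ne (μ := μ) hf hpos
  have hmass : c * ∫⁻ x, u x ^ 2 ∂μ = 1 := by
    have : (η : Measure S) Set.univ = 1 := measure_univ
    rwa [hηθ, Measure.smul_apply, withDensity_apply _ MeasurableSet.univ, setLIntegral_univ,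
      smul_eq_mul] at this
  rw [hηθ, squareLaw, ENNReal.eq_inv_of_mul_eq_one_left hmass]

end SquareLaw

/-! ### Approximation by measures with squared continuous density -/

section Approximation

/-- Continuity of the inner product of `L²`. -/
theorem tendsto_integral_mul_of_tendsto_eLpNorm {T : Type*} [MeasurableSpace T] {ν : Measure T}
    {a b : ℕ → T → ℝ} {a₀ b₀ : T → ℝ} (ha : ∀ n, MemLp (a n) 2 ν) (hb : ∀ n, MemLp (b n) 2 ν)
    (ha₀ : MemLp a₀ 2 ν) (hb₀ : MemLp b₀ 2 ν)
    (hta : Tendsto (fun n => eLpNorm (a n - a₀) 2 ν) atTop (𝓝 0))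
    (htb : Tendsto (fun n => eLpNorm (b n - b₀) 2 ν) atTop (𝓝 0)) :
    Tendsto (fun n => ∫ x, a n x * b n x ∂ν) atTop (𝓝 (∫ x, a₀ x * b₀ x ∂ν)) := by
  have key : ∀ {f g : T → ℝ} (hf : MemLp f 2 ν) (hg : MemLp g 2 ν),
      ∫ x, f x * g x ∂ν = inner ℝ (hf.toLp f) (hg.toLp g) := by
    intro f g hf hg
    rw [L2.inner_def]
    refine integral_congr_ae ?_
    filter_upwards [hf.coeFn_toLp, hg.coeFn_toLp] with x hx hy
    rw [hx, hy]
    simp [mul_comm]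
  rw [key ha₀ hb₀]
  simp only [fun n => key (ha n) (hb n)]
  exact ((Lp.tendsto_Lp_iff_tendsto_eLpNorm'' a ha a₀ ha₀).2 hta).inner
    ((Lp.tendsto_Lp_iff_tendsto_eLpNorm'' b hb b₀ hb₀).2 htb)

variable {S : Type*} [TopologicalSpace S] [CompactSpace S] [PolishSpace S] [MeasurableSpace S]
  [BorelSpace S] {q : S → ℝ} {α : Kernel S S} [IsMarkovKernel α] {μ : Measure S}
  [IsProbabilityMeasure μ]

theorem exists_seq_continuous_pos_tendsto {s : S → ℝ} (hs : MemLp s 2 μ) (hs0 : ∀ x, 0 ≤ s x) :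
    ∃ f : ℕ → S → ℝ, (∀ n, Continuous (f n)) ∧ (∀ n x, 0 < f n x) ∧
      Tendsto (fun n => eLpNorm (f n - s) 2 μ) atTop (𝓝 0) := by
  have hε : ∀ n : ℕ, ((n : ℝ≥0∞) + 1)⁻¹ ≠ 0 := fun n => ENNReal.inv_ne_zero.2 (by finiteness)
  choose g hg _ using fun n => hs.exists_boundedContinuous_eLpNorm_sub_le (by norm_num) (hε n)
  have hpos : ∀ n : ℕ, (0 : ℝ) < ((n : ℝ) + 1)⁻¹ := fun n => by positivity
  -- The absolute value does not increase the distance to the nonnegative `s`, and the vanishing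
  -- constant gives strict positivity.
  refine ⟨fun n x => |g n x| + ((n : ℝ) + 1)⁻¹, fun n => by fun_prop, fun n x => by
    have := hpos n; positivity, ?_⟩
  have hbd : ∀ n : ℕ, eLpNorm ((fun x => |g n x| + ((n : ℝ) + 1)⁻¹) - s) 2 μ ≤
      2 * ((n : ℝ≥0∞) + 1)⁻¹ := by
    intro n
    calc _ ≤ eLpNorm ((fun x => |s x - g n x|) + fun _ => ((n : ℝ) + 1)⁻¹) 2 μ := by
          refine eLpNorm_mono_real fun x => ?_
          simp only [Pi.sub_apply, Pi.add_apply, Real.norm_eq_abs]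
          have h1 : |(|g n x| - s x)| ≤ |s x - g n x| := by
            conv_lhs => rw [← abs_of_nonneg (hs0 x)]
            rw [abs_sub_comm (s x)]
            exact abs_abs_sub_abs_le _ _
          calc |(|g n x| + ((n : ℝ) + 1)⁻¹ - s x)| = |(|g n x| - s x) + ((n : ℝ) + 1)⁻¹| := by
                congr 1; ring
            _ ≤ _ := (abs_add_le _ _).trans (by rw [abs_of_pos (hpos n)]; linarith)
      _ ≤ eLpNorm (fun x => |s x - g n x|) 2 μ + eLpNorm (fun _ => ((n : ℝ) + 1)⁻¹) 2 μ := by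
          refine eLpNorm_add_le ?_ aestronglyMeasurable_const (by norm_num)
          exact (hs.1.sub (g n).continuous.aestronglyMeasurable).norm
      _ ≤ ((n : ℝ≥0∞) + 1)⁻¹ + ((n : ℝ≥0∞) + 1)⁻¹ := by
          gcongr
          · refine le_trans (le_of_eq ?_) (hg n)
            exact eLpNorm_norm (s - ⇑(g n))
          · rw [eLpNorm_const _ (by norm_num) (IsProbabilityMeasure.ne_zero μ), measure_univ,
              ENNReal.one_rpow, mul_one, Real.enorm_eq_ofReal (hpos n).le,
              ENNReal.ofReal_inv_of_pos (by positivity), ENNReal.ofReal_add (by positivity)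
              (by norm_num), ENNReal.ofReal_natCast, ENNReal.ofReal_one]
      _ = _ := by rw [two_mul]
  have hlim : Tendsto (fun n : ℕ => 2 * ((n : ℝ≥0∞) + 1)⁻¹) atTop (𝓝 0) := by
    have h1 : Tendsto (fun n : ℕ => ((n : ℝ≥0∞) + 1)⁻¹) atTop (𝓝 0) := by
      have := (tendsto_add_atTop_iff_nat 1).2 ENNReal.tendsto_inv_nat_nhds_zero
      simpa using this
    simpa using ENNReal.Tendsto.const_mul h1 (Or.inr (by norm_num : (2 : ℝ≥0∞) ≠ ∞))
  exact tendsto_of_tendsto_of_tendsto_of_le_of_le tendsto_const_nhds hlim (fun _ => zero_le) hbd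

/-- The first marginal of the flux is `q dμ`, and by balance so is the second. Convergence in
`L²(μ)` therefore lifts to either coordinate on the product. -/
theorem map_fst_flux_le {q : S → ℝ} (hq : Measurable q) {K : ℝ≥0}
    (hqK : ∀ x, ENNReal.ofReal (q x) ≤ K) : (flux q α μ).map Prod.fst ≤ K • μ := by
  refine Measure.le_iff.2 fun A hA => ?_
  rw [← lintegral_indicator_one hA, lintegral_map (measurable_one.indicator hA) measurable_fst,
    lintegral_flux (g := fun z => A.indicator 1 z.1) hq
      ((measurable_one.indicator hA).comp measurable_fst)]
  simp only [lintegral_const, measure_univ, mul_one]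
  calc _ ≤ ∫⁻ x, K * A.indicator 1 x ∂μ := by
        refine lintegral_mono fun x => ?_
        rw [mul_comm]
        exact mul_le_mul_left (hqK x) _
    _ = _ := by
        rw [lintegral_const_mul _ (measurable_one.indicator hA), lintegral_indicator_one hA]
        rfl

theorem DetailedBalance.map_snd_flux (h : DetailedBalance q α μ) :
    (flux q α μ).map Prod.snd = (flux q α μ).map Prod.fst := by
  conv_rhs => rw [← h]
  rw [Measure.map_map measurable_fst measurable_swap]
  rfl

/-- One factor `f` of the density cancels the denominator of the gain, leaving the bilinear form at
`f`. -/
theorem integral_realGain_squareLaw (H : ReversibleJump q α μ) {f : S → ℝ} (hf : Continuous f)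
    (hpos : ∀ x, 0 < f x) :
    ∫ x, realGain q α f x ∂(squareLaw μ f) =
      (∫ x, f x * f x ∂μ)⁻¹ * ∫ z, f z.1 * f z.2 ∂(flux q α μ) := by
  have hfm := hf.measurable
  rw [integral_squareLaw hf hpos]
  congr 1
  have hg := continuous_realGain H.feller H.continuous_rate hf hpos
  rw [integral_eq_lintegral_of_nonneg_ae (Eventually.of_forall fun x =>
      (mul_pos (mul_pos (realGain_pos H.rate_pos hf hpos x) (hpos x)) (hpos x)).le)
      ((hg.mul hf).mul hf).aestronglyMeasurable,
    integral_eq_lintegral_of_nonneg_ae (Eventually.of_forall fun z =>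
      (mul_pos (hpos _) (hpos _)).le) (by
        exact ((hfm.comp measurable_fst).mul (hfm.comp measurable_snd)).aestronglyMeasurable)]
  congr 1
  have h1 := lintegral_mul_gain (μ := μ) (α := α) H.continuous_rate.measurable
    (θ := fun x => ENNReal.ofReal (f x * f x)) (u := fun x => ENNReal.ofReal (f x))
    (by fun_prop) (by fun_prop)
  simp only [gain_ofReal H.rate_pos hf hpos] at h1
  convert h1 using 2 with x
  · ext x
    rw [← ENNReal.ofReal_mul (mul_self_nonneg _)]
    congr 1; ring
  · ext z
    rw [← ENNReal.ofReal_div_of_pos (hpos _), ← ENNReal.ofReal_mul (mul_self_nonneg _)]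
    have := (hpos z.1).ne'
    congr 1; field_simp

/-- Absolutely continuous measures can be approximated, together with their rate, by measures with
squared continuous positive density. -/
theorem ReversibleJump.exists_squareLaw_mem (H : ReversibleJump q α μ)
    {O : Set (ProbabilityMeasure S)} (hO : IsOpen O) {η : ProbabilityMeasure S} (hη : η ∈ O)
    (hac : η ∈ acMeasures μ) {a : ℝ} (ha : rateReal q α μ η < a) :
    ∃ (f : S → ℝ) (_ : Continuous f) (_ : ∀ x, 0 < f x) (ν : ProbabilityMeasure S),
      (ν : Measure S) = squareLaw μ f ∧ ν ∈ O ∧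
      ∫ x, tiltPotential q α f x ∂(ν : Measure S) < a := by
  have hqm := H.continuous_rate.measurable
  set θ := (η : Measure S).rnDeriv μ with hθ_def
  have hθ : Measurable θ := Measure.measurable_rnDeriv _ _
  have hfin : ∀ᵐ x ∂μ, θ x ≠ ∞ := (Measure.rnDeriv_lt_top _ μ).mono fun x hx => hx.ne
  -- The square root of the density lies in `L²(μ)`. Both `∫ h dη` and the form are bilinear in it,
  -- so `L²` approximation by positive continuous functions suffices.
  set s : S → ℝ := fun x => (θ x ^ (1 / 2 : ℝ)).toReal with hs_def
  have hsm : Measurable s := by rw [hs_def]; fun_prop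
  have hs0 : ∀ x, 0 ≤ s x := fun x => ENNReal.toReal_nonneg
  have hss : ∀ x, s x * s x = (θ x).toReal := fun x => by
    rw [hs_def]
    simp only
    rw [← ENNReal.toReal_mul, ← ENNReal.rpow_add_of_nonneg _ _ (by norm_num) (by norm_num)]
    norm_num
  have hsL : MemLp s 2 μ := by
    rw [memLp_two_iff_integrable_sq hsm.aestronglyMeasurable]
    refine Measure.integrable_toReal_rnDeriv (μ := (η : Measure S)) (ν := μ) |>.congr
      (Eventually.of_forall fun x => ?_)
    simp only [pow_two, hss]
    rfl
  obtain ⟨f, hf, hpos, hlim⟩ := exists_seq_continuous_pos_tendsto hsL hs0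
  have hfL : ∀ n, MemLp (f n) 2 μ := fun n => by
    obtain ⟨K, -, hK⟩ := exists_le_of_continuous (hf n)
    exact MemLp.of_bound (hf n).aestronglyMeasurable K (Eventually.of_forall hK)
  -- integrals of continuous functions
  have hint : ∀ h : S → ℝ, Continuous h →
      Tendsto (fun n => ∫ x, h x * f n x * f n x ∂μ) atTop (𝓝 (∫ x, h x ∂(η : Measure S))) := by
    intro h hh
    obtain ⟨K, hK0, hK⟩ := exists_le_of_continuous hh
    have hmul : ∀ g : S → ℝ, MemLp g 2 μ → MemLp (fun x => h x * g x) 2 μ := fun g hg =>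
      hg.of_le_mul (c := K) (hh.aestronglyMeasurable.mul hg.1) (Eventually.of_forall fun x => by
        rw [norm_mul]; gcongr; exact hK x)
    have h1 : ∫ x, h x * s x * s x ∂μ = ∫ x, h x ∂(η : Measure S) := by
      conv_rhs => rw [← Measure.withDensity_rnDeriv_eq _ _ hac]
      rw [integral_withDensity_eq_integral_toReal_smul hθ (Measure.rnDeriv_lt_top _ μ)]
      refine integral_congr_ae (Eventually.of_forall fun x => ?_)
      simp only [smul_eq_mul]
      rw [mul_assoc, hss, mul_comm]
    rw [← h1]
    refine tendsto_integral_mul_of_tendsto_eLpNorm (fun n => hmul _ (hfL n)) hfL (hmul _ hsL) hsL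
      ?_ hlim
    have h2 : ∀ n, eLpNorm ((fun x => h x * f n x) - fun x => h x * s x) 2 μ ≤
        ENNReal.ofReal K * eLpNorm (f n - s) 2 μ := fun n => by
      refine eLpNorm_le_mul_eLpNorm_of_ae_le_mul (Eventually.of_forall fun x => ?_) 2
      simp only [Pi.sub_apply]
      rw [← mul_sub, norm_mul]
      gcongr
      exact hK x
    refine tendsto_of_tendsto_of_tendsto_of_le_of_le tendsto_const_nhds ?_ (fun _ => zero_le) h2
    simpa using ENNReal.Tendsto.const_mul hlim (Or.inr ENNReal.ofReal_ne_top)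
  have hZ : Tendsto (fun n => ∫ x, f n x * f n x ∂μ) atTop (𝓝 1) := by
    simpa using hint (fun _ => 1) continuous_const
  have hlaw : ∀ h : S → ℝ, Continuous h →
      Tendsto (fun n => ∫ x, h x ∂(squareLaw μ (f n))) atTop (𝓝 (∫ x, h x ∂(η : Measure S))) := by
    intro h hh
    simp only [fun n => integral_squareLaw (μ := μ) (hf n) (hpos n) h]
    simpa using (hZ.inv₀ one_ne_zero).mul (hint h hh)
  let ν : ℕ → ProbabilityMeasure S := fun n =>
    ⟨squareLaw μ (f n), isProbabilityMeasure_squareLaw (hf n) (hpos n)⟩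
  have hν : Tendsto ν atTop (𝓝 η) :=
    ProbabilityMeasure.tendsto_iff_forall_integral_tendsto.2 fun h => hlaw h h.continuous
  -- the Dirichlet form
  obtain ⟨K', hK0, hK⟩ := exists_le_of_continuous H.continuous_rate
  set K : ℝ≥0 := K'.toNNReal with hK_def
  have hqK : ∀ x, ENNReal.ofReal (q x) ≤ K := fun x =>
    ENNReal.ofReal_le_ofReal ((le_abs_self _).trans (hK x))
  have hfst := map_fst_flux_le (μ := μ) (α := α) hqm hqK
  have hsnd : (flux q α μ).map Prod.snd ≤ K • μ := by rw [H.balance.map_snd_flux]; exact hfst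
  have hproj : ∀ p : S × S → S, Measurable p → (flux q α μ).map p ≤ K • μ →
      (∀ g : S → ℝ, MemLp g 2 μ → MemLp (fun z => g (p z)) 2 (flux q α μ)) ∧
      Tendsto (fun n => eLpNorm ((fun z => f n (p z)) - fun z => s (p z)) 2 (flux q α μ)) atTop
        (𝓝 0) := by
    intro p hp hpK
    have hmem : ∀ g : S → ℝ, MemLp g 2 μ → MemLp g 2 ((flux q α μ).map p) := fun g hg =>
      (hg.smul_measure (c := (K : ℝ≥0∞)) ENNReal.coe_ne_top).mono_measure hpK
    refine ⟨fun g hg => (hmem g hg).comp_of_map hp.aemeasurable, ?_⟩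
    have h2 : ∀ n, eLpNorm ((fun z => f n (p z)) - fun z => s (p z)) 2 (flux q α μ) ≤
        (K : ℝ≥0∞) ^ (1 / (2 : ℝ≥0∞)).toReal * eLpNorm (f n - s) 2 μ := fun n => by
      have h3 := eLpNorm_map_measure (p := 2) (hmem _ ((hfL n).sub hsL)).1 hp.aemeasurable
      calc _ = eLpNorm (f n - s) 2 ((flux q α μ).map p) := h3.symm
        _ ≤ eLpNorm (f n - s) 2 ((K : ℝ≥0∞) • μ) := eLpNorm_mono_measure _ hpK
        _ = _ := by
          rw [eLpNorm_smul_measure_of_ne_top (by norm_num)]; simp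
    refine tendsto_of_tendsto_of_tendsto_of_le_of_le tendsto_const_nhds ?_ (fun _ => zero_le) h2
    have h4 : (K : ℝ≥0∞) ^ (1 / (2 : ℝ≥0∞)).toReal ≠ ∞ :=
      ENNReal.rpow_ne_top_of_nonneg ENNReal.toReal_nonneg ENNReal.coe_ne_top
    have := ENNReal.Tendsto.const_mul hlim (Or.inr h4)
    rwa [mul_zero] at this
  obtain ⟨hm1, ht1⟩ := hproj Prod.fst measurable_fst hfst
  obtain ⟨hm2, ht2⟩ := hproj Prod.snd measurable_snd hsnd
  have hform : (form q α μ θ).toReal = ∫ z, s z.1 * s z.2 ∂(flux q α μ) := by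
    rw [form_eq_lintegral_flux hqm hθ, integral_eq_lintegral_of_nonneg_ae
      (Eventually.of_forall fun z => mul_nonneg (hs0 _) (hs0 _))
      ((hsm.comp measurable_fst).mul (hsm.comp measurable_snd)).aestronglyMeasurable]
    congr 1
    refine lintegral_congr_ae ?_
    have hacK : K • μ ≪ μ := Measure.smul_absolutelyContinuous
    have e1 : ∀ᵐ z ∂(flux q α μ), θ z.1 ≠ ∞ := by
      have := (hfst.absolutelyContinuous.trans hacK).ae_le hfin
      exact ae_of_ae_map measurable_fst.aemeasurable this
    have e2 : ∀ᵐ z ∂(flux q α μ), θ z.2 ≠ ∞ := by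
      have := (hsnd.absolutelyContinuous.trans hacK).ae_le hfin
      exact ae_of_ae_map measurable_snd.aemeasurable this
    filter_upwards [e1, e2] with z h1 h2
    rw [ENNReal.ofReal_mul (hs0 _), hs_def]
    simp only
    rw [ENNReal.ofReal_toReal (ENNReal.rpow_ne_top_of_nonneg (by norm_num) h1),
      ENNReal.ofReal_toReal (ENNReal.rpow_ne_top_of_nonneg (by norm_num) h2)]
  have hcross : Tendsto (fun n => ∫ z, f n z.1 * f n z.2 ∂(flux q α μ)) atTop
      (𝓝 (form q α μ θ).toReal) := by
    rw [hform]
    exact tendsto_integral_mul_of_tendsto_eLpNorm (fun n => hm1 _ (hfL n))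
      (fun n => hm2 _ (hfL n)) (hm1 _ hsL) (hm2 _ hsL) ht1 ht2
  have hpot : Tendsto (fun n => ∫ x, tiltPotential q α (f n) x ∂(squareLaw μ (f n))) atTop
      (𝓝 (rateReal q α μ η)) := by
    have e : ∀ n, ∫ x, tiltPotential q α (f n) x ∂(squareLaw μ (f n)) =
        ∫ x, q x ∂(squareLaw μ (f n)) -
          (∫ x, f n x * f n x ∂μ)⁻¹ * ∫ z, f n z.1 * f n z.2 ∂(flux q α μ) := fun n => by
      have := isProbabilityMeasure_squareLaw (μ := μ) (hf n) (hpos n)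
      rw [← integral_realGain_squareLaw H (hf n) (hpos n)]
      exact integral_sub (integrable_of_continuous H.continuous_rate _)
        (integrable_of_continuous
          (continuous_realGain H.feller H.continuous_rate (hf n) (hpos n)) _)
    simp only [e]
    have := (hlaw q H.continuous_rate).sub ((hZ.inv₀ one_ne_zero).mul hcross)
    simpa [rateReal] using this
  obtain ⟨n, h1, h2⟩ := ((hν.eventually (hO.mem_nhds hη)).and
    (hpot.eventually (gt_mem_nhds ha))).exists
  exact ⟨f n, hf n, hpos n, ν n, rfl, h1, h2⟩

end Approximation

/-! ### One step of the jump process -/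

section OneStep

variable {S Ω : Type*} [MeasurableSpace S] [mΩ : MeasurableSpace Ω] {P : Measure Ω}
  {α : Kernel S S} {X : ℕ → Ω → S} {τ : ℕ → Ω → ℝ}

/-- The chain stopped at time `n`. -/
def stoppedChain (X : ℕ → Ω → S) (n : ℕ) (ω : Ω) (k : ℕ) : S := X (min k n) ω

/-- The holding times before the `n`-th one, continued by zero. -/
def pastTimes (τ : ℕ → Ω → ℝ) (n : ℕ) (ω : Ω) (k : ℕ) : ℝ := if k < n then τ k ω else 0

theorem IsJumpData.measurable_stoppedChain (h : IsJumpData P α X τ) (n : ℕ) :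
    Measurable (stoppedChain X n) :=
  measurable_pi_lambda _ fun _ => h.measurable_chain _

theorem IsJumpData.measurable_pastTimes (h : IsJumpData P α X τ) (n : ℕ) :
    Measurable (pastTimes τ n) := by
  refine measurable_pi_lambda _ fun k => ?_
  unfold pastTimes
  split_ifs
  · exact h.measurable_time k
  · exact measurable_const

/-- The Markov property is integrated over events of the past, which determines the joint law on
rectangles. Stopping the chain encodes the past in one fixed path space. -/
theorem IsJumpData.map_chain_succ [IsProbabilityMeasure P] [IsMarkovKernel α]
    (h : IsJumpData P α X τ) (n : ℕ) :
    P.map (fun ω => (stoppedChain X n ω, X (n + 1) ω)) =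
      P.map (stoppedChain X n) ⊗ₘ α.comap (fun x : ℕ → S => x n) (measurable_pi_apply n) := by
  have hZ := h.measurable_stoppedChain n
  have hY := h.measurable_chain (n + 1)
  have : IsProbabilityMeasure (P.map (stoppedChain X n)) :=
    Measure.isProbabilityMeasure_map hZ.aemeasurable
  have : IsProbabilityMeasure (P.map fun ω => (stoppedChain X n ω, X (n + 1) ω)) :=
    Measure.isProbabilityMeasure_map (hZ.prodMk hY).aemeasurable
  refine Measure.ext_prod fun {A Γ} hA hΓ => ?_
  rw [Measure.compProd_apply_prod hA hΓ, Measure.map_apply (hZ.prodMk hY) (hA.prod hΓ),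
    setLIntegral_map hA (by exact Kernel.measurable_coe _ hΓ) hZ]
  simp only [Kernel.comap_apply]
  have hXn : ∀ ω, stoppedChain X n ω n = X n ω := fun ω => by simp [stoppedChain]
  simp only [hXn]
  have hΓX : MeasurableSet (X (n + 1) ⁻¹' Γ) := hY hΓ
  have hint : Integrable ((X (n + 1) ⁻¹' Γ).indicator fun _ => (1 : ℝ)) P :=
    (integrable_const 1).indicator hΓX
  have h1 : ∫ ω in stoppedChain X n ⁻¹' A, (α (X n ω)).real Γ ∂P =
      ∫ ω in stoppedChain X n ⁻¹' A, (X (n + 1) ⁻¹' Γ).indicator (fun _ => (1 : ℝ)) ω ∂P := by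
    have hm : (⨆ j ∈ Finset.range (n + 1), MeasurableSpace.comap (X j) inferInstance) ≤ mΩ :=
      iSup₂_le fun j _ => (h.measurable_chain j).comap_le
    have hAm : MeasurableSet[⨆ j ∈ Finset.range (n + 1),
        MeasurableSpace.comap (X j) inferInstance] (stoppedChain X n ⁻¹' A) := by
      refine (@measurable_pi_lambda _ _ _ (_) _ _ fun k => ?_) hA
      have hk : min k n ∈ Finset.range (n + 1) := Finset.mem_range.2 (by omega)
      exact Measurable.mono (comap_measurable (X (min k n)))
        (le_iSup₂_of_le (min k n) hk le_rfl) le_rfl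
    rw [← setIntegral_condExp hm hint hAm]
    exact (setIntegral_congr_ae (hm _ hAm) ((h.markov n Γ hΓ).mono fun ω hω _ => hω)).symm
  rw [integral_indicator_const _ hΓX, smul_eq_mul, mul_one] at h1
  have hmeas : Measurable fun ω => (α (X n ω)).real Γ :=
    ((α.measurable_coe hΓ).comp (h.measurable_chain n)).ennreal_toReal
  have h2 : ∫⁻ ω in stoppedChain X n ⁻¹' A, (α (X n ω)) Γ ∂P =
      ENNReal.ofReal (∫ ω in stoppedChain X n ⁻¹' A, (α (X n ω)).real Γ ∂P) := by
    rw [ofReal_integral_eq_lintegral_ofReal]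
    · refine lintegral_congr fun ω => ?_
      rw [Measure.real, ENNReal.ofReal_toReal (measure_ne_top _ _)]
    · refine Integrable.of_bound hmeas.aestronglyMeasurable 1 (Eventually.of_forall fun ω => ?_)
      rw [Real.norm_of_nonneg measureReal_nonneg]
      exact measureReal_le_one
    · exact Eventually.of_forall fun ω => measureReal_nonneg
  rw [h2, h1, measureReal_restrict_apply hΓX, Measure.real, ENNReal.ofReal_toReal
    (measure_ne_top _ _)]
  congr 1
  ext ω
  simp [and_comm]

theorem IsJumpData.indep_pastTimes [IsProbabilityMeasure P] (h : IsJumpData P α X τ) (n : ℕ) :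
    IndepFun (pastTimes τ n) (τ n) P := by
  have h1 := h.indep_times.indepFun_finset (Finset.range n) {n} (by simp) h.measurable_time
  have hφ : Measurable fun (s : Finset.range n → ℝ) (k : ℕ) =>
      if hk : k < n then s ⟨k, Finset.mem_range.2 hk⟩ else 0 := by
    refine measurable_pi_lambda _ fun k => ?_
    split_ifs
    · exact measurable_pi_apply _
    · exact measurable_const
  have hψ : Measurable fun s : ({n} : Finset ℕ) → ℝ => s ⟨n, Finset.mem_singleton_self n⟩ :=
    measurable_pi_apply _
  have h2 := h1.comp hφ hψ
  convert h2 using 1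
  · ext ω k
    simp [pastTimes]
  · rfl

theorem IsJumpData.indep_chain_times [IsProbabilityMeasure P] (h : IsJumpData P α X τ) (n : ℕ) :
    IndepFun (fun ω => (stoppedChain X n ω, X (n + 1) ω)) (fun ω => (pastTimes τ n ω, τ n ω)) P := by
  have hφ : Measurable fun x : ℕ → S => ((fun k => x (min k n) : ℕ → S), x (n + 1)) :=
    (measurable_pi_lambda _ fun k => measurable_pi_apply _).prodMk (measurable_pi_apply _)
  have hψ : Measurable fun s : ℕ → ℝ => ((fun k => if k < n then s k else 0 : ℕ → ℝ), s n) := by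
    refine Measurable.prodMk (measurable_pi_lambda _ fun k => ?_) (measurable_pi_apply _)
    split_ifs
    · exact measurable_pi_apply _
    · exact measurable_const
  exact h.indep_chain.comp hφ hψ

/-- Given the past, the next holding time is exponential and the next state has law
`α(X_n, ·)`, independently of each other. -/
theorem IsJumpData.lintegral_step [IsProbabilityMeasure P] [IsMarkovKernel α]
    (h : IsJumpData P α X τ) (n : ℕ) {G : ((ℕ → S) × (ℕ → ℝ)) × (ℝ × S) → ℝ≥0∞}
    (hG : Measurable G) :
    ∫⁻ ω, G ((stoppedChain X n ω, pastTimes τ n ω), (τ n ω, X (n + 1) ω)) ∂P =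
      ∫⁻ ω, ∫⁻ t, ∫⁻ y, G ((stoppedChain X n ω, pastTimes τ n ω), (t, y)) ∂(α (X n ω))
        ∂(expMeasure 1) ∂P := by
  have hX := h.measurable_stoppedChain n
  have hY := h.measurable_chain (n + 1)
  have hτ := h.measurable_pastTimes n
  have ht := h.measurable_time n
  have : IsProbabilityMeasure (expMeasure 1) := isProbabilityMeasure_expMeasure one_pos
  have : IsProbabilityMeasure (P.map (stoppedChain X n)) :=
    Measure.isProbabilityMeasure_map hX.aemeasurable
  have : IsProbabilityMeasure (P.map (pastTimes τ n)) :=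
    Measure.isProbabilityMeasure_map hτ.aemeasurable
  set κ : Kernel (ℕ → S) S := α.comap (fun x : ℕ → S => x n) (measurable_pi_apply n) with hκ
  have hlaw : P.map (fun ω => ((stoppedChain X n ω, X (n + 1) ω), (pastTimes τ n ω, τ n ω))) =
      (P.map (stoppedChain X n) ⊗ₘ κ).prod ((P.map (pastTimes τ n)).prod (expMeasure 1)) := by
    rw [(h.indep_chain_times n).map_prod_eq_prod_map_map (hX.prodMk hY).aemeasurable
      (hτ.prodMk ht).aemeasurable, (h.indep_pastTimes n).map_prod_eq_prod_map_map
      hτ.aemeasurable ht.aemeasurable, h.law_time n, h.map_chain_succ n]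
  have hlaw2 : P.map (fun ω => (stoppedChain X n ω, pastTimes τ n ω)) =
      (P.map (stoppedChain X n)).prod (P.map (pastTimes τ n)) := by
    have h1 := (h.indep_chain_times n).comp measurable_fst measurable_fst
    exact h1.map_prod_eq_prod_map_map hX.aemeasurable hτ.aemeasurable
  have hG1 : Measurable fun z : ((ℕ → S) × S) × ((ℕ → ℝ) × ℝ) =>
      G ((z.1.1, z.2.1), (z.2.2, z.1.2)) := by fun_prop
  have hin : Measurable fun z : ((ℕ → S) × (ℕ → ℝ)) × ℝ =>
      ∫⁻ y, G (z.1, (z.2, y)) ∂(κ z.1.1) := by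
    have h1 : Measurable (Function.uncurry fun (z : ((ℕ → S) × (ℕ → ℝ)) × ℝ) (y : S) =>
      G (z.1, (z.2, y))) := by unfold Function.uncurry; fun_prop
    exact h1.lintegral_kernel_prod_right'
      (κ := κ.comap (fun z : ((ℕ → S) × (ℕ → ℝ)) × ℝ => z.1.1) (by fun_prop))
  have hL : ∫⁻ ω, G ((stoppedChain X n ω, pastTimes τ n ω), (τ n ω, X (n + 1) ω)) ∂P =
      ∫⁻ x, ∫⁻ y, ∫⁻ s, ∫⁻ t, G ((x, s), (t, y)) ∂(expMeasure 1) ∂(P.map (pastTimes τ n)) ∂(κ x)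
        ∂(P.map (stoppedChain X n)) := by
    have := lintegral_map (μ := P) hG1 ((hX.prodMk hY).prodMk (hτ.prodMk ht))
    rw [← this, hlaw, lintegral_prod _ hG1.aemeasurable,
      Measure.lintegral_compProd (hG1.lintegral_prod_right')]
    refine lintegral_congr fun x => lintegral_congr fun y => ?_
    rw [lintegral_prod _ (by fun_prop)]
  have hR : ∫⁻ ω, ∫⁻ t, ∫⁻ y, G ((stoppedChain X n ω, pastTimes τ n ω), (t, y)) ∂(α (X n ω))
        ∂(expMeasure 1) ∂P =
      ∫⁻ x, ∫⁻ s, ∫⁻ t, ∫⁻ y, G ((x, s), (t, y)) ∂(κ x) ∂(expMeasure 1)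
        ∂(P.map (pastTimes τ n)) ∂(P.map (stoppedChain X n)) := by
    have hm := hin.lintegral_prod_right' (ν := expMeasure 1)
    have h1 := lintegral_map (μ := P) hm (hX.prodMk hτ)
    rw [hlaw2, lintegral_prod _ hm.aemeasurable] at h1
    rw [h1]
    refine lintegral_congr fun ω => ?_
    simp [hκ, Kernel.comap_apply, stoppedChain]
  rw [hL, hR]
  refine lintegral_congr fun x => ?_
  rw [lintegral_lintegral_swap (by
    have : Measurable (Function.uncurry fun (y : S) (s : ℕ → ℝ) =>
        ∫⁻ t, G ((x, s), (t, y)) ∂(expMeasure 1)) := by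
      refine Measurable.lintegral_prod_right (f := fun (p : S × (ℕ → ℝ)) t =>
        G ((x, p.2), (t, p.1))) ?_
      unfold Function.uncurry
      fun_prop
    exact this.aemeasurable)]
  refine lintegral_congr fun s => ?_
  exact lintegral_lintegral_swap (by unfold Function.uncurry; fun_prop)

end OneStep

/-! ### The exponential martingale of the jump process -/

section Exponential

theorem expMeasure_eq_withDensity (r : ℝ) :
    expMeasure r = volume.withDensity (exponentialPDF r) := rfl

theorem measurable_exponentialPDF (r : ℝ) : Measurable (exponentialPDF r) :=
  (measurable_exponentialPDFReal r).ennreal_ofReal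

theorem expMeasure_apply_Iic {r : ℝ} (hr : 0 < r) {R : ℝ} (hR : 0 ≤ R) :
    expMeasure r (Set.Iic R) = ENNReal.ofReal (1 - Real.exp (-(r * R))) := by
  rw [expMeasure_eq_withDensity, withDensity_apply _ measurableSet_Iic,
    lintegral_exponentialPDF_eq_antiDeriv hr, if_pos hR]

theorem ae_nonneg_expMeasure (r : ℝ) : ∀ᵐ t ∂(expMeasure r), 0 ≤ t := by
  have : expMeasure r (Set.Iio 0) = 0 := by
    rw [expMeasure_eq_withDensity, withDensity_apply _ measurableSet_Iio,
      lintegral_exponentialPDF_of_nonpos le_rfl]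
  filter_upwards [measure_eq_zero_iff_ae_notMem.1 this] with t ht
  simpa using ht

/-- The integrand is the density of the rate-`b` exponential law with respect to the rate-one law.
-/
theorem setLIntegral_exp_expMeasure {b : ℝ} {s : Set ℝ} (hs : MeasurableSet s) :
    ∫⁻ t in s, ENNReal.ofReal (b * Real.exp ((1 - b) * t)) ∂(expMeasure 1) = expMeasure b s := by
  rw [expMeasure_eq_withDensity, expMeasure_eq_withDensity, withDensity_apply _ hs,
    setLIntegral_withDensity_eq_setLIntegral_mul _ (measurable_exponentialPDF 1) (by fun_prop) hs]
  refine lintegral_congr fun t => ?_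
  rw [Pi.mul_apply, exponentialPDF_eq, exponentialPDF_eq]
  split_ifs with ht
  · rw [← ENNReal.ofReal_mul (by positivity)]
    congr 1
    have : Real.exp (-(b * t)) = Real.exp (-(1 * t)) * Real.exp ((1 - b) * t) := by
      rw [← Real.exp_add]; congr 1; ring
    rw [this]; ring
  · simp

/-- This is the likelihood ratio observed only up to `R`. Beyond `R` it is the ratio `exp(-bR) /
exp(-R)` of the survival probabilities, so the total mass is one. -/
theorem lintegral_exp_stopped {b R : ℝ} (hb : 0 < b) (hR : 0 ≤ R) :
    ∫⁻ t, (if t ≤ R then ENNReal.ofReal (b * Real.exp ((1 - b) * t))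
      else ENNReal.ofReal (Real.exp ((1 - b) * R))) ∂(expMeasure 1) = 1 := by
  have : IsProbabilityMeasure (expMeasure 1) := isProbabilityMeasure_expMeasure one_pos
  have e1 : Set.EqOn (fun t => if t ≤ R then ENNReal.ofReal (b * Real.exp ((1 - b) * t))
      else ENNReal.ofReal (Real.exp ((1 - b) * R)))
      (fun t => ENNReal.ofReal (b * Real.exp ((1 - b) * t))) (Set.Iic R) :=
    fun t ht => if_pos ht
  have e2 : Set.EqOn (fun t => if t ≤ R then ENNReal.ofReal (b * Real.exp ((1 - b) * t))
      else ENNReal.ofReal (Real.exp ((1 - b) * R)))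
      (fun _ => ENNReal.ofReal (Real.exp ((1 - b) * R))) (Set.Iic R)ᶜ :=
    fun t ht => if_neg ht
  rw [← lintegral_add_compl _ (measurableSet_Iic (a := R)),
    setLIntegral_congr_fun measurableSet_Iic e1, setLIntegral_congr_fun measurableSet_Iic.compl e2,
    setLIntegral_exp_expMeasure measurableSet_Iic, expMeasure_apply_Iic hb hR, setLIntegral_const,
    prob_compl_eq_one_sub measurableSet_Iic, expMeasure_apply_Iic one_pos hR]
  have h1 : Real.exp (-(1 * R)) ≤ 1 := Real.exp_le_one_iff.2 (by linarith)
  have h2 : Real.exp (-(b * R)) ≤ 1 := Real.exp_le_one_iff.2 (by nlinarith)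
  rw [← ENNReal.ofReal_one, ← ENNReal.ofReal_sub _ (by linarith), sub_sub_cancel,
    ← ENNReal.ofReal_mul (Real.exp_pos _).le, ← Real.exp_add,
    ← ENNReal.ofReal_add (by linarith) (Real.exp_pos _).le]
  congr 1
  have : (1 - b) * R + -(1 * R) = -(b * R) := by ring
  rw [this]; ring

theorem lintegral_exp_neg_expMeasure :
    ∫⁻ t, ENNReal.ofReal (Real.exp (-t)) ∂(expMeasure 1) = 2⁻¹ := by
  have h := setLIntegral_exp_expMeasure (b := 2) MeasurableSet.univ
  have h2 : IsProbabilityMeasure (expMeasure 2) := isProbabilityMeasure_expMeasure two_pos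
  have h3 : ∀ t : ℝ, ENNReal.ofReal (2 * Real.exp ((1 - 2) * t)) =
      2 * ENNReal.ofReal (Real.exp (-t)) := fun t => by
    rw [ENNReal.ofReal_mul (by norm_num)]
    congr 1
    · simp
    · congr 2; ring
  rw [setLIntegral_univ, measure_univ] at h
  simp only [h3] at h
  rw [lintegral_const_mul _ (by fun_prop)] at h
  rw [mul_comm] at h
  exact ENNReal.eq_inv_of_mul_eq_one_left h

/-- The one-step identity behind the exponential martingale: a state with jump rate `q`, where the
test function has the value `u` and the expected value `v` after a jump. -/
theorem lintegral_one_step {q u v : ℝ} (hq : 0 < q) (hu : 0 < u) (hv : 0 < v) (T c a : ℝ) :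
    ∫⁻ t, ((if c ≤ T ∧ T < c + t / q then
          ENNReal.ofReal (u * Real.exp (a + (q - q * v / u) * (T - c))) else 0) +
        (if c + t / q ≤ T then
          ENNReal.ofReal (Real.exp (a + (q - q * v / u) * (t / q))) * ENNReal.ofReal v else 0))
        ∂(expMeasure 1) =
      if c ≤ T then ENNReal.ofReal (u * Real.exp a) else 0 := by
  split_ifs with hc
  -- With `b = v / u` and the remaining time `R = q (T - c)`, the integrand is `u exp(a)` times the
  -- stopped likelihood ratio.
  · have key : ∀ t : ℝ, ((if c ≤ T ∧ T < c + t / q then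
          ENNReal.ofReal (u * Real.exp (a + (q - q * v / u) * (T - c))) else 0) +
        (if c + t / q ≤ T then
          ENNReal.ofReal (Real.exp (a + (q - q * v / u) * (t / q))) * ENNReal.ofReal v else 0)) =
        ENNReal.ofReal (u * Real.exp a) *
          (if t ≤ q * (T - c) then ENNReal.ofReal (v / u * Real.exp ((1 - v / u) * t))
            else ENNReal.ofReal (Real.exp ((1 - v / u) * (q * (T - c))))) := by
      intro t
      have hiff : c + t / q ≤ T ↔ t ≤ q * (T - c) := by
        rw [← le_sub_iff_add_le', div_le_iff₀ hq, mul_comm]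
      by_cases ht : t ≤ q * (T - c)
      · have h1 := hiff.2 ht
        rw [if_neg (fun h => absurd h.2 (not_lt.2 h1)), if_pos h1, if_pos ht, zero_add,
          ← ENNReal.ofReal_mul (Real.exp_pos _).le, ← ENNReal.ofReal_mul (by positivity)]
        congr 1
        have : a + (q - q * v / u) * (t / q) = a + (1 - v / u) * t := by field_simp
        rw [this, Real.exp_add]
        field_simp
      · have h1 : ¬ c + t / q ≤ T := fun h => ht (hiff.1 h)
        rw [if_pos ⟨hc, not_le.1 h1⟩, if_neg h1, if_neg ht, add_zero,
          ← ENNReal.ofReal_mul (by positivity)]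
        congr 1
        have : a + (q - q * v / u) * (T - c) = a + (1 - v / u) * (q * (T - c)) := by field_simp
        rw [this, Real.exp_add]
        ring
    simp only [key]
    rw [lintegral_const_mul', lintegral_exp_stopped (div_pos hv hu)
      (mul_nonneg hq.le (sub_nonneg.2 hc)), mul_one]
    exact ENNReal.ofReal_ne_top
  · refine (lintegral_congr_ae (g := fun _ => 0) ?_).trans lintegral_zero
    filter_upwards [ae_nonneg_expMeasure 1] with t ht
    have h1 : 0 ≤ t / q := div_nonneg ht hq.le
    rw [if_neg (fun h => hc h.1), if_neg (by intro h; exact hc (by linarith)), add_zero]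

end Exponential

/-! ### Integrals along a path and the empirical measure -/

section Path

variable {S Ω : Type*}

/-- The integral of `W` along the path up to the `n`-th jump time. -/
noncomputable def pathSum (W q : S → ℝ) (X : ℕ → Ω → S) (τ : ℕ → Ω → ℝ) (n : ℕ) (ω : Ω) : ℝ :=
  ∑ i ∈ Finset.range n, W (X i ω) * (τ i ω / q (X i ω))

theorem pathSum_succ (W q : S → ℝ) (X : ℕ → Ω → S) (τ : ℕ → Ω → ℝ) (n : ℕ) (ω : Ω) :
    pathSum W q X τ (n + 1) ω = pathSum W q X τ n ω + W (X n ω) * (τ n ω / q (X n ω)) :=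
  Finset.sum_range_succ _ _

theorem jumpTime_succ (q : S → ℝ) (X : ℕ → Ω → S) (τ : ℕ → Ω → ℝ) (n : ℕ) (ω : Ω) :
    jumpTime q X τ (n + 1) ω = jumpTime q X τ n ω + τ n ω / q (X n ω) :=
  Finset.sum_range_succ _ _

theorem pathSum_one (q : S → ℝ) (X : ℕ → Ω → S) (τ : ℕ → Ω → ℝ) (n : ℕ) (ω : Ω) :
    pathSum (fun _ => 1) q X τ n ω = jumpTime q X τ n ω := by
  simp [pathSum, jumpTime]

theorem pathSum_stopped (W q : S → ℝ) (X : ℕ → Ω → S) (τ : ℕ → Ω → ℝ) (n : ℕ) (ω : Ω) :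
    pathSum W q (fun i (z : (ℕ → S) × (ℕ → ℝ)) => z.1 i) (fun i z => z.2 i) n
      (stoppedChain X n ω, pastTimes τ n ω) = pathSum W q X τ n ω := by
  refine Finset.sum_congr rfl fun i hi => ?_
  have hi' := Finset.mem_range.1 hi
  simp [stoppedChain, pastTimes, hi', min_eq_left hi'.le]

theorem pathSum_le {W q : S → ℝ} {X : ℕ → Ω → S} {τ : ℕ → Ω → ℝ} {ω : Ω}
    (h0 : ∀ i, 0 ≤ τ i ω / q (X i ω)) {L : ℝ} (hL : ∀ x, W x ≤ L) (n : ℕ) :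
    pathSum W q X τ n ω ≤ L * jumpTime q X τ n ω := by
  rw [jumpTime, Finset.mul_sum]
  exact Finset.sum_le_sum fun i _ => mul_le_mul_of_nonneg_right (hL _) (h0 i)

theorem jumpTime_mono {q : S → ℝ} {X : ℕ → Ω → S} {τ : ℕ → Ω → ℝ} {ω : Ω}
    (h0 : ∀ i, 0 ≤ τ i ω / q (X i ω)) : Monotone fun n => jumpTime q X τ n ω :=
  monotone_nat_of_le_succ fun n => by rw [jumpTime_succ]; linarith [h0 n]

variable [MeasurableSpace S]

theorem measurable_pathSum [MeasurableSpace Ω] {W q : S → ℝ} (hW : Measurable W)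
    (hq : Measurable q) {X : ℕ → Ω → S} {τ : ℕ → Ω → ℝ} (hX : ∀ n, Measurable (X n))
    (hτ : ∀ n, Measurable (τ n)) (n : ℕ) : Measurable (pathSum W q X τ n) := by
  unfold pathSum
  refine Finset.measurable_sum _ fun i _ => ?_
  have := hX i
  have := hτ i
  fun_prop

theorem intervalIntegrable_jumpProcess {W : S → ℝ} (hW : Measurable W) {L : ℝ}
    (hL : ∀ x, |W x| ≤ L) (q : S → ℝ) (X : ℕ → Ω → S) (τ : ℕ → Ω → ℝ) (ω : Ω) (a b : ℝ) :
    IntervalIntegrable (fun t => W (jumpProcess q X τ t ω)) volume a b := by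
  have hm : Measurable fun t => W (jumpProcess q X τ t ω) :=
    hW.comp (measurable_jumpProcess_path q X τ ω)
  refine (intervalIntegrable_const (c := L)).mono_fun hm.aestronglyMeasurable
    (Eventually.of_forall fun t => ?_)
  exact (hL _).trans (le_abs_self L)

theorem intervalIntegral_jumpProcess {W : S → ℝ} (hW : Measurable W) {L : ℝ}
    (hL : ∀ x, |W x| ≤ L) {q : S → ℝ} {X : ℕ → Ω → S} {τ : ℕ → Ω → ℝ} {ω : Ω}
    (h0 : ∀ i, 0 ≤ τ i ω / q (X i ω)) {n : ℕ} {T : ℝ} (h1 : jumpTime q X τ n ω ≤ T)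
    (h2 : T ≤ jumpTime q X τ (n + 1) ω) :
    ∫ t in (0)..T, W (jumpProcess q X τ t ω) =
      pathSum W q X τ n ω + W (X n ω) * (T - jumpTime q X τ n ω) := by
  have hpiece : ∀ (n : ℕ) (T : ℝ), jumpTime q X τ n ω ≤ T → T ≤ jumpTime q X τ (n + 1) ω →
      ∫ t in (jumpTime q X τ n ω)..T, W (jumpProcess q X τ t ω) =
        W (X n ω) * (T - jumpTime q X τ n ω) := by
    intro n T h1 h2
    rw [intervalIntegral.integral_congr_Ioo_of_le (g := fun _ => W (X n ω)) h1,
      intervalIntegral.integral_const, smul_eq_mul, mul_comm]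
    intro t ht
    simp only
    rw [jumpProcess_eq q X τ ω h0 n t ht.1.le (ht.2.trans_le h2)]
  have hsum : ∀ n, ∫ t in (0)..(jumpTime q X τ n ω), W (jumpProcess q X τ t ω) =
      pathSum W q X τ n ω := by
    intro n
    induction n with
    | zero => simp [jumpTime, pathSum]
    | succ n ih =>
      rw [← intervalIntegral.integral_add_adjacent_intervals
        (intervalIntegrable_jumpProcess hW hL q X τ ω 0 (jumpTime q X τ n ω))
        (intervalIntegrable_jumpProcess hW hL q X τ ω _ _), ih,
        hpiece n _ (by rw [jumpTime_succ]; linarith [h0 n]) le_rfl, pathSum_succ, jumpTime_succ]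
      ring
  rw [← intervalIntegral.integral_add_adjacent_intervals
    (intervalIntegrable_jumpProcess hW hL q X τ ω 0 (jumpTime q X τ n ω))
    (intervalIntegrable_jumpProcess hW hL q X τ ω _ _), hsum, hpiece n T h1 h2]

theorem mul_integral_empiricalMeasure {W : S → ℝ} (hW : Measurable W) (q : S → ℝ) (X : ℕ → Ω → S)
    (τ : ℕ → Ω → ℝ) (ω : Ω) {T : ℝ} (hT : 0 < T) :
    T * ∫ x, W x ∂(empiricalMeasure q X τ T ω : Measure S) =
      ∫ t in (0)..T, W (jumpProcess q X τ t ω) := by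
  have h1 : (empiricalMeasure q X τ T ω : Measure S) = occupation q X τ T ω := by
    have : empiricalMeasure q X τ T ω =
        ⟨occupation q X τ T ω, isProbabilityMeasure_occupation q X τ T hT ω⟩ := dif_pos hT
    rw [this]; rfl
  rw [h1, occupation, integral_smul_measure,
    integral_map (measurable_jumpProcess_path q X τ ω).aemeasurable hW.aestronglyMeasurable,
    ENNReal.toReal_ofReal (by positivity), smul_eq_mul, ← mul_assoc, mul_one_div_cancel hT.ne',
    one_mul, intervalIntegral.integral_of_le hT.le, integral_Ico_eq_integral_Ioo,
    integral_Ioc_eq_integral_Ioo]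

end Path


/-! ### The exponential martingale identity -/

section Martingale

variable {S Ω : Type*} [TopologicalSpace S] [CompactSpace S] [MeasurableSpace S]
  [BorelSpace S] [MeasurableSpace Ω] {P : Measure Ω} [IsProbabilityMeasure P]
  {q : S → ℝ} {α : Kernel S S} [IsMarkovKernel α] {X : ℕ → Ω → S} {τ : ℕ → Ω → ℝ}

/-- The weight `u(X_n) exp(∫_0^{T_n} W(X_s) ds)` on the event that the `n`-th jump time `T_n` is at
most `T`. -/
noncomputable def jumpedWeight (W q u : S → ℝ) (X : ℕ → Ω → S) (τ : ℕ → Ω → ℝ) (T : ℝ) (n : ℕ)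
    (ω : Ω) : ℝ≥0∞ :=
  if jumpTime q X τ n ω ≤ T then ENNReal.ofReal (u (X n ω) * Real.exp (pathSum W q X τ n ω)) else 0

/-- The weight `u(X_T) exp(∫_0^T W(X_s) ds)` on the event that there are exactly `n` jumps up to
time `T`. -/
noncomputable def currentWeight (W q u : S → ℝ) (X : ℕ → Ω → S) (τ : ℕ → Ω → ℝ) (T : ℝ) (n : ℕ)
    (ω : Ω) : ℝ≥0∞ :=
  if jumpTime q X τ n ω ≤ T ∧ T < jumpTime q X τ n ω + τ n ω / q (X n ω) then
    ENNReal.ofReal (u (X n ω) *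
      Real.exp (pathSum W q X τ n ω + W (X n ω) * (T - jumpTime q X τ n ω))) else 0

theorem measurable_jumpTime (hq : Measurable q) (hX : ∀ n, Measurable (X n))
    (hτ : ∀ n, Measurable (τ n)) (n : ℕ) : Measurable (jumpTime q X τ n) := by
  have := measurable_pathSum (W := fun _ => 1) measurable_const hq hX hτ n
  exact (funext (pathSum_one q X τ n)) ▸ this

theorem measurable_currentWeight {W u : S → ℝ} (hW : Measurable W) (hq : Measurable q)
    (hu : Measurable u) (hX : ∀ n, Measurable (X n)) (hτ : ∀ n, Measurable (τ n)) (T : ℝ) (n : ℕ) :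
    Measurable (currentWeight W q u X τ T n) := by
  have h1 := measurable_jumpTime hq hX hτ n
  have h2 := measurable_pathSum hW hq hX hτ n
  have h3 := hX n
  have h4 := hτ n
  unfold currentWeight
  have hs1 : MeasurableSet {ω | jumpTime q X τ n ω ≤ T} := measurableSet_le h1 measurable_const
  have hs2 : MeasurableSet {ω | T < jumpTime q X τ n ω + τ n ω / q (X n ω)} :=
    measurableSet_lt measurable_const (by fun_prop)
  exact Measurable.ite (hs1.inter hs2) (by fun_prop) measurable_const

theorem IsJumpData.ae_nonneg (h : IsJumpData P α X τ) (hq : ∀ x, 0 < q x) :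
    ∀ᵐ ω ∂P, ∀ i, 0 ≤ τ i ω / q (X i ω) := by
  rw [ae_all_iff]
  intro i
  have h1 := ae_nonneg_expMeasure 1
  rw [← h.law_time i] at h1
  filter_upwards [ae_of_ae_map (h.measurable_time i).aemeasurable h1] with ω hω
  exact div_nonneg hω (hq _).le

/-- After the `n`-th jump, either the next jump falls beyond `T` or it occurs by `T`; conditionally
on the past, the two contributions add up by `lintegral_one_step`. -/
theorem IsJumpData.lintegral_jumpedWeight (h : IsJumpData P α X τ) (hF : IsFeller α)
    (hqc : Continuous q) (hq : ∀ x, 0 < q x) {u : S → ℝ} (hu : Continuous u) (hpos : ∀ x, 0 < u x)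
    (T : ℝ) (n : ℕ) :
    ∫⁻ ω, jumpedWeight (tiltPotential q α u) q u X τ T n ω ∂P =
      ∫⁻ ω, currentWeight (tiltPotential q α u) q u X τ T n ω ∂P +
        ∫⁻ ω, jumpedWeight (tiltPotential q α u) q u X τ T (n + 1) ω ∂P := by
  have hqm := hqc.measurable
  have hum := hu.measurable
  set W := tiltPotential q α u with hW_def
  have hW : Measurable W := (continuous_tiltPotential hF hqc hu hpos).measurable
  set x : ℕ → (ℕ → S) × (ℕ → ℝ) → S := fun i z => z.1 i with hx_def
  set s : ℕ → (ℕ → S) × (ℕ → ℝ) → ℝ := fun i z => z.2 i with hs_def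
  have hx : ∀ i, Measurable (x i) := fun i => (measurable_pi_apply i).comp measurable_fst
  have hs : ∀ i, Measurable (s i) := fun i => (measurable_pi_apply i).comp measurable_snd
  have hc := measurable_jumpTime hqm hx hs n
  have ha := measurable_pathSum hW hqm hx hs n
  have hxn := hx n
  have hax : ∀ ω, pathSum W q x s n (stoppedChain X n ω, pastTimes τ n ω) = pathSum W q X τ n ω :=
    fun ω => pathSum_stopped W q X τ n ω
  have hcx : ∀ ω, jumpTime q x s n (stoppedChain X n ω, pastTimes τ n ω) = jumpTime q X τ n ω :=
    fun ω => by
      rw [← pathSum_one, ← pathSum_one]; exact pathSum_stopped _ q X τ n ω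
  have hxx : ∀ ω, x n (stoppedChain X n ω, pastTimes τ n ω) = X n ω := fun ω => by
    simp [hx_def, stoppedChain]
  set G₁ : ((ℕ → S) × (ℕ → ℝ)) × (ℝ × S) → ℝ≥0∞ := fun p =>
    if jumpTime q x s n p.1 ≤ T ∧ T < jumpTime q x s n p.1 + p.2.1 / q (x n p.1) then
      ENNReal.ofReal (u (x n p.1) * Real.exp (pathSum W q x s n p.1 +
        W (x n p.1) * (T - jumpTime q x s n p.1))) else 0 with hG₁
  set G₂ : ((ℕ → S) × (ℕ → ℝ)) × (ℝ × S) → ℝ≥0∞ := fun p =>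
    (if jumpTime q x s n p.1 + p.2.1 / q (x n p.1) ≤ T then
      ENNReal.ofReal (Real.exp (pathSum W q x s n p.1 + W (x n p.1) * (p.2.1 / q (x n p.1))))
        else 0) * ENNReal.ofReal (u p.2.2) with hG₂
  have hG₁m : Measurable G₁ := by
    have hs1 : MeasurableSet {p : ((ℕ → S) × (ℕ → ℝ)) × (ℝ × S) | jumpTime q x s n p.1 ≤ T} :=
      measurableSet_le (by fun_prop) measurable_const
    have hs2 : MeasurableSet {p : ((ℕ → S) × (ℕ → ℝ)) × (ℝ × S) |
        T < jumpTime q x s n p.1 + p.2.1 / q (x n p.1)} :=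
      measurableSet_lt measurable_const (by fun_prop)
    exact Measurable.ite (hs1.inter hs2) (by fun_prop) measurable_const
  have hG₂m : Measurable G₂ := by
    have hs1 : MeasurableSet {p : ((ℕ → S) × (ℕ → ℝ)) × (ℝ × S) |
        jumpTime q x s n p.1 + p.2.1 / q (x n p.1) ≤ T} :=
      measurableSet_le (by fun_prop) measurable_const
    exact Measurable.mul (Measurable.ite hs1 (by fun_prop) measurable_const) (by fun_prop)
  have e1 : ∀ ω, currentWeight W q u X τ T n ω =
      G₁ ((stoppedChain X n ω, pastTimes τ n ω), (τ n ω, X (n + 1) ω)) := fun ω => by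
    simp only [hG₁, hax, hcx, hxx]
    rfl
  have e2 : ∀ ω, jumpedWeight W q u X τ T (n + 1) ω =
      G₂ ((stoppedChain X n ω, pastTimes τ n ω), (τ n ω, X (n + 1) ω)) := fun ω => by
    simp only [hG₂, hax, hcx, hxx, jumpedWeight, pathSum_succ, jumpTime_succ]
    split_ifs
    · rw [← ENNReal.ofReal_mul (Real.exp_pos _).le, mul_comm]
    · rw [zero_mul]
  simp only [e1, e2]
  have hG₁ω : Measurable fun ω =>
      G₁ ((stoppedChain X n ω, pastTimes τ n ω), (τ n ω, X (n + 1) ω)) :=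
    hG₁m.comp (((h.measurable_stoppedChain n).prodMk
      (h.measurable_pastTimes n)).prodMk ((h.measurable_time n).prodMk (h.measurable_chain (n + 1))))
  rw [← lintegral_add_left hG₁ω,
    h.lintegral_step n (G := fun p => G₁ p + G₂ p) (hG₁m.add hG₂m)]
  refine lintegral_congr fun ω => ?_
  have h1 := lintegral_one_step (hq (X n ω)) (hpos (X n ω))
    (integral_kernel_pos (α := α) hu hpos (X n ω)) T (jumpTime q X τ n ω) (pathSum W q X τ n ω)
  rw [jumpedWeight, ← h1]
  refine lintegral_congr fun t => ?_
  simp only [hG₁, hG₂, hax, hcx, hxx]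
  rw [lintegral_add_left measurable_const, lintegral_const_mul _ (by fun_prop),
    ← ofReal_integral_eq_lintegral_ofReal (integrable_of_continuous hu _)
      (Eventually.of_forall fun y => (hpos y).le)]
  simp only [lintegral_const, measure_univ, mul_one, ite_mul, zero_mul]
  rfl

theorem IsJumpData.lintegral_exp_neg_sum (h : IsJumpData P α X τ) (n : ℕ) :
    ∫⁻ ω, ENNReal.ofReal (Real.exp (-∑ i ∈ Finset.range n, τ i ω)) ∂P = 2⁻¹ ^ n := by
  induction n with
  | zero => simp
  | succ n ih =>
    have hG : Measurable fun p : ((ℕ → S) × (ℕ → ℝ)) × (ℝ × S) =>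
        ENNReal.ofReal (Real.exp (-∑ i ∈ Finset.range n, p.1.2 i)) *
          ENNReal.ofReal (Real.exp (-p.2.1)) := by fun_prop
    have hsum : ∀ ω, ∑ i ∈ Finset.range n, pastTimes τ n ω i = ∑ i ∈ Finset.range n, τ i ω :=
      fun ω => Finset.sum_congr rfl fun i hi => if_pos (Finset.mem_range.1 hi)
    have h1 := h.lintegral_step n hG
    simp only [hsum, lintegral_const, measure_univ, mul_one] at h1
    rw [pow_succ, ← ih, ← lintegral_exp_neg_expMeasure]
    rw [← lintegral_mul_const' _ _ (by rw [lintegral_exp_neg_expMeasure]; simp)]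
    refine Eq.trans (lintegral_congr fun ω => ?_) (h1.trans (lintegral_congr fun ω => ?_))
    · rw [Finset.sum_range_succ, neg_add, Real.exp_add, ENNReal.ofReal_mul (Real.exp_pos _).le]
    · rw [lintegral_const_mul _ (by fun_prop)]

/-- Jumping `n` times by `T` forces `∑ τ i ≤ K T`. Markov's inequality for `exp(-∑ τ i)` then gives
a factor `1/2` per jump, which rules out explosion. -/
theorem IsJumpData.measure_jumpTime_le (h : IsJumpData P α X τ) (hq : ∀ x, 0 < q x) {K : ℝ}
    (hK : ∀ x, q x ≤ K) {T : ℝ} (n : ℕ) :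
    P {ω | jumpTime q X τ n ω ≤ T} ≤ ENNReal.ofReal (Real.exp (K * T)) * 2⁻¹ ^ n := by
  rw [← h.lintegral_exp_neg_sum n, ← lintegral_const_mul' _ _ ENNReal.ofReal_ne_top]
  have hτ := h.measurable_time
  calc P {ω | jumpTime q X τ n ω ≤ T}
      ≤ P {ω | 1 ≤ ENNReal.ofReal (Real.exp (K * T)) *
          ENNReal.ofReal (Real.exp (-∑ i ∈ Finset.range n, τ i ω))} := by
        refine measure_mono_ae ?_
        filter_upwards [h.ae_nonneg hq] with ω hω (hT : jumpTime q X τ n ω ≤ T)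
        change 1 ≤ _
        rw [← ENNReal.ofReal_mul (Real.exp_pos _).le, ← Real.exp_add, ENNReal.one_le_ofReal,
          Real.one_le_exp_iff]
        have h1 : ∑ i ∈ Finset.range n, τ i ω ≤ K * jumpTime q X τ n ω := by
          rw [jumpTime, Finset.mul_sum]
          refine Finset.sum_le_sum fun i _ => ?_
          calc τ i ω = q (X i ω) * (τ i ω / q (X i ω)) := by
                have := (hq (X i ω)).ne'; field_simp
            _ ≤ _ := mul_le_mul_of_nonneg_right (hK _) (hω i)
        rcases Nat.eq_zero_or_pos n with rfl | hn
        · have hT' : 0 ≤ T := by simpa [jumpTime] using hT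
          have hK0 : 0 < K := (hq (X 0 ω)).trans_le (hK _)
          simpa using mul_nonneg hK0.le hT'
        · have hK0 : 0 < K := (hq (X 0 ω)).trans_le (hK _)
          have : K * jumpTime q X τ n ω ≤ K * T := mul_le_mul_of_nonneg_left hT hK0.le
          linarith
    _ ≤ _ := by
        have := mul_meas_ge_le_lintegral₀ (μ := P) (f := fun ω =>
          ENNReal.ofReal (Real.exp (K * T)) *
            ENNReal.ofReal (Real.exp (-∑ i ∈ Finset.range n, τ i ω))) (by fun_prop) 1
        rwa [one_mul] at this

theorem IsJumpData.tendsto_measure_jumpTime_le (h : IsJumpData P α X τ) (hqc : Continuous q)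
    (hq : ∀ x, 0 < q x) (T : ℝ) :
    Tendsto (fun n => P {ω | jumpTime q X τ n ω ≤ T}) atTop (𝓝 0) := by
  obtain ⟨K, -, hK⟩ := exists_le_of_continuous hqc
  refine tendsto_of_tendsto_of_tendsto_of_le_of_le tendsto_const_nhds ?_ (fun _ => zero_le)
    (fun n => h.measure_jumpTime_le hq (fun x => (le_abs_self _).trans (hK x)) n)
  have h1 : Tendsto (fun n : ℕ => (2⁻¹ : ℝ≥0∞) ^ n) atTop (𝓝 0) :=
    ENNReal.tendsto_pow_atTop_nhds_zero_of_lt_one (by simp)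
  simpa using ENNReal.Tendsto.const_mul h1 (Or.inr (ENNReal.ofReal_ne_top
    (r := Real.exp (K * T))))

theorem IsJumpData.ae_exists_jumpTime (h : IsJumpData P α X τ) (hqc : Continuous q)
    (hq : ∀ x, 0 < q x) {T : ℝ} (hT : 0 ≤ T) :
    ∀ᵐ ω ∂P, ∃ n, jumpTime q X τ n ω ≤ T ∧ T < jumpTime q X τ (n + 1) ω := by
  have h0 : P {ω | ∀ n, jumpTime q X τ n ω ≤ T} = 0 := by
    refine le_antisymm (ge_of_tendsto' (h.tendsto_measure_jumpTime_le hqc hq T) fun n => ?_) zero_le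
    exact measure_mono fun ω hω => hω n
  filter_upwards [measure_eq_zero_iff_ae_notMem.1 h0] with ω hω
  have hex : ∃ n, T < jumpTime q X τ n ω := by
    by_contra hne
    push Not at hne
    exact hω hne
  classical
  have hpos : Nat.find hex ≠ 0 := by
    intro h0
    have := Nat.find_spec hex
    rw [h0] at this
    simp only [jumpTime, Finset.range_zero, Finset.sum_empty] at this
    linarith
  obtain ⟨n, hn⟩ := Nat.exists_eq_succ_of_ne_zero hpos
  refine ⟨n, not_lt.1 (Nat.find_min hex (by omega)), ?_⟩
  have := Nat.find_spec hex
  rwa [hn] at this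

theorem IsJumpData.tendsto_lintegral_jumpedWeight (h : IsJumpData P α X τ)
    (hqc : Continuous q) (hq : ∀ x, 0 < q x) {u W : S → ℝ} (hu : Continuous u)
    (hW : Continuous W) (T : ℝ) :
    Tendsto (fun n => ∫⁻ ω, jumpedWeight W q u X τ T n ω ∂P) atTop (𝓝 0) := by
  obtain ⟨M, hM0, hM⟩ := exists_le_of_continuous hu
  obtain ⟨L, hL0, hL⟩ := exists_le_of_continuous hW
  have hbd : ∀ n, ∫⁻ ω, jumpedWeight W q u X τ T n ω ∂P ≤
      ENNReal.ofReal (M * Real.exp (L * T)) * P {ω | jumpTime q X τ n ω ≤ T} := by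
    intro n
    have hs : MeasurableSet {ω | jumpTime q X τ n ω ≤ T} :=
      measurableSet_le (measurable_jumpTime hqc.measurable h.measurable_chain h.measurable_time n)
        measurable_const
    rw [← lintegral_indicator_const hs]
    refine lintegral_mono_ae ?_
    filter_upwards [h.ae_nonneg hq] with ω hω
    by_cases hT : jumpTime q X τ n ω ≤ T
    · rw [Set.indicator_of_mem (by exact hT), jumpedWeight, if_pos hT]
      refine ENNReal.ofReal_le_ofReal ?_
      refine mul_le_mul ((le_abs_self _).trans (hM _)) (Real.exp_le_exp.2 ?_) (Real.exp_pos _).le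
        hM0.le
      exact (pathSum_le hω (fun x => (le_abs_self _).trans (hL x)) n).trans
        (mul_le_mul_of_nonneg_left hT hL0.le)
    · rw [jumpedWeight, if_neg hT]
      exact zero_le
  refine tendsto_of_tendsto_of_tendsto_of_le_of_le tendsto_const_nhds ?_ (fun _ => zero_le) hbd
  simpa using ENNReal.Tendsto.const_mul (h.tendsto_measure_jumpTime_le hqc hq T)
    (Or.inr (ENNReal.ofReal_ne_top (r := M * Real.exp (L * T))))

/-- Exactly one holding interval contains `T`, so a single term survives. -/
theorem tsum_currentWeight {W u : S → ℝ} (hW : Continuous W) {T : ℝ}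
    (hT : 0 < T) {ω : Ω} (h0 : ∀ i, 0 ≤ τ i ω / q (X i ω)) {n : ℕ}
    (h1 : jumpTime q X τ n ω ≤ T) (h2 : T < jumpTime q X τ (n + 1) ω) :
    ∑' k, currentWeight W q u X τ T k ω =
      ENNReal.ofReal (u (jumpProcess q X τ T ω) *
        Real.exp (T * ∫ x, W x ∂(empiricalMeasure q X τ T ω : Measure S))) := by
  obtain ⟨L, -, hL⟩ := exists_le_of_continuous hW
  have hmono := jumpTime_mono h0
  rw [tsum_eq_single n, currentWeight, ← jumpTime_succ, if_pos ⟨h1, h2⟩,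
    jumpProcess_eq q X τ ω h0 n T h1 h2, mul_integral_empiricalMeasure hW.measurable q X τ ω hT,
    intervalIntegral_jumpProcess hW.measurable hL h0 h1 h2.le]
  intro k hk
  rw [currentWeight, ← jumpTime_succ, if_neg]
  rintro ⟨h3, h4⟩
  rcases lt_or_gt_of_ne hk with hlt | hlt
  · have := hmono (show k + 1 ≤ n by omega)
    simp only at this
    linarith
  · have := hmono (show n + 1 ≤ k by omega)
    simp only at this
    linarith

/-- The exponential martingale: `E[u(X(T)) exp(∫_0^T W(X(s)) ds)] = E[u(X(0))]` for the potential
`W = - L u / u`. -/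
theorem IsJumpData.lintegral_exp_empiricalMeasure (h : IsJumpData P α X τ) (hF : IsFeller α)
    (hqc : Continuous q) (hq : ∀ x, 0 < q x) {u : S → ℝ} (hu : Continuous u) (hpos : ∀ x, 0 < u x)
    {T : ℝ} (hT : 0 < T) :
    ∫⁻ ω, ENNReal.ofReal (u (jumpProcess q X τ T ω) * Real.exp
        (T * ∫ x, tiltPotential q α u x ∂(empiricalMeasure q X τ T ω : Measure S))) ∂P =
      ∫⁻ ω, ENNReal.ofReal (u (X 0 ω)) ∂P := by
  have hWc := continuous_tiltPotential (α := α) hF hqc hu hpos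
  set W := tiltPotential q α u with hW_def
  have hstep := h.lintegral_jumpedWeight hF hqc hq hu hpos T
  -- The one-step identity telescopes; the remainder vanishes because `n` jumps by time `T` become
  -- improbable.
  have hsum : ∀ n, ∫⁻ ω, jumpedWeight W q u X τ T 0 ω ∂P =
      ∑ k ∈ Finset.range n, ∫⁻ ω, currentWeight W q u X τ T k ω ∂P +
        ∫⁻ ω, jumpedWeight W q u X τ T n ω ∂P := by
    intro n
    induction n with
    | zero => simp
    | succ n ih => rw [ih, hstep n, Finset.sum_range_succ, add_assoc]
  have hlim : Tendsto (fun n => ∑ k ∈ Finset.range n, ∫⁻ ω, currentWeight W q u X τ T k ω ∂P +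
      ∫⁻ ω, jumpedWeight W q u X τ T n ω ∂P) atTop
      (𝓝 (∑' k, ∫⁻ ω, currentWeight W q u X τ T k ω ∂P + 0)) :=
    ENNReal.summable.hasSum.tendsto_sum_nat.add
      (h.tendsto_lintegral_jumpedWeight hqc hq hu hWc T)
  simp only [← hsum] at hlim
  have hzero := tendsto_nhds_unique hlim tendsto_const_nhds
  rw [add_zero, ← lintegral_tsum fun k => (measurable_currentWeight hWc.measurable hqc.measurable
    hu.measurable h.measurable_chain h.measurable_time T k).aemeasurable] at hzero
  calc _ = ∫⁻ ω, ∑' k, currentWeight W q u X τ T k ω ∂P := by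
        refine lintegral_congr_ae ?_
        filter_upwards [h.ae_nonneg hq, h.ae_exists_jumpTime hqc hq hT.le] with ω h0 ⟨n, h1, h2⟩
        exact (tsum_currentWeight hWc hT h0 h1 h2).symm
    _ = _ := by
        rw [hzero]
        refine lintegral_congr fun ω => ?_
        simp [jumpedWeight, jumpTime, pathSum, hT.le]

end Martingale

/-! ### The large deviation bounds -/

section LargeDeviations

variable {S Ω : Type*} [TopologicalSpace S] [CompactSpace S] [PolishSpace S] [MeasurableSpace S]
  [BorelSpace S] [MeasurableSpace Ω] {P : Measure Ω} [IsProbabilityMeasure P]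
  {q : S → ℝ} {α : Kernel S S} [IsMarkovKernel α] {μ : Measure S} [IsProbabilityMeasure μ]
  {X : ℕ → Ω → S} {τ : ℕ → Ω → ℝ}

/-- Measurability comes from the series over the number of jumps, which agrees with the functional
almost surely. -/
theorem IsJumpData.aemeasurable_exp_empiricalMeasure (h : IsJumpData P α X τ)
    (hqc : Continuous q) (hq : ∀ x, 0 < q x) {u W : S → ℝ} (hu : Continuous u) (hW : Continuous W)
    {T : ℝ} (hT : 0 < T) :
    AEMeasurable (fun ω => ENNReal.ofReal (u (jumpProcess q X τ T ω) * Real.exp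
        (T * ∫ x, W x ∂(empiricalMeasure q X τ T ω : Measure S)))) P := by
  refine ⟨fun ω => ∑' k, currentWeight W q u X τ T k ω, ?_, ?_⟩
  · exact Measurable.tsum fun k => measurable_currentWeight hW.measurable hqc.measurable
      hu.measurable h.measurable_chain h.measurable_time T k
  · filter_upwards [h.ae_nonneg hq, h.ae_exists_jumpTime hqc hq hT.le] with ω h0 ⟨n, h1, h2⟩
    exact (tsum_currentWeight hW hT h0 h1 h2).symm

/-- The exponential upper bound, with an additional weight `exp(T ∫ V dη_T)`. -/
theorem ReversibleJump.exists_setLIntegral_le (H : ReversibleJump q α μ) (h : IsJumpData P α X τ)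
    {V : S → ℝ} (hV : Continuous V) {C : Set (ProbabilityMeasure S)} (hC : IsClosed C) {l : ℝ}
    (hl : ∀ η ∈ C, l < rateReal q α μ η - ∫ x, V x ∂(η : Measure S)) :
    ∃ K : ℝ≥0∞, K ≠ ∞ ∧ ∀ T : ℝ, 0 < T →
      ∫⁻ ω in {ω | empiricalMeasure q X τ T ω ∈ C}, ENNReal.ofReal
        (Real.exp (T * ∫ x, V x ∂(empiricalMeasure q X τ T ω : Measure S))) ∂P ≤
      K * ENNReal.ofReal (Real.exp (-(l * T))) := by
  refine hC.isCompact.induction_on (p := fun D => ∃ K : ℝ≥0∞, K ≠ ∞ ∧ ∀ T : ℝ, 0 < T →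
      ∫⁻ ω in {ω | empiricalMeasure q X τ T ω ∈ D}, ENNReal.ofReal
        (Real.exp (T * ∫ x, V x ∂(empiricalMeasure q X τ T ω : Measure S))) ∂P ≤
      K * ENNReal.ofReal (Real.exp (-(l * T)))) ?_ ?_ ?_ ?_
  · exact ⟨0, ENNReal.zero_ne_top, fun T _ => by simp⟩
  · rintro s t hst ⟨K, hK, hb⟩
    have hsub (T : ℝ) : {ω | empiricalMeasure q X τ T ω ∈ s} ⊆ {ω | empiricalMeasure q X τ T ω ∈ t} :=
      fun _ hω => hst hω
    exact ⟨K, hK, fun T hT => (lintegral_mono_set (hsub T)).trans (hb T hT)⟩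
  · rintro s t ⟨K, hK, hb⟩ ⟨K', hK', hb'⟩
    refine ⟨K + K', ENNReal.add_ne_top.2 ⟨hK, hK'⟩, fun T hT => ?_⟩
    rw [add_mul]
    refine le_trans ?_ (add_le_add (hb T hT) (hb' T hT))
    rw [← lintegral_add_measure]
    exact lintegral_mono' (Measure.restrict_union_le _ _) le_rfl
  · intro η hη
    -- Half of the gap is given up, so `∫ W_u - ∫ V` still exceeds `l` at `η`, and by continuity
    -- nearby. There the weight is bounded by `exp(-l T)` times the martingale.
    obtain ⟨u, hu, hu0, h1⟩ := H.exists_rateReal_le η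
      (ε := (rateReal q α μ η - ∫ x, V x ∂(η : Measure S) - l) / 2) (by linarith [hl η hη])
    have hWc := continuous_tiltPotential (α := α) H.feller H.continuous_rate hu hu0
    set W := tiltPotential q α u with hW_def
    have hnhds : ∀ᶠ ν : ProbabilityMeasure S in 𝓝 η,
        l + ∫ x, V x ∂(ν : Measure S) < ∫ x, W x ∂(ν : Measure S) := by
      have hlim := ((continuous_integral_of_continuous hWc).sub
        (continuous_integral_of_continuous hV)).tendsto η
      have hlt : l < ∫ x, W x ∂(η : Measure S) - ∫ x, V x ∂(η : Measure S) := by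
        linarith [hl η hη]
      filter_upwards [hlim.eventually (lt_mem_nhds hlt)] with ν hν
      exact add_lt_of_lt_sub_right hν
    obtain ⟨m, hm, hmu⟩ := exists_pos_le_of_continuous hu hu0
    obtain ⟨M, hM, hMu⟩ := exists_le_of_continuous hu
    refine ⟨_, nhdsWithin_le_nhds hnhds, ENNReal.ofReal (m⁻¹ * M), ENNReal.ofReal_ne_top,
      fun T hT => ?_⟩
    set g : Ω → ℝ≥0∞ := fun ω => ENNReal.ofReal (u (jumpProcess q X τ T ω) * Real.exp
        (T * ∫ x, W x ∂(empiricalMeasure q X τ T ω : Measure S))) with hg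
    have hgm : AEMeasurable g P :=
      h.aemeasurable_exp_empiricalMeasure H.continuous_rate H.rate_pos hu hWc hT
    have hmart := h.lintegral_exp_empiricalMeasure H.feller H.continuous_rate H.rate_pos hu hu0 hT
    calc _ ≤ ∫⁻ ω in {ω | empiricalMeasure q X τ T ω ∈ {ν : ProbabilityMeasure S |
              l + ∫ x, V x ∂(ν : Measure S) < ∫ x, W x ∂(ν : Measure S)}},
            ENNReal.ofReal (m⁻¹ * Real.exp (-(l * T))) * g ω ∂P := by
          refine setLIntegral_mono_ae (hgm.restrict.const_mul _) (Eventually.of_forall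
            fun ω hω => ?_)
          have hω' : l + ∫ x, V x ∂(empiricalMeasure q X τ T ω : Measure S) <
            ∫ x, W x ∂(empiricalMeasure q X τ T ω : Measure S) := hω
          rw [hg, ← ENNReal.ofReal_mul (by positivity)]
          refine ENNReal.ofReal_le_ofReal ?_
          have e1 : Real.exp (T * ∫ x, V x ∂(empiricalMeasure q X τ T ω : Measure S)) ≤
              Real.exp (-(l * T)) *
                Real.exp (T * ∫ x, W x ∂(empiricalMeasure q X τ T ω : Measure S)) := by
            rw [← Real.exp_add]
            refine Real.exp_le_exp.2 ?_
            nlinarith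
          have e2 : 1 ≤ m⁻¹ * u (jumpProcess q X τ T ω) := by
            rw [inv_mul_eq_div, one_le_div hm]; exact hmu _
          calc _ ≤ 1 * (Real.exp (-(l * T)) *
                Real.exp (T * ∫ x, W x ∂(empiricalMeasure q X τ T ω : Measure S))) := by
                rw [one_mul]; exact e1
            _ ≤ (m⁻¹ * u (jumpProcess q X τ T ω)) * (Real.exp (-(l * T)) *
                Real.exp (T * ∫ x, W x ∂(empiricalMeasure q X τ T ω : Measure S))) := by
                gcongr
            _ = _ := by ring
      _ ≤ ∫⁻ ω, ENNReal.ofReal (m⁻¹ * Real.exp (-(l * T))) * g ω ∂P := setLIntegral_le_lintegral _ _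
      _ = ENNReal.ofReal (m⁻¹ * Real.exp (-(l * T))) * ∫⁻ ω, ENNReal.ofReal (u (X 0 ω)) ∂P := by
          rw [lintegral_const_mul' _ _ ENNReal.ofReal_ne_top, hmart]
      _ ≤ ENNReal.ofReal (m⁻¹ * Real.exp (-(l * T))) * ENNReal.ofReal M := by
          gcongr
          calc _ ≤ ∫⁻ _, ENNReal.ofReal M ∂P := lintegral_mono fun ω =>
                ENNReal.ofReal_le_ofReal ((le_abs_self _).trans (hMu _))
            _ = _ := by simp
      _ = _ := by
          rw [← ENNReal.ofReal_mul (by positivity), ← ENNReal.ofReal_mul (by positivity)]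
          congr 1; ring

theorem tendsto_one_div_mul_log {c a : ℝ} :
    Tendsto (fun T : ℝ => ((1 / T * (Real.log c - a * T) : ℝ) : EReal)) atTop
      (𝓝 ((-a : ℝ) : EReal)) := by
  refine (continuous_coe_real_ereal.tendsto _).comp ?_
  have h1 : Tendsto (fun T : ℝ => Real.log c * T⁻¹ - a) atTop (𝓝 (Real.log c * 0 - a)) :=
    (tendsto_inv_atTop_zero.const_mul _).sub_const _
  rw [mul_zero, zero_sub] at h1
  refine h1.congr' ?_
  filter_upwards [eventually_gt_atTop 0] with T hT
  field_simp

theorem one_div_mul_log_ofReal {c a T : ℝ} (hc : 0 < c) :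
    ((1 / T : ℝ) : EReal) * ENNReal.log (ENNReal.ofReal (c * Real.exp (-(a * T)))) =
      ((1 / T * (Real.log c - a * T) : ℝ) : EReal) := by
  rw [ENNReal.log_ofReal_of_pos (by positivity), Real.log_mul hc.ne' (Real.exp_pos _).ne',
    Real.log_exp, ← EReal.coe_mul, sub_eq_add_neg]

theorem limsup_log_le_of_le {p : ℝ → ℝ≥0∞} {K : ℝ≥0∞} (hK : K ≠ ∞) {l : ℝ}
    (hp : ∀ T, 0 < T → p T ≤ K * ENNReal.ofReal (Real.exp (-(l * T)))) :
    limsup (fun T : ℝ => ((1 / T : ℝ) : EReal) * ENNReal.log (p T)) atTop ≤ ((-l : ℝ) : EReal) := by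
  rw [← (tendsto_one_div_mul_log (c := K.toReal + 1) (a := l)).limsup_eq]
  refine limsup_le_limsup ?_
  filter_upwards [eventually_gt_atTop 0] with T hT
  -- The added one allows `K = 0`.
  have hc : 0 < K.toReal + 1 := by positivity
  rw [← one_div_mul_log_ofReal hc]
  refine mul_le_mul_of_nonneg_left (ENNReal.log_le_log_iff.2 ((hp T hT).trans ?_))
    (by exact_mod_cast (by positivity : (0 : ℝ) ≤ 1 / T))
  rw [ENNReal.ofReal_mul hc.le]
  gcongr
  exact ENNReal.le_ofReal_iff_toReal_le hK hc.le |>.2 (by linarith)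

theorem le_liminf_log_of_le {p : ℝ → ℝ≥0∞} {c : ℝ} (hc : 0 < c) {a : ℝ}
    (hp : ∀ᶠ T in atTop, ENNReal.ofReal (c * Real.exp (-(a * T))) ≤ p T) :
    ((-a : ℝ) : EReal) ≤ liminf (fun T : ℝ => ((1 / T : ℝ) : EReal) * ENNReal.log (p T)) atTop := by
  rw [← (tendsto_one_div_mul_log (c := c) (a := a)).liminf_eq]
  refine liminf_le_liminf ?_
  filter_upwards [eventually_gt_atTop 0, hp] with T hT hpT
  rw [← one_div_mul_log_ofReal hc]
  exact mul_le_mul_of_nonneg_left (ENNReal.log_le_log_iff.2 hpT)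
    (by exact_mod_cast (by positivity : (0 : ℝ) ≤ 1 / T))

theorem ReversibleJump.limsup_le (H : ReversibleJump q α μ) (h : IsJumpData P α X τ)
    {C : Set (ProbabilityMeasure S)} (hC : IsClosed C) :
    limsup (fun T : ℝ => ((1 / T : ℝ) : EReal) *
        ENNReal.log (P {ω | empiricalMeasure q X τ T ω ∈ C})) atTop ≤
      - (⨅ η ∈ C, rate q α μ η) := by
  by_contra hlt
  push Not at hlt
  obtain ⟨r, hr1, hr2⟩ := EReal.lt_iff_exists_real_btwn.1 hlt
  have hr : ((-r : ℝ) : EReal) < ⨅ η ∈ C, rate q α μ η := by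
    rw [EReal.coe_neg]; exact EReal.neg_lt_comm.1 hr1
  -- With zero weight the integral is the probability itself.
  obtain ⟨K, hK, hb⟩ := H.exists_setLIntegral_le h (V := fun _ => 0) continuous_const hC (l := -r)
    (fun η hη => by
      have := hr.trans_le (iInf₂_le η hη)
      rw [H.rate_eq, EReal.coe_lt_coe_iff] at this
      simpa using this)
  have := limsup_log_le_of_le hK (l := -r)
    (p := fun T => P {ω | empiricalMeasure q X τ T ω ∈ C}) (fun T hT => by
      have := hb T hT
      simp only [integral_zero, mul_zero, Real.exp_zero, ENNReal.ofReal_one, setLIntegral_one]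
        at this
      exact this)
  rw [neg_neg] at this
  exact absurd hr2 (not_lt.2 this)

/-- The lower bound for the probability of a neighbourhood of a measure with squared continuous
positive density. -/
theorem ReversibleJump.exists_le_measure (H : ReversibleJump q α μ) (h : IsJumpData P α X τ)
    {O : Set (ProbabilityMeasure S)} (hO : IsOpen O) {f : S → ℝ} (hf : Continuous f)
    (hpos : ∀ x, 0 < f x) {ν : ProbabilityMeasure S} (hν : (ν : Measure S) = squareLaw μ f)
    (hνO : ν ∈ O) {a : ℝ} (ha : ∫ x, tiltPotential q α f x ∂(ν : Measure S) < a) :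
    ∃ c : ℝ, 0 < c ∧ ∀ᶠ T in atTop, ENNReal.ofReal (c * Real.exp (-(a * T))) ≤
      P {ω | empiricalMeasure q X τ T ω ∈ O} := by
  have hVc := continuous_tiltPotential (α := α) H.feller H.continuous_rate hf hpos
  set V := tiltPotential q α f with hV_def
  have hVi := continuous_integral_of_continuous hVc
  -- Shrinking the neighbourhood bounds the exponential weight by `exp(a T)` on it.
  set O' : Set (ProbabilityMeasure S) := O ∩ {η | ∫ x, V x ∂(η : Measure S) < a} with hO'
  have hO'o : IsOpen O' := hO.inter (isOpen_lt hVi continuous_const)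
  have hνO' : ν ∈ O' := ⟨hνO, ha⟩
  have hgap : ∀ η ∈ O'ᶜ, 0 < rateReal q α μ η - ∫ x, V x ∂(η : Measure S) := by
    intro η hη
    by_contra hle
    have := H.eq_squareLaw_of_rateReal_le hf hpos η (by linarith)
    have hην : η = ν := ProbabilityMeasure.toMeasure_injective (this.trans hν.symm)
    exact hη (hην ▸ hνO')
  -- The gap vanishes only at `ν`; being lower semicontinuous, it attains a positive minimum on the
  -- compact complement, and half of that minimum serves as `l`.
  obtain ⟨l, hl0, hl⟩ : ∃ l, 0 < l ∧
      ∀ η ∈ O'ᶜ, l < rateReal q α μ η - ∫ x, V x ∂(η : Measure S) := by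
    rcases Set.eq_empty_or_nonempty O'ᶜ with he | hne
    · exact ⟨1, one_pos, fun η hη => by rw [he] at hη; exact hη.elim⟩
    · have hlsc : LowerSemicontinuous fun η : ProbabilityMeasure S =>
          rateReal q α μ η + -∫ x, V x ∂(η : Measure S) :=
        H.lowerSemicontinuous_rateReal.add hVi.neg.lowerSemicontinuous
      obtain ⟨η₀, hη₀, hmin⟩ := (hlsc.lowerSemicontinuousOn O'ᶜ).exists_isMinOn hne
        hO'o.isClosed_compl.isCompact
      have h0 := hgap η₀ hη₀
      refine ⟨(rateReal q α μ η₀ - ∫ x, V x ∂(η₀ : Measure S)) / 2, by linarith, fun η hη => ?_⟩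
      have : rateReal q α μ η₀ + -∫ x, V x ∂(η₀ : Measure S) ≤
        rateReal q α μ η + -∫ x, V x ∂(η : Measure S) := hmin hη
      linarith
  obtain ⟨K, hK, hb⟩ := H.exists_setLIntegral_le h hVc hO'o.isClosed_compl hl
  obtain ⟨m, hm, hmf⟩ := exists_pos_le_of_continuous hf hpos
  obtain ⟨M, hM, hMf⟩ := exists_le_of_continuous hf
  have hsmall : ∀ᶠ T in atTop, ENNReal.ofReal M * (K * ENNReal.ofReal (Real.exp (-(l * T)))) ≤
      ENNReal.ofReal (m / 2) := by
    have h1 : Tendsto (fun T : ℝ => ENNReal.ofReal (Real.exp (-(l * T)))) atTop (𝓝 0) := by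
      rw [← ENNReal.ofReal_zero]
      exact ENNReal.tendsto_ofReal (Real.tendsto_exp_neg_atTop_nhds_zero.comp
        (tendsto_id.const_mul_atTop hl0))
    have h2 := ENNReal.Tendsto.const_mul (ENNReal.Tendsto.const_mul h1 (Or.inr hK))
      (Or.inr (ENNReal.ofReal_ne_top (r := M)))
    rw [mul_zero, mul_zero] at h2
    exact (h2.eventually (gt_mem_nhds (by simpa using hm))).mono fun T hT => hT.le
  -- The martingale has mass at least `m`; at most `m / 2` comes from outside `O'`, and inside its
  -- density is at most `M exp(a T)`.
  refine ⟨m / 2 / M, by positivity, ?_⟩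
  filter_upwards [hsmall, eventually_gt_atTop 0] with T hTs hT
  have hmart := h.lintegral_exp_empiricalMeasure H.feller H.continuous_rate H.rate_pos hf hpos hT
  set g : Ω → ℝ≥0∞ := fun ω => ENNReal.ofReal (f (jumpProcess q X τ T ω) * Real.exp
    (T * ∫ x, V x ∂(empiricalMeasure q X τ T ω : Measure S))) with hg
  set A : Set Ω := {ω | empiricalMeasure q X τ T ω ∈ O'} with hA
  have hgM : ∀ ω, g ω ≤ ENNReal.ofReal M * ENNReal.ofReal (Real.exp
      (T * ∫ x, V x ∂(empiricalMeasure q X τ T ω : Measure S))) := fun ω => by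
    rw [hg, ← ENNReal.ofReal_mul hM.le]
    refine ENNReal.ofReal_le_ofReal ?_
    gcongr
    exact (le_abs_self _).trans (hMf _)
  have hlow : ENNReal.ofReal m ≤ ∫⁻ ω, g ω ∂P := by
    rw [hmart]
    calc ENNReal.ofReal m = ∫⁻ _, ENNReal.ofReal m ∂P := by simp
      _ ≤ _ := lintegral_mono fun ω => ENNReal.ofReal_le_ofReal (hmf _)
  have hsplit : ∫⁻ ω, g ω ∂P ≤ ∫⁻ ω in A, g ω ∂P + ∫⁻ ω in Aᶜ, g ω ∂P := by
    rw [← lintegral_add_measure]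
    refine lintegral_mono' ?_ le_rfl
    have := Measure.restrict_union_le (μ := P) A Aᶜ
    rwa [Set.union_compl_self, Measure.restrict_univ] at this
  have hfar : ∫⁻ ω in Aᶜ, g ω ∂P ≤ ENNReal.ofReal (m / 2) := by
    refine le_trans ?_ hTs
    refine le_trans ?_ (mul_le_mul_right (hb T hT) _)
    rw [← lintegral_const_mul' _ _ ENNReal.ofReal_ne_top]
    exact lintegral_mono hgM
  have hnear : ∫⁻ ω in A, g ω ∂P ≤ ENNReal.ofReal (M * Real.exp (a * T)) * P A := by
    rw [← setLIntegral_const]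
    refine setLIntegral_mono measurable_const fun ω hω => (hgM ω).trans ?_
    rw [← ENNReal.ofReal_mul hM.le]
    refine ENNReal.ofReal_le_ofReal (mul_le_mul_of_nonneg_left (Real.exp_le_exp.2 ?_) hM.le)
    have : ∫ x, V x ∂(empiricalMeasure q X τ T ω : Measure S) < a := hω.2
    nlinarith
  have hhalf : ENNReal.ofReal (m / 2) ≤ ENNReal.ofReal (M * Real.exp (a * T)) * P A := by
    have h1 := hlow.trans (hsplit.trans (add_le_add hnear hfar))
    have h2 : ENNReal.ofReal m = ENNReal.ofReal (m / 2) + ENNReal.ofReal (m / 2) := by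
      rw [← ENNReal.ofReal_add (by positivity) (by positivity), add_halves]
    rw [h2] at h1
    exact (ENNReal.add_le_add_iff_right ENNReal.ofReal_ne_top).1 h1
  calc ENNReal.ofReal (m / 2 / M * Real.exp (-(a * T)))
      = ENNReal.ofReal (m / 2) / ENNReal.ofReal (M * Real.exp (a * T)) := by
        rw [← ENNReal.ofReal_div_of_pos (by positivity)]
        congr 1
        rw [Real.exp_neg]
        field_simp
    _ ≤ P A := ENNReal.div_le_of_le_mul' hhalf
    _ ≤ _ := measure_mono fun ω hω => hω.1

/-- As a regularization, the rate is nearly attained inside `O` by an absolutely continuous measure,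
and then by one with squared continuous density. -/
theorem ReversibleJump.le_liminf (H : ReversibleJump q α μ) (h : IsJumpData P α X τ)
    {O : Set (ProbabilityMeasure S)} (hO : IsOpen O) :
    - (⨅ η ∈ O, rate q α μ η) ≤ liminf (fun T : ℝ => ((1 / T : ℝ) : EReal) *
        ENNReal.log (P {ω | empiricalMeasure q X τ T ω ∈ O})) atTop := by
  by_contra hlt
  push Not at hlt
  obtain ⟨r, hr1, hr2⟩ := EReal.lt_iff_exists_real_btwn.1 hlt
  have hr : (⨅ η ∈ O, rate q α μ η) < ((-r : ℝ) : EReal) := by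
    rw [EReal.coe_neg]; exact EReal.lt_neg_comm.1 hr2
  obtain ⟨η, hη, hηr⟩ := by simpa only [iInf_lt_iff, exists_prop] using hr
  have hfreq : ∃ᶠ ν in 𝓝[acMeasures μ] η, rateOnAC q α μ ν < ((-r : ℝ) : EReal) :=
    frequently_lt_of_liminf_lt (h := hηr)
  obtain ⟨ν, hνr, hνO, hνac⟩ := (hfreq.and_eventually
    (Filter.Eventually.and (nhdsWithin_le_nhds (hO.mem_nhds hη) : ∀ᶠ ν in 𝓝[acMeasures μ] η, ν ∈ O)
      (self_mem_nhdsWithin : ∀ᶠ ν in 𝓝[acMeasures μ] η, ν ∈ acMeasures μ))).exists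
  rw [H.rateOnAC_eq, EReal.coe_lt_coe_iff] at hνr
  obtain ⟨f, hf, hpos, ν', hν', hν'O, hlt'⟩ := H.exists_squareLaw_mem hO hνO hνac hνr
  obtain ⟨c, hc, hP⟩ := H.exists_le_measure h hO hf hpos hν' hν'O hlt'
  have := le_liminf_log_of_le hc hP
  rw [neg_neg] at this
  exact absurd hr1 (not_lt.2 this)

end LargeDeviations

/-! ### The stationary law and verification of the standing assumptions -/

section StationaryLaw

variable {S : Type*} [MeasurableSpace S] {q : S → ℝ} {π' : Measure S} [IsProbabilityMeasure π']

theorem lintegral_inv_rate_ne {K₁ K₂ : ℝ} (hK₁ : 0 < K₁) (hq : ∀ x, K₁ ≤ q x ∧ q x ≤ K₂) :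
    ∫⁻ x, ENNReal.ofReal (1 / q x) ∂π' ≠ 0 ∧ ∫⁻ x, ENNReal.ofReal (1 / q x) ∂π' ≠ ∞ := by
  obtain ⟨x₀⟩ := nonempty_of_isProbabilityMeasure π'
  have hK₂ : 0 < K₂ := hK₁.trans_le ((hq x₀).1.trans (hq x₀).2)
  constructor
  · have h1 : ENNReal.ofReal (1 / K₂) ≤ ∫⁻ x, ENNReal.ofReal (1 / q x) ∂π' := by
      calc _ = ∫⁻ _, ENNReal.ofReal (1 / K₂) ∂π' := by simp
        _ ≤ _ := lintegral_mono fun x => ENNReal.ofReal_le_ofReal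
          (one_div_le_one_div_of_le (hK₁.trans_le (hq x).1) (hq x).2)
    refine (lt_of_lt_of_le ?_ h1).ne'
    simpa using hK₂
  · have h1 : ∫⁻ x, ENNReal.ofReal (1 / q x) ∂π' ≤ ENNReal.ofReal (1 / K₁) := by
      calc _ ≤ ∫⁻ _, ENNReal.ofReal (1 / K₁) ∂π' := lintegral_mono fun x =>
            ENNReal.ofReal_le_ofReal (one_div_le_one_div_of_le hK₁ (hq x).1)
        _ = _ := by simp
    exact (h1.trans_lt ENNReal.ofReal_lt_top).ne

theorem isProbabilityMeasure_stationaryLaw {K₁ K₂ : ℝ} (hK₁ : 0 < K₁)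
    (hq : ∀ x, K₁ ≤ q x ∧ q x ≤ K₂) : IsProbabilityMeasure (stationaryLaw q π') := by
  obtain ⟨h0, ht⟩ := lintegral_inv_rate_ne (π' := π') hK₁ hq
  refine ⟨?_⟩
  rw [stationaryLaw, Measure.smul_apply, withDensity_apply _ MeasurableSet.univ,
    setLIntegral_univ, smul_eq_mul, ENNReal.inv_mul_cancel h0 ht]

theorem absolutelyContinuous_stationaryLaw (hqm : Measurable q) {K₁ K₂ : ℝ} (hK₁ : 0 < K₁)
    (hq : ∀ x, K₁ ≤ q x ∧ q x ≤ K₂) :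
    π' ≪ stationaryLaw q π' ∧ stationaryLaw q π' ≪ π' := by
  obtain ⟨h0, ht⟩ := lintegral_inv_rate_ne (π' := π') hK₁ hq
  refine ⟨?_, ?_⟩
  · refine Measure.AbsolutelyContinuous.trans (withDensity_absolutelyContinuous'
      (f := fun x => ENNReal.ofReal (1 / q x)) (by fun_prop) ?_)
      (Measure.absolutelyContinuous_smul (ENNReal.inv_ne_zero.2 ht))
    exact Eventually.of_forall fun x => by simpa using hK₁.trans_le (hq x).1
  · exact Measure.smul_absolutelyContinuous.trans (withDensity_absolutelyContinuous _ _)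

theorem invariant_pow {α : Kernel S S} (h : α.Invariant π') (k : ℕ) : (α ^ k).Invariant π' := by
  induction k with
  | zero =>
    rw [pow_zero]
    exact Measure.bind_dirac
  | succ k ih =>
    rw [pow_succ]
    exact ih.comp h

end StationaryLaw

/-- Bounds on `q` make `π'` and the stationary law equivalent. Invariance of `π'` then gives the
almost-everywhere null condition for all powers, and the domination of `α^N` gives the everywhere
one. -/
theorem reversibleJump_stationaryLaw {S : Type*} [TopologicalSpace S] [MeasurableSpace S]
    [BorelSpace S] {q : S → ℝ} (hqc : Continuous q) {K₁ K₂ : ℝ} (hK₁ : 0 < K₁)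
    (hq : ∀ x, K₁ ≤ q x ∧ q x ≤ K₂) {α : Kernel S S} [IsMarkovKernel α] (hF : IsFeller α)
    (htrans : IsTransitive α) {π' : Measure S} [IsProbabilityMeasure π'] (hinv : α.Invariant π')
    (hbound : ∃ (N : ℕ) (c : ℝ≥0), 0 < c ∧ ∀ x, (α ^ N) x ≤ c • π')
    (hsupp : (stationaryLaw q π').support = Set.univ)
    (hrev : DetailedBalance q α (stationaryLaw q π')) :
    ReversibleJump q α (stationaryLaw q π') := by
  have hac := (absolutelyContinuous_stationaryLaw (π' := π') hqc.measurable hK₁ hq)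
  refine ⟨hqc, fun x => hK₁.trans_le (hq x).1, hF, htrans, ?_, ?_, hsupp, hrev⟩
  · intro A hA hA0 k
    have h1 : ∫⁻ x, (α ^ k) x A ∂π' = 0 := by
      rw [← Measure.bind_apply hA (α ^ k).measurable.aemeasurable, (invariant_pow hinv k).def]
      exact hac.1 hA0
    rw [lintegral_eq_zero_iff ((α ^ k).measurable_coe hA)] at h1
    exact hac.2.ae_le h1
  · obtain ⟨N, c, -, hN⟩ := hbound
    refine ⟨N, fun A _ hA0 x => le_antisymm ((hN x A).trans ?_) zero_le⟩
    rw [Measure.smul_apply, hac.1 hA0, smul_zero]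

end JumpLDP

theorem mainTheorem1
    {S : Type*} [TopologicalSpace S] [CompactSpace S] [PolishSpace S]
    [MeasurableSpace S] [BorelSpace S]
    (q : S → ℝ) (hq_cont : Continuous q)
    (K₁ K₂ : ℝ) (hK₁ : 0 < K₁) (hq : ∀ x, K₁ ≤ q x ∧ q x ≤ K₂)
    (α : Kernel S S) [IsMarkovKernel α]
    (h_feller : IsFeller α)
    (h_trans : IsTransitive α)
    -- an invariant distribution of the kernel
    (π' : Measure S) [IsProbabilityMeasure π'] (h_inv : α.Invariant π')
    (h_bound : ∃ (N : ℕ) (c : ℝ≥0), 0 < c ∧ ∀ x, (α ^ N) x ≤ c • π')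
    (h_supp : (stationaryLaw q π').support = Set.univ)
    (h_rev : DetailedBalance q α (stationaryLaw q π'))
    {Ω : Type*} [MeasurableSpace Ω] (P : Measure Ω) [IsProbabilityMeasure P]
    (X : ℕ → Ω → S) (τ : ℕ → Ω → ℝ) (h_data : IsJumpData P α X τ) :
    -- the rate function is a bounded lower semicontinuous extension
    LowerSemicontinuous (rate q α (stationaryLaw q π')) ∧
    (∀ η ∈ acMeasures (stationaryLaw q π'),
      rate q α (stationaryLaw q π') η = rateOnAC q α (stationaryLaw q π') η) ∧
    (∀ η, 0 ≤ rate q α (stationaryLaw q π') η ∧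
      rate q α (stationaryLaw q π') η ≤ ((⨆ x, q x : ℝ) : EReal)) ∧
    -- the lower bound
    (∀ O : Set (ProbabilityMeasure S), IsOpen O →
      - (⨅ η ∈ O, rate q α (stationaryLaw q π') η) ≤
        liminf (fun T : ℝ => ((1 / T : ℝ) : EReal) *
          ENNReal.log (P {ω | empiricalMeasure q X τ T ω ∈ O})) atTop) ∧
    -- the upper bound
    (∀ C : Set (ProbabilityMeasure S), IsClosed C →
      limsup (fun T : ℝ => ((1 / T : ℝ) : EReal) *
          ENNReal.log (P {ω | empiricalMeasure q X τ T ω ∈ C})) atTop ≤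
        - (⨅ η ∈ C, rate q α (stationaryLaw q π') η)) := by
  have := isProbabilityMeasure_stationaryLaw (π' := π') hK₁ hq
  have H := reversibleJump_stationaryLaw hq_cont hK₁ hq h_feller h_trans h_inv h_bound h_supp h_rev
  refine ⟨H.lowerSemicontinuous_rate, fun η _ => by rw [H.rate_eq, H.rateOnAC_eq], fun η => ?_,
    fun O hO => H.le_liminf h_data hO, fun C hC => H.limsup_le h_data hC⟩
  rw [H.rate_eq]
  exact ⟨by exact_mod_cast H.rateReal_nonneg η, EReal.coe_le_coe_iff.2 (H.rateReal_le η)⟩
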